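/- Let $k\ge 1$. For a $k$-tuple $\mathcal H=\{\mathcal L_1,\dots,\mathcal L_k\}$ of distinct linear forms $\mathcal L_i(n)=a_in+b_i$ with $a_i,b_i\in\mathbb Z$, $a_i\ge 1$, put $P(n;\mathcal H)=\prod_{i}\mathcal L_i(n)$ and $\nu_{\mathcal H}(p)=\#\{n \bmod p : P(n;\mathcal H)\equiv 0 \bmod p\}$. The tuple is admissible if $\nu_{\mathcal H}(p)<p$ for every prime $p$. Put $$\mathbf a(n)=\prod_{i=1}^k\Lambda(\mathcal L_i(n))\quad(n\ge 1),\qquad \mathbf a(n)=0\quad (n\le 0),$$ where $\Lambda$ is the von Mangoldt function, with $\Lambda(m)=0$ for $m\le 0$, and $$\mathcal A(x)=\sum_{1\le n\le x}\mathbf a(n),\qquad \mathcal A(x;q,a)=\sum_{\substack{1\le n\le x\\ n\equiv a \bmod q}}\mathbf a(n),\qquad \gamma(q)=\prod_{p\mid q}\Big(1-\frac{\nu_{\mathcal H}(p)}p\Big),$$ $$\mathfrak S(\mathcal H)=\prod_p\Big(1-\frac{\nu_{\mathcal H}(p)}p\Big)\Big(1-\frac1p\Big)^{-k}.$$ Let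 $\omega(n)$ denote the number of distinct prime factors of $n$. There is a real number $\delta_k>0$, depending only on $k$, with the following property. Fix $\delta>0$ and let $\mathbf L:\mathbb R\to\mathbb R$ be nondecreasing on $[0,\infty)$ with $\mathbf L(x)\to\infty$ as $x\to\infty$, and such that for some $\eta>0$ and all sufficiently large $x$, $$\mathbf L(x)^{1+\eta}\le \mathbf L\Big(\frac{x}{2\mathbf L(x)}\Big)^{1+\delta}$$ (for example, a power of $\log x$). Assume the Hardy–Littlewood prime $k$-tuple conjecture in the uniform form $$\mathcal A(x)=\mathfrak S(\mathcal H)\,x+O\Big(\frac{x}{\mathbf L(x)^{2+2\delta}}\Big),$$ uniformly over all admissible $k$-tuples $\mathcal H$ with $a_i\le \mathbf L(x)^{1+\delta}$ and $b_i=O(1)$ for all $i$; that is, for every $B$ there are $C$ and $x_0$ such that the error is at most $C x/\mathbf L(x)^{2+2\delta}$ for all $x\ge x_0$ and all admissible $k$-tuples with $1\le a_i\le\mathbf L(x)^{1+\delta}$ and $|b_i|\le B$. Let $\mathcal H$ be a fixed admissible $k$-tuple, let $a\ne 0$ be a fixed integer with $P(a;\mathcal H)\ne 0$, and let $M=M(x)$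 satisfy $M(x)\to\infty$ as $x\to\infty$ and $M(x)\le\mathbf L(x)$ for all large $x$. Write $P=P(a;\mathcal H)$ and $\omega=\omega(P)$. Then, as $x\to\infty$, the average $$\frac{1}{\frac{\phi(|P|)}{|P|}\,\frac{x}{2M}}\sum_{\substack{\frac{x}{2M}<q\le\frac xM\\ (q,P)=1}}\Big(\mathcal A(x;q,a)-\mathbf a(a)-\frac{\mathcal A(x)}{q\gamma(q)}\Big)$$ is $$\sim-\frac{(\log M)^{k-\omega}}{2\,(k-\omega)!}\prod_{p\mid P}\frac{p-\nu_{\mathcal H}(p)}{p-1}\log p\quad\text{if }\omega\le k,\qquad\text{and}\qquad O\big(M^{-\delta_k}\big)\quad\text{if }\omega>k.$$ -/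

import Mathlib

open Filter Asymptotics

namespace PrimeTuples

/-- A linear form `n ↦ slope * n + const` with integer coefficients. -/
@[ext] structure LinForm where
  slope : ℤ
  const : ℤ

/-- The value of a linear form at an integer. -/
def LinForm.eval (ℓ : LinForm) (n : ℤ) : ℤ := ℓ.slope * n + ℓ.const

/-- `P(n; H)`, the product of the values at `n` of the forms of the tuple `H`. -/
def prodForms {k : ℕ} (H : Fin k → LinForm) (n : ℤ) : ℤ := ∏ i, (H i).eval n

/-- `ν_H(p)`, the number of residue classes `n` mod `p` with `P(n; H) ≡ 0` mod `p`. -/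
def nu {k : ℕ} (H : Fin k → LinForm) (p : ℕ) : ℕ :=
  ((Finset.range p).filter (fun n : ℕ => (p : ℤ) ∣ prodForms H (n : ℤ))).card

/-- `H` is a tuple of distinct linear forms with positive leading coefficients, and it is
admissible: `ν_H(p) < p` for every prime `p`. -/
structure IsAdmissible {k : ℕ} (H : Fin k → LinForm) : Prop where
  distinct : Function.Injective H
  slope_pos : ∀ i, 1 ≤ (H i).slope
  nu_lt : ∀ p : ℕ, p.Prime → nu H p < p

/-- The sequence `n ↦ ∏ i, Λ (ℒ_i n)`, indexed by the positive integers and extended by `0` to the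
other integers. The von Mangoldt function is taken to vanish at integers `≤ 0`. -/
noncomputable def seq {k : ℕ} (H : Fin k → LinForm) (n : ℤ) : ℝ :=
  if 1 ≤ n then ∏ i, ArithmeticFunction.vonMangoldt ((H i).eval n).toNat else 0

/-- The counting function `𝒜(x) = ∑_{1 ≤ n ≤ x} seq H n`. -/
noncomputable def countAll {k : ℕ} (H : Fin k → LinForm) (x : ℝ) : ℝ :=
  ∑ n ∈ Finset.Icc 1 ⌊x⌋₊, seq H (n : ℤ)

/-- The counting function `𝒜(x; q, a) = ∑_{1 ≤ n ≤ x, n ≡ a mod q} seq H n`. -/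
noncomputable def countProg {k : ℕ} (H : Fin k → LinForm) (x : ℝ) (q : ℕ) (a : ℤ) : ℝ :=
  ∑ n ∈ (Finset.Icc 1 ⌊x⌋₊).filter (fun n : ℕ => (n : ℤ) ≡ a [ZMOD (q : ℤ)]), seq H (n : ℤ)

/-- The singular series `𝔖(H) = ∏_p (1 - ν_H(p)/p) (1 - 1/p)^{-k}` (over all primes; the product
converges absolutely for admissible `H`). -/
noncomputable def singularSeries {k : ℕ} (H : Fin k → LinForm) : ℝ :=
  ∏' p : Nat.Primes,
    (1 - (nu H (p : ℕ) : ℝ) / ((p : ℕ) : ℝ)) * ((1 - 1 / ((p : ℕ) : ℝ)) ^ k)⁻¹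

/-- `γ(q) = ∏_{p ∣ q} (1 - ν_H(p)/p)`. -/
noncomputable def gam {k : ℕ} (H : Fin k → LinForm) (q : ℕ) : ℝ :=
  ∏ p ∈ q.primeFactors, (1 - (nu H p : ℝ) / (p : ℝ))

/-- The Hardy-Littlewood prime `k`-tuple conjecture with error term `O(x / L(x)^{2+2δ})`, uniformly
over the admissible `k`-tuples of linear forms `a_i n + b_i` with `1 ≤ a_i ≤ L(x)^{1+δ}` and
`b_i = O(1)`: for each bound `B` on the `|b_i|` there is one implied constant. -/
def UniformHardyLittlewood (k : ℕ) (δ : ℝ) (L : ℝ → ℝ) : Prop :=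
  ∀ B : ℝ, ∃ C : ℝ, ∀ᶠ x : ℝ in atTop, ∀ H : Fin k → LinForm, IsAdmissible H →
    (∀ i, ((H i).slope : ℝ) ≤ L x ^ (1 + δ)) → (∀ i, |((H i).const : ℝ)| ≤ B) →
      |countAll H x - singularSeries H * x| ≤ C * (x / L x ^ (2 + 2 * δ))

/-- `ω(n)`, the number of distinct prime factors of a nonzero integer. -/
def omegaInt (n : ℤ) : ℕ := n.natAbs.primeFactors.card

/-- The dyadic average over `x/(2M) < q ≤ x/M`, `(q, P(a; H)) = 1`, of
`𝒜(x; q, a) - seq H a - 𝒜(x) / (q γ(q))`, normalized by `(φ(P)/P) * x/(2M)` with `P = P(a; H)`. -/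
noncomputable def dyadicAverage {k : ℕ} (H : Fin k → LinForm) (a : ℤ) (x M : ℝ) : ℝ :=
  (((prodForms H a).natAbs.totient : ℝ) / ((prodForms H a).natAbs : ℝ) * (x / (2 * M)))⁻¹ *
    ∑ q ∈ (Finset.Ioc ⌊x / (2 * M)⌋₊ ⌊x / M⌋₊).filter
        (fun q : ℕ => q.Coprime (prodForms H a).natAbs),
      (countProg H x q a - seq H a - countAll H x / ((q : ℝ) * gam H q))

/-- The main term
`-(log M)^{k-ω} / (2 (k-ω)!) * ∏_{p ∣ P(a; H)} (p - ν_H(p))/(p - 1) * log p`, `ω = ω(P(a; H))`;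
it is only used for `ω ≤ k`. -/
noncomputable def mainTerm {k : ℕ} (H : Fin k → LinForm) (a : ℤ) (M : ℝ) : ℝ :=
  -(Real.log M ^ (k - omegaInt (prodForms H a)) /
      (2 * ((k - omegaInt (prodForms H a)).factorial : ℝ))) *
    ∏ p ∈ (prodForms H a).natAbs.primeFactors,
      ((p : ℝ) - (nu H p : ℝ)) / ((p : ℝ) - 1) * Real.log (p : ℝ)

end PrimeTuples

/-! Write n = a + qr. As q runs over (x/(2M), x/M] and n ≤ x, the cofactor r is O(M), and for fixed
r the values ℒ_i(a + qr) are linear forms in q with slope a_i r and constant term ℒ_i(a). So large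
moduli can be exchanged for small ones, and the uniform conjecture applies to each `shiftTuple`. For
r coprime to P its singular series is 𝔖(H)/γ(r) (`singularSeries_shiftTuple`). If qr shares a prime
p with P and the product of the Λ does not vanish, then some form takes a power of a prime divisor
of P as its value, which is rare (`card_bad_le`).

With y = x/M, the switched sum is close to 𝔖(H) y ∑ γ(r)⁻¹ w(M/r) and the expected one to 𝔖(H) M ∑
γ(q)⁻¹ w'(y/q), over r and q coprime to P, where w is `rampWeight` and w' is `dyadicWeight`. On the
integers coprime to P, 1/γ is the Dirichlet convolution of 1 with `kernelFun`, whose Dirichlet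
series is G(s) ∏_{p ∣ P} (1 - p^{-s}) ζ(s+1)^k (`oneFun_mul_kernelFun`), with G absolutely
convergent at s = -1/4 (`wsummable_corrFun`). Both w(1/t) and w'(1/t) have integral log 2 over t >
0, so the two linear main terms cancel. There remains 𝔖(H) y times the action of the kernel on
`rampDefect` at M, and `rampDefect` tends to -1/4 with rate 1/u (`hasLimitRate_rampDefect`).

In analytic terms, a pole of order k at s = 0 meets a zero of order ω. The argument is elementary
instead. A factor (1 - p^{-s}) ζ(s+1) turns a limit c with a power rate into the limit c log p,
again with a power rate (`HasLimitRate.diff_inv`); a leftover ζ(s+1) integrates against du/u and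
raises the power of the logarithm (`HasLogGrowth.dilSum_invFun`); a leftover 1 - p^{-s} annihilates
the limit and leaves only the rate. These are the two cases ω ≤ k (`tendsto_dilSum_of_card_le`) and
ω > k (`abs_dilSum_le_of_lt_card`). The constant comes from 𝔖(H) G(0) = ∏_{p ∣ P} (1 - ν(p)/p)
(`tprod_localFactor_mul_tsum`).

The errors are negligible because L(x)³ = O(x), which the conjecture itself forces
(`exists_cube_le`). -/

namespace PrimeTuples

open Topology

/-! ### Arithmetic functions acting by dilations -/

/-- The action `Φ ↦ (y ↦ ∑ n, α n * Φ (y / n))` of an arithmetic function on functions. -/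
noncomputable def dilSum (α : ArithmeticFunction ℝ) (Φ : ℝ → ℝ) (y : ℝ) : ℝ :=
  ∑' n : ℕ, α n * Φ (y / n)

/-- Absolute convergence of the Dirichlet series of `α` at `σ`. -/
def WSummable (σ : ℝ) (α : ArithmeticFunction ℝ) : Prop :=
  Summable fun n : ℕ => |α n| * (n : ℝ) ^ (-σ)

/-- Group the pairs by their product. The fibre over 0 is the union of the two axes, while
`Nat.divisorsAntidiagonal 0` is empty; hence the two vanishing hypotheses. -/
lemma hasSum_divisorsAntidiagonal {F : ℕ × ℕ → ℝ} (hF : Summable F)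
    (h1 : ∀ b, F (0, b) = 0) (h2 : ∀ a, F (a, 0) = 0) :
    HasSum (fun n : ℕ => ∑ x ∈ n.divisorsAntidiagonal, F x) (∑' x, F x) := by
  have h := hF.hasSum.tsum_fiberwise (fun x : ℕ × ℕ => x.1 * x.2)
  convert! h using 2 with n
  rcases eq_or_ne n 0 with rfl | hn
  · simp only [Nat.divisorsAntidiagonal_zero, Finset.sum_empty]
    symm
    convert tsum_zero with x
    obtain ⟨⟨a, b⟩, hx⟩ := x
    have : a * b = 0 := hx
    rcases Nat.mul_eq_zero.1 this with rfl | rfl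
    · exact h1 b
    · exact h2 a
  · have : (fun x : ℕ × ℕ => x.1 * x.2) ⁻¹' {n} = (n.divisorsAntidiagonal : Set (ℕ × ℕ)) := by
      ext x; simp [hn]
    rw [this]
    exact (Finset.tsum_subtype' n.divisorsAntidiagonal F).symm

lemma WSummable.mono {σ τ : ℝ} {α : ArithmeticFunction ℝ} (h : WSummable σ α) (hστ : σ ≤ τ) :
    WSummable τ α := by
  refine Summable.of_nonneg_of_le (fun n => by positivity) (fun n => ?_) h
  rcases Nat.eq_zero_or_pos n with rfl | hn
  · simp
  · gcongr
    exact_mod_cast hn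

lemma WSummable.nonneg_tsum {σ : ℝ} {α : ArithmeticFunction ℝ} :
    0 ≤ ∑' n : ℕ, |α n| * (n : ℝ) ^ (-σ) := tsum_nonneg fun n => by positivity

lemma WSummable.prod {σ : ℝ} {α β : ArithmeticFunction ℝ} (hα : WSummable σ α)
    (hβ : WSummable σ β) :
    Summable fun x : ℕ × ℕ => (|α x.1| * (x.1 : ℝ) ^ (-σ)) * (|β x.2| * (x.2 : ℝ) ^ (-σ)) :=
  Summable.mul_of_nonneg hα hβ (fun n => by positivity) (fun n => by positivity)

lemma WSummable.mul {σ : ℝ} {α β : ArithmeticFunction ℝ} (hα : WSummable σ α)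
    (hβ : WSummable σ β) : WSummable σ (α * β) := by
  have h := hasSum_divisorsAntidiagonal (hα.prod hβ) (by simp) (by simp)
  refine Summable.of_nonneg_of_le (fun n => by positivity) (fun n => ?_) h.summable
  rw [ArithmeticFunction.mul_apply]
  calc |∑ x ∈ n.divisorsAntidiagonal, α x.1 * β x.2| * (n : ℝ) ^ (-σ)
      ≤ (∑ x ∈ n.divisorsAntidiagonal, |α x.1 * β x.2|) * (n : ℝ) ^ (-σ) := by
        gcongr; exact Finset.abs_sum_le_sum_abs _ _
    _ = _ := by
        rw [Finset.sum_mul]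
        refine Finset.sum_congr rfl fun x hx => ?_
        rw [← (Nat.mem_divisorsAntidiagonal.1 hx).1, abs_mul, Nat.cast_mul,
          Real.mul_rpow (by positivity) (by positivity)]
        ring

lemma WSummable.one (σ : ℝ) : WSummable σ 1 := by
  refine summable_of_ne_finset_zero (s := {1}) fun n hn => ?_
  rw [ArithmeticFunction.one_apply_ne (by simpa using hn)]; simp

lemma WSummable.pow {σ : ℝ} {α : ArithmeticFunction ℝ} (hα : WSummable σ α) (j : ℕ) :
    WSummable σ (α ^ j) := by
  induction j with
  | zero => simpa using WSummable.one σ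
  | succ j ih => rw [pow_succ]; exact ih.mul hα

lemma WSummable.finset_prod {ι : Type*} {σ : ℝ} {α : ι → ArithmeticFunction ℝ} (s : Finset ι)
    (hα : ∀ i ∈ s, WSummable σ (α i)) : WSummable σ (∏ i ∈ s, α i) := by
  classical
  induction s using Finset.induction_on with
  | empty => simpa using WSummable.one σ
  | insert i s hi ih =>
    rw [Finset.prod_insert hi]
    exact (hα i (by simp)).mul (ih fun j hj => hα j (by simp [hj]))

lemma abs_term_le {σ K : ℝ} {α : ArithmeticFunction ℝ} {Φ : ℝ → ℝ}
    (hΦ : ∀ u, 0 < u → |Φ u| ≤ K * u ^ σ) {y : ℝ} (hy : 0 < y) (n : ℕ) :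
    |α n * Φ (y / n)| ≤ K * y ^ σ * (|α n| * (n : ℝ) ^ (-σ)) := by
  rcases Nat.eq_zero_or_pos n with rfl | hn
  · simp
  · have hn' : (0 : ℝ) < n := by exact_mod_cast hn
    rw [abs_mul]
    calc |α n| * |Φ (y / n)| ≤ |α n| * (K * (y / n) ^ σ) := by
          gcongr; exact hΦ _ (by positivity)
      _ = _ := by
        rw [Real.div_rpow hy.le hn'.le, Real.rpow_neg hn'.le]; ring

lemma summable_term {σ K : ℝ} {α : ArithmeticFunction ℝ} (hα : WSummable σ α) {Φ : ℝ → ℝ}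
    (hΦ : ∀ u, 0 < u → |Φ u| ≤ K * u ^ σ) {y : ℝ} (hy : 0 < y) :
    Summable fun n : ℕ => α n * Φ (y / n) :=
  Summable.of_norm_bounded (hα.mul_left (K * y ^ σ)) fun n => abs_term_le hΦ hy n

lemma abs_dilSum_le {σ K : ℝ} {α : ArithmeticFunction ℝ} (hα : WSummable σ α) {Φ : ℝ → ℝ}
    (hΦ : ∀ u, 0 < u → |Φ u| ≤ K * u ^ σ) {y : ℝ} (hy : 0 < y) :
    |dilSum α Φ y| ≤ (K * ∑' n : ℕ, |α n| * (n : ℝ) ^ (-σ)) * y ^ σ := by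
  have := tsum_of_norm_bounded (f := fun n : ℕ => α n * Φ (y / n))
    (hα.hasSum.mul_left (K * y ^ σ)) fun n => abs_term_le hΦ hy n
  rw [Real.norm_eq_abs] at this
  calc |dilSum α Φ y| ≤ _ := this
    _ = _ := by ring

/-- Dirichlet convolution becomes composition of actions, so the factors of a convolution may be
applied one at a time in any order. The power bound on Φ makes the double sum absolutely convergent.
-/
lemma dilSum_mul {σ K : ℝ} {α β : ArithmeticFunction ℝ} (hα : WSummable σ α)
    (hβ : WSummable σ β) {Φ : ℝ → ℝ} (hΦ : ∀ u, 0 < u → |Φ u| ≤ K * u ^ σ) {y : ℝ} (hy : 0 < y) :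
    dilSum (α * β) Φ y = dilSum α (dilSum β Φ) y := by
  set F : ℕ × ℕ → ℝ := fun x => α x.1 * (β x.2 * Φ (y / x.1 / x.2)) with hFdef
  have hF : Summable F := by
    refine Summable.of_norm_bounded ((hα.prod hβ).mul_left (K * y ^ σ)) fun x => ?_
    rcases Nat.eq_zero_or_pos x.1 with h | hn
    · simp [hFdef, h]
    have hn' : (0 : ℝ) < x.1 := by exact_mod_cast hn
    have := abs_term_le (α := β) hΦ (y := y / x.1) (by positivity) x.2
    rw [Real.norm_eq_abs, hFdef, abs_mul]
    calc _ ≤ |α x.1| * (K * (y / x.1) ^ σ * (|β x.2| * (x.2 : ℝ) ^ (-σ))) := by gcongr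
      _ = _ := by rw [Real.div_rpow hy.le hn'.le, Real.rpow_neg hn'.le]; ring
  have h := hasSum_divisorsAntidiagonal hF (by simp [hFdef]) (by simp [hFdef])
  rw [hF.tsum_prod] at h
  have h2 : ∑' (a : ℕ) (b : ℕ), F (a, b) = dilSum α (dilSum β Φ) y := by
    simp only [hFdef, dilSum, tsum_mul_left]
  rw [← h2, ← h.tsum_eq, dilSum]
  refine tsum_congr fun n => ?_
  rw [ArithmeticFunction.mul_apply, Finset.sum_mul]
  refine Finset.sum_congr rfl fun x hx => ?_
  rw [← (Nat.mem_divisorsAntidiagonal.1 hx).1, Nat.cast_mul, ← div_div]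
  simp only [hFdef]
  ring

/-! ### Limits with a power rate, and the factor (1 - p^{-s}) ζ(s+1) -/

/-- Functions on `(0, ∞)` that are Lipschitz, at most linear, and tend to `c` with rate
`u ^ (-δ)`. -/
structure HasLimitRate (Φ : ℝ → ℝ) (c δ : ℝ) : Prop where
  lipschitz : ∃ K, 0 ≤ K ∧ ∀ u v, 0 < u → 0 < v → |Φ u - Φ v| ≤ K * |u - v|
  linear : ∃ K, 0 ≤ K ∧ ∀ u, 0 < u → |Φ u| ≤ K * u
  rate : ∃ K, 0 ≤ K ∧ ∀ u, 0 < u → |Φ u - c| ≤ K * u ^ (-δ)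

lemma dilSum_linear {α : ArithmeticFunction ℝ} (hα : WSummable 1 α) {Φ : ℝ → ℝ}
    (hΦ : ∃ K, 0 ≤ K ∧ ∀ u, 0 < u → |Φ u| ≤ K * u) :
    ∃ K, 0 ≤ K ∧ ∀ u, 0 < u → |dilSum α Φ u| ≤ K * u := by
  obtain ⟨K, hK, h⟩ := hΦ
  refine ⟨_, mul_nonneg hK (WSummable.nonneg_tsum (α := α) (σ := 1)), fun u hu => ?_⟩
  simpa using abs_dilSum_le hα (K := K) (by simpa using h) hu

lemma dilSum_lipschitz {α : ArithmeticFunction ℝ} (hα : WSummable 1 α) {Φ : ℝ → ℝ}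
    (hΦ : ∃ K, 0 ≤ K ∧ ∀ u, 0 < u → |Φ u| ≤ K * u)
    (hL : ∃ K, 0 ≤ K ∧ ∀ u v, 0 < u → 0 < v → |Φ u - Φ v| ≤ K * |u - v|) :
    ∃ K, 0 ≤ K ∧ ∀ u v, 0 < u → 0 < v → |dilSum α Φ u - dilSum α Φ v| ≤ K * |u - v| := by
  obtain ⟨K, hK, h⟩ := hΦ
  obtain ⟨K', hK', h'⟩ := hL
  refine ⟨_, mul_nonneg hK' (WSummable.nonneg_tsum (α := α) (σ := 1)), fun u v hu hv => ?_⟩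
  have hu' := summable_term hα (K := K) (by simpa using h) hu
  have hv' := summable_term hα (K := K) (by simpa using h) hv
  rw [dilSum, dilSum, ← hu'.tsum_sub hv']
  have := tsum_of_norm_bounded (f := fun n : ℕ => α n * Φ (u / n) - α n * Φ (v / n))
    (hα.hasSum.mul_left (K' * |u - v|)) fun n => ?_
  · rw [Real.norm_eq_abs] at this
    calc _ ≤ _ := this
      _ = _ := by ring
  · rcases Nat.eq_zero_or_pos n with rfl | hn
    · simp
    have hn' : (0 : ℝ) < n := by exact_mod_cast hn
    rw [Real.norm_eq_abs, ← mul_sub, abs_mul]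
    calc _ ≤ |α n| * (K' * |u / n - v / n|) := by
          gcongr; exact h' _ _ (by positivity) (by positivity)
      _ = _ := by
        rw [← sub_div, abs_div, abs_of_pos hn', Real.rpow_neg_one]; ring

/-- The arithmetic function `n ↦ 1 / n`. -/
noncomputable def invFun : ArithmeticFunction ℝ := ⟨fun n => (n : ℝ)⁻¹, by simp⟩

@[simp] lemma invFun_apply (n : ℕ) : invFun n = (n : ℝ)⁻¹ := rfl

lemma wsummable_invFun {σ : ℝ} (hσ : 0 < σ) : WSummable σ invFun := by
  have := Real.summable_nat_rpow (p := -(1 + σ)) |>.2 (by linarith)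
  refine this.congr fun n => ?_
  rcases Nat.eq_zero_or_pos n with rfl | hn
  · simp [Real.zero_rpow (by linarith : -σ + -1 ≠ 0)]
  have hn' : (0 : ℝ) < n := by exact_mod_cast hn
  rw [invFun_apply, abs_of_pos (by positivity), ← Real.rpow_neg_one, ← Real.rpow_add hn']
  congr 1; ring

/-- The arithmetic function with Dirichlet series `1 - p ^ (-s)`. -/
noncomputable def diffFun (p : ℕ) : ArithmeticFunction ℝ :=
  ⟨fun n => (if n = 1 then 1 else 0) - (if n = p ∧ n ≠ 0 then 1 else 0), by simp⟩

lemma diffFun_apply (p n : ℕ) :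
    diffFun p n = (if n = 1 then 1 else 0) - (if n = p ∧ n ≠ 0 then 1 else 0) := rfl

lemma wsummable_diffFun (σ : ℝ) (p : ℕ) : WSummable σ (diffFun p) := by
  refine summable_of_ne_finset_zero (s := {1, p}) fun n hn => ?_
  simp only [Finset.mem_insert, Finset.mem_singleton, not_or] at hn
  simp [diffFun_apply, hn.1, hn.2]

lemma dilSum_diffFun {p : ℕ} (hp : 1 < p) (Φ : ℝ → ℝ) (y : ℝ) :
    dilSum (diffFun p) Φ y = Φ y - Φ (y / p) := by
  rw [dilSum, tsum_eq_sum (s := {1, p})]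
  · rw [Finset.sum_pair (by omega)]
    have : p ≠ 1 := by omega
    have h0 : p ≠ 0 := by omega
    simp [diffFun_apply, this, h0, hp.ne]
    ring
  · intro n hn
    simp only [Finset.mem_insert, Finset.mem_singleton, not_or] at hn
    simp [diffFun_apply, hn.1, hn.2]

/-- By concavity of t^δ (Bernoulli with an exponent at most 1), each step of t^δ/δ is at least the
next term of the sum. -/
lemma sum_inv_mul_rpow_le {δ : ℝ} (hδ : 0 < δ) (hδ1 : δ ≤ 1) (X : ℕ) :
    ∑ m ∈ Finset.range (X + 1), (m : ℝ)⁻¹ * (m : ℝ) ^ δ ≤ (X : ℝ) ^ δ / δ := by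
  induction X with
  | zero => simp [Real.zero_rpow hδ.ne']
  | succ X ih =>
    rw [Finset.sum_range_succ]
    have hX : (0 : ℝ) < (X + 1 : ℕ) := by positivity
    set z : ℝ := ((X + 1 : ℕ) : ℝ) with hz
    have hXz : (X : ℝ) = z * (1 + (-z⁻¹)) := by
      field_simp; rw [hz]; push_cast; ring
    have hz1 : z⁻¹ ≤ 1 := inv_le_one_of_one_le₀ (by rw [hz]; push_cast; linarith [X.cast_nonneg (α := ℝ)])
    have h := rpow_one_add_le_one_add_mul_self (s := -z⁻¹) (by linarith) hδ.le hδ1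
    have h2 : (X : ℝ) ^ δ ≤ z ^ δ * (1 + δ * (-z⁻¹)) := by
      rw [hXz, Real.mul_rpow hX.le (by linarith)]
      gcongr
    have h3 : (X : ℝ) ^ δ / δ ≤ z ^ δ / δ - z⁻¹ * z ^ δ := by
      rw [div_le_iff₀ hδ, sub_mul, div_mul_cancel₀ _ hδ.ne']
      linarith
    linarith

lemma sum_range_inv_eq_harmonic (n : ℕ) :
    ∑ m ∈ Finset.range (n + 1), (m : ℝ)⁻¹ = (harmonic n : ℝ) := by
  rw [Finset.sum_range_succ', harmonic]
  simp

lemma harmonic_bounds {n : ℕ} (hn : 0 < n) :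
    Real.eulerMascheroniConstant + Real.log n ≤ (harmonic n : ℝ) ∧
      (harmonic n : ℝ) ≤ Real.eulerMascheroniConstant + Real.log (n + 1) := by
  have h1 := Real.eulerMascheroniSeq_lt_eulerMascheroniConstant n
  have h2 := Real.eulerMascheroniConstant_lt_eulerMascheroniSeq' n
  rw [Real.eulerMascheroniSeq] at h1
  rw [Real.eulerMascheroniSeq', if_neg hn.ne'] at h2
  constructor <;> linarith

lemma log_succ_sub_log_le {N : ℝ} (hN : 0 < N) : Real.log (N + 1) - Real.log N ≤ 1 / N := by
  rw [← Real.log_div (by positivity) (by positivity)]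
  have := Real.log_le_sub_one_of_pos (x := (N + 1) / N) (by positivity)
  calc _ ≤ _ := this
    _ = _ := by field_simp; ring

/-- Both sums are harmonic numbers, since the term at 0 is 0. A harmonic number H_n lies between γ +
log n and γ + log (n+1), and the top index X of the longer sum satisfies X + 1 = p(N+1), so the
difference of the logarithms is log p up to log (N+1) - log N. -/
lemma abs_harmonic_sub_le {p N : ℕ} (hp : 0 < p) (hN : 0 < N) :
    |∑ m ∈ Finset.range (p * (N + 1)), (m : ℝ)⁻¹ - ∑ n ∈ Finset.range (N + 1), (n : ℝ)⁻¹
      - Real.log p| ≤ 1 / N := by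
  obtain ⟨X, hX⟩ : ∃ X, p * (N + 1) = X + 1 := ⟨p * (N + 1) - 1, by
    have : 0 < p * (N + 1) := by positivity
    omega⟩
  have hXN : p * N ≤ X := by nlinarith
  have hX0 : 0 < X := lt_of_lt_of_le (by positivity) hXN
  rw [hX, sum_range_inv_eq_harmonic, sum_range_inv_eq_harmonic]
  have hXr : (p : ℝ) * (N + 1) = X + 1 := by exact_mod_cast hX
  have hXNr : (p : ℝ) * N ≤ X := by exact_mod_cast hXN
  have hp' : (0 : ℝ) < p := by exact_mod_cast hp
  have hN' : (0 : ℝ) < N := by exact_mod_cast hN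
  obtain ⟨a1, a2⟩ := harmonic_bounds hX0
  obtain ⟨b1, b2⟩ := harmonic_bounds hN
  have h1 := log_succ_sub_log_le hN'
  have h2 : Real.log (X + 1) = Real.log p + Real.log (N + 1) := by
    rw [← hXr, Real.log_mul (by positivity) (by positivity)]
  have h3 : Real.log p + Real.log N ≤ Real.log X := by
    rw [← Real.log_mul (by positivity) (by positivity)]
    exact Real.log_le_log (by positivity) hXNr
  rw [abs_le]
  constructor <;> linarith

/-- The increments are dominated by the telescoping differences 1/z² - 1/(z+1)². -/
lemma abs_sub_le_of_tendsto {D : ℕ → ℝ} {U b : ℝ} (hb : 0 ≤ b) (hD : Tendsto D atTop (𝓝 U))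
    (h : ∀ K, |D (K + 1) - D K| ≤ b / ((K : ℝ) + 1) ^ 3) {N : ℕ} (hN : 0 < N) :
    |U - D N| ≤ b / (N : ℝ) ^ 2 := by
  have key : ∀ j : ℕ, |D (N + j) - D N| ≤ b * (1 / (N : ℝ) ^ 2 - 1 / ((N + j : ℕ) : ℝ) ^ 2) := by
    intro j
    induction j with
    | zero => simp
    | succ j ih =>
      have h1 := h (N + j)
      set z : ℝ := ((N + j : ℕ) : ℝ) with hz
      have hz0 : 0 < z := by rw [hz]; exact_mod_cast (by omega : 0 < N + j)
      have hz1 : (((N + (j + 1) : ℕ)) : ℝ) = z + 1 := by rw [hz]; push_cast; ring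
      rw [hz1]
      have h2 : 1 / (z + 1) ^ 3 ≤ 1 / z ^ 2 - 1 / (z + 1) ^ 2 := by
        rw [div_sub_div _ _ (by positivity) (by positivity),
          div_le_div_iff₀ (by positivity) (by positivity)]
        nlinarith [pow_pos hz0 2, pow_pos hz0 3, pow_pos hz0 4, pow_pos hz0 1]
      have h3 : b / (z + 1) ^ 3 ≤ b * (1 / z ^ 2 - 1 / (z + 1) ^ 2) := by
        rw [div_eq_mul_one_div]; gcongr
      calc |D (N + (j + 1)) - D N| ≤ |D (N + j + 1) - D (N + j)| + |D (N + j) - D N| :=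
            abs_sub_le _ _ _
        _ ≤ b * (1 / z ^ 2 - 1 / (z + 1) ^ 2) + b * (1 / (N : ℝ) ^ 2 - 1 / z ^ 2) :=
            add_le_add (h1.trans h3) ih
        _ = _ := by ring
  have ht : Tendsto (fun j => |D (N + j) - D N|) atTop (𝓝 |U - D N|) := by
    refine ((Tendsto.comp hD ?_).sub_const _).abs
    exact tendsto_atTop_mono (fun j => Nat.le_add_left j N) tendsto_id
  refine le_of_tendsto ht (Eventually.of_forall fun j => (key j).trans ?_)
  rw [div_eq_mul_one_div b]
  have : 0 ≤ 1 / ((N + j : ℕ) : ℝ) ^ 2 := by positivity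
  gcongr
  linarith

/-- Replaces a derivative bound for s ↦ Φ(y/s)/s: the change in 1/s is paid for by linear growth of
Φ, the change in y/s by its Lipschitz constant. -/
lemma abs_inv_mul_sub_le {Φ : ℝ → ℝ} {K K' y : ℝ} (hK : 0 ≤ K) (hK' : 0 ≤ K')
    (h : ∀ u, 0 < u → |Φ u| ≤ K * u)
    (h' : ∀ u v, 0 < u → 0 < v → |Φ u - Φ v| ≤ K' * |u - v|) (hy : 0 < y)
    {s t : ℝ} (ht : 0 < t) (hts : t ≤ s) :
    |s⁻¹ * Φ (y / s) - t⁻¹ * Φ (y / t)| ≤ (K + K') * y * (s - t) / t ^ 3 := by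
  have hs : 0 < s := ht.trans_le hts
  have hst : 0 ≤ s - t := by linarith
  have e1 : s⁻¹ * Φ (y / s) - t⁻¹ * Φ (y / t)
      = -((s - t) / (s * t)) * Φ (y / s) + t⁻¹ * (Φ (y / s) - Φ (y / t)) := by
    field_simp; ring
  have e2 : |y / s - y / t| = y * (s - t) / (s * t) := by
    rw [abs_sub_comm, abs_of_nonneg (sub_nonneg.2 (by gcongr))]
    field_simp
  rw [e1]
  calc _ ≤ |-((s - t) / (s * t)) * Φ (y / s)| + |t⁻¹ * (Φ (y / s) - Φ (y / t))| := abs_add_le _ _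
    _ ≤ (s - t) / (s * t) * (K * (y / s)) + t⁻¹ * (K' * (y * (s - t) / (s * t))) := by
      rw [abs_mul, abs_mul, abs_neg, abs_of_nonneg (by positivity : 0 ≤ (s - t) / (s * t)),
        abs_of_pos (by positivity : 0 < t⁻¹)]
      gcongr
      · exact h _ (by positivity)
      · rw [← e2]; exact h' _ _ (by positivity) (by positivity)
    _ ≤ (s - t) / (t * t) * (K * (y / t)) + t⁻¹ * (K' * (y * (s - t) / (t * t))) := by
      gcongr
    _ = _ := by field_simp

lemma dilSum_diffFun_mul_invFun {p : ℕ} (hp : 1 < p) {Φ : ℝ → ℝ}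
    (hΦ : ∃ K, 0 ≤ K ∧ ∀ u, 0 < u → |Φ u| ≤ K * u) {y : ℝ} (hy : 0 < y) :
    dilSum (diffFun p * invFun) Φ y = dilSum invFun Φ y - dilSum invFun Φ (y / p) := by
  obtain ⟨K, -, h⟩ := hΦ
  rw [dilSum_mul (σ := 1) (wsummable_diffFun 1 p) (wsummable_invFun one_pos) (K := K)
    (by simpa using h) hy, dilSum_diffFun hp]

/-- With F(m) = Φ(y/m)/m, the quantity is the difference of ∑ F(m) and ∑ p F(pn). Past m = p(N+1),
each block of p consecutive m is compared with p copies of its first term; smoothness gives the tail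
y/N². Before that, Φ is replaced by c at the cost of its rate, and the resulting harmonic sums
differ by log p up to 1/N. -/
lemma HasLimitRate.diff_inv_bound {Φ : ℝ → ℝ} {c δ : ℝ} (hΦ : HasLimitRate Φ c δ) (hδ : 0 < δ)
    (hδ1 : δ ≤ 1) {p : ℕ} (hp : 1 < p) :
    ∃ A B : ℝ, 0 ≤ A ∧ 0 ≤ B ∧ ∀ y : ℝ, 0 < y → ∀ N : ℕ, 0 < N →
      |dilSum (diffFun p * invFun) Φ y - c * Real.log p| ≤
        A * y / (N : ℝ) ^ 2 + |c| / N + B * (((N : ℝ) + 1) / y) ^ δ := by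
  obtain ⟨K', hK', h'⟩ := hΦ.lipschitz
  obtain ⟨K, hK, h⟩ := hΦ.linear
  obtain ⟨K₂, hK₂, h₂⟩ := hΦ.rate
  refine ⟨K + K', 2 * K₂ * (p : ℝ) ^ δ / δ, by positivity, by positivity, fun y hy N hN => ?_⟩
  have hp0 : (0 : ℝ) < p := by positivity
  rw [dilSum_diffFun_mul_invFun hp hΦ.linear hy]
  set F : ℕ → ℝ := fun m => (m : ℝ)⁻¹ * Φ (y / m) with hF
  set G : ℕ → ℝ := fun n => (n : ℝ)⁻¹ * Φ (y / p / n) with hG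
  have hGF : ∀ n, G n = p * F (p * n) := by
    intro n
    simp only [hF, hG]; push_cast; rw [div_div, mul_inv]; field_simp
  -- The first sum stops just before p(k+1), so passing from k to k + 1 adds one full block starting
  -- at p(k+1), together with the matching term p F(p(k+1)).
  set D : ℕ → ℝ := fun k => ∑ m ∈ Finset.range (p * (k + 1)), F m - ∑ n ∈ Finset.range (k + 1), G n
    with hD
  have hlim : Tendsto D atTop (𝓝 (dilSum invFun Φ y - dilSum invFun Φ (y / p))) := by
    have s1 := (summable_term (wsummable_invFun one_pos) (K := K) (by simpa using h) hy).hasSum.tendsto_sum_nat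
    have s2 := (summable_term (wsummable_invFun one_pos) (K := K) (Φ := Φ) (y := y / p) (by simpa using h)
      (by positivity)).hasSum.tendsto_sum_nat
    refine Tendsto.sub (s1.comp ?_) (s2.comp (tendsto_add_atTop_nat 1))
    exact tendsto_atTop_mono (fun k => show k ≤ p * (k + 1) by nlinarith) tendsto_id
  have hstep : ∀ k, |D (k + 1) - D k| ≤ (K + K') * y / ((k : ℝ) + 1) ^ 3 := by
    intro k
    have e : D (k + 1) - D k = ∑ i ∈ Finset.range p, (F (p * (k + 1) + i) - F (p * (k + 1))) := by
      simp only [hD]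
      rw [Finset.sum_range_succ G (k + 1), show p * (k + 1 + 1) = p * (k + 1) + p by ring,
        Finset.sum_range_add, hGF (k + 1), Finset.sum_sub_distrib]
      simp; ring
    rw [e]
    calc _ ≤ ∑ i ∈ Finset.range p, |F (p * (k + 1) + i) - F (p * (k + 1))| :=
          Finset.abs_sum_le_sum_abs _ _
      _ ≤ ∑ i ∈ Finset.range p, (K + K') * y * p / ((p : ℝ) * (k + 1)) ^ 3 := by
          refine Finset.sum_le_sum fun i hi => ?_
          have hip : (i : ℝ) ≤ p := by exact_mod_cast (Finset.mem_range.1 hi).le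
          have := abs_inv_mul_sub_le hK hK' h h' hy (s := ((p * (k + 1) + i : ℕ) : ℝ))
            (t := ((p * (k + 1) : ℕ) : ℝ)) (by positivity) (by push_cast; linarith [i.cast_nonneg (α := ℝ)])
          simp only [hF]
          refine this.trans ?_
          push_cast
          rw [show (p : ℝ) * (k + 1) + i - p * (k + 1) = i by ring]
          gcongr
      _ = (K + K') * y / ((k : ℝ) + 1) ^ 3 * (1 / p) := by
          rw [Finset.sum_const, Finset.card_range, nsmul_eq_mul]; field_simp
      _ ≤ (K + K') * y / ((k : ℝ) + 1) ^ 3 * 1 := by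
          gcongr
          rw [div_le_one hp0]; exact_mod_cast hp.le
      _ = _ := mul_one _
  have htail := abs_sub_le_of_tendsto (by positivity) hlim hstep hN
  have hmain : |D N - c * (∑ m ∈ Finset.range (p * (N + 1)), (m : ℝ)⁻¹
      - ∑ n ∈ Finset.range (N + 1), (n : ℝ)⁻¹)| ≤ 2 * K₂ * (p : ℝ) ^ δ / δ * (((N : ℝ) + 1) / y) ^ δ := by
    have b1 : ∀ (z : ℝ) (X : ℕ), 0 < z → |∑ m ∈ Finset.range X, ((m : ℝ)⁻¹ * Φ (z / m) - c * (m : ℝ)⁻¹)| ≤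
        K₂ / δ * (X / z) ^ δ := by
      intro z X hz
      calc _ ≤ ∑ m ∈ Finset.range X, |((m : ℝ)⁻¹ * Φ (z / m) - c * (m : ℝ)⁻¹)| :=
            Finset.abs_sum_le_sum_abs _ _
        _ ≤ ∑ m ∈ Finset.range (X + 1), |((m : ℝ)⁻¹ * Φ (z / m) - c * (m : ℝ)⁻¹)| :=
            Finset.sum_le_sum_of_subset_of_nonneg (Finset.range_mono (Nat.le_succ X))
              fun _ _ _ => abs_nonneg _
        _ ≤ ∑ m ∈ Finset.range (X + 1), K₂ * z ^ (-δ) * ((m : ℝ)⁻¹ * (m : ℝ) ^ δ) := by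
            refine Finset.sum_le_sum fun m _ => ?_
            rcases Nat.eq_zero_or_pos m with rfl | hm
            · simp
            have hm' : (0 : ℝ) < m := by exact_mod_cast hm
            rw [mul_comm c, ← mul_sub, abs_mul, abs_of_pos (by positivity : 0 < (m : ℝ)⁻¹)]
            calc _ ≤ (m : ℝ)⁻¹ * (K₂ * (z / m) ^ (-δ)) := by
                  gcongr; exact h₂ _ (by positivity)
              _ = _ := by
                rw [Real.div_rpow hz.le hm'.le, Real.rpow_neg hm'.le]; field_simp
        _ ≤ K₂ * z ^ (-δ) * ((X : ℝ) ^ δ / δ) := by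
            rw [← Finset.mul_sum]; gcongr; exact sum_inv_mul_rpow_le hδ hδ1 X
        _ = _ := by
            rw [Real.div_rpow (by positivity) hz.le, Real.rpow_neg hz.le]; field_simp
    have c1 := b1 y (p * (N + 1)) hy
    have c2 := b1 (y / p) (N + 1) (by positivity)
    have e1 : ((p * (N + 1) : ℕ) : ℝ) / y = p * ((N + 1) / y) := by push_cast; ring
    have e2 : ((N + 1 : ℕ) : ℝ) / (y / p) = p * ((N + 1) / y) := by push_cast; field_simp
    rw [e1, Real.mul_rpow (by positivity) (by positivity)] at c1
    rw [e2, Real.mul_rpow (by positivity) (by positivity)] at c2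
    rw [Finset.sum_sub_distrib, ← Finset.mul_sum] at c1 c2
    have := abs_sub_le_iff.1 c1
    have := abs_sub_le_iff.1 c2
    simp only [hD, hF, hG]
    have e3 : 2 * K₂ * (p : ℝ) ^ δ / δ * (((N : ℝ) + 1) / y) ^ δ
      = 2 * (K₂ / δ * ((p : ℝ) ^ δ * (((N : ℝ) + 1) / y) ^ δ)) := by ring
    rw [e3, abs_le]
    constructor <;> linarith
  have hharm := abs_harmonic_sub_le (p := p) (N := N) (by omega) hN
  set U := dilSum invFun Φ y - dilSum invFun Φ (y / p)
  set Hh := ∑ m ∈ Finset.range (p * (N + 1)), (m : ℝ)⁻¹ - ∑ n ∈ Finset.range (N + 1), (n : ℝ)⁻¹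
  have e : U - c * Real.log p = (U - D N) + c * (Hh - Real.log p) + (D N - c * Hh) := by ring
  rw [e]
  refine (abs_add_three _ _ _).trans ?_
  gcongr
  rw [abs_mul, div_eq_mul_one_div]
  gcongr

/-- The class of functions is preserved, so the operation can be iterated over several primes; each
use divides the rate by 4. For y ≤ 1 the linear bound suffices, since y^{-δ/4} ≥ 1 there. -/
lemma HasLimitRate.diff_inv {Φ : ℝ → ℝ} {c δ : ℝ} (hΦ : HasLimitRate Φ c δ) (hδ : 0 < δ)
    (hδ1 : δ ≤ 1) {p : ℕ} (hp : 1 < p) :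
    HasLimitRate (dilSum (diffFun p * invFun) Φ) (c * Real.log p) (δ / 4) := by
  have hw : WSummable 1 (diffFun p * invFun) :=
    (wsummable_diffFun 1 p).mul (wsummable_invFun one_pos)
  obtain ⟨L, hL, hlin⟩ := dilSum_linear hw hΦ.linear
  refine ⟨dilSum_lipschitz hw hΦ.linear hΦ.lipschitz, ⟨L, hL, hlin⟩, ?_⟩
  obtain ⟨A, B, hA, hB, h⟩ := hΦ.diff_inv_bound hδ hδ1 hp
  refine ⟨(L + |c * Real.log p|) + (A + |c| + B * 3 ^ δ), by positivity, fun y hy => ?_⟩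
  rcases le_or_gt y 1 with hy1 | hy1
  · have h1 : 1 ≤ y ^ (-(δ / 4)) := Real.one_le_rpow_of_pos_of_le_one_of_nonpos hy hy1 (by linarith)
    calc _ ≤ |dilSum (diffFun p * invFun) Φ y| + |c * Real.log p| := abs_sub _ _
      _ ≤ L * 1 + |c * Real.log p| := by
        gcongr; exact (hlin y hy).trans (by gcongr)
      _ ≤ (L + |c * Real.log p|) + (A + |c| + B * 3 ^ δ) := by
        have : 0 ≤ A + |c| + B * 3 ^ δ := by positivity
        linarith
      _ ≤ _ := le_mul_of_one_le_right (by positivity) h1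
  · have hz1 : 1 ≤ y ^ (3 / 4 : ℝ) := Real.one_le_rpow hy1.le (by norm_num)
    set z : ℝ := y ^ (3 / 4 : ℝ) with hz
    -- Cutting at N of order y^{3/4} gives y/N² ≤ y^{-1/2} and (N/y)^δ of order y^{-δ/4}; as δ ≤ 1,
    -- the last error dominates.
    set N := ⌈z⌉₊ with hN
    have hNz : z ≤ N := Nat.le_ceil _
    have hNz2 : (N : ℝ) < z + 1 := Nat.ceil_lt_add_one (by linarith)
    have hN0 : 0 < N := Nat.ceil_pos.2 (by linarith)
    refine (h y hy N hN0).trans ?_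
    have m1 : y / (N : ℝ) ^ 2 ≤ y ^ (-(δ / 4)) := by
      calc y / (N : ℝ) ^ 2 ≤ y / z ^ 2 := by gcongr
        _ = y ^ (1 - (3 / 4) * 2 : ℝ) := by
          rw [Real.rpow_sub hy, Real.rpow_one, Real.rpow_mul hy.le, hz]; norm_cast
        _ ≤ _ := Real.rpow_le_rpow_of_exponent_le hy1.le (by linarith)
    have m2 : 1 / (N : ℝ) ≤ y ^ (-(δ / 4)) := by
      calc 1 / (N : ℝ) ≤ 1 / z := by gcongr
        _ = y ^ (-(3 / 4 : ℝ)) := by rw [Real.rpow_neg hy.le, one_div]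
        _ ≤ _ := Real.rpow_le_rpow_of_exponent_le hy1.le (by linarith)
    have m3 : (((N : ℝ) + 1) / y) ^ δ ≤ 3 ^ δ * y ^ (-(δ / 4)) := by
      calc (((N : ℝ) + 1) / y) ^ δ ≤ (3 * z / y) ^ δ := by gcongr; linarith
        _ = (3 * y ^ (-(1 / 4) : ℝ)) ^ δ := by
          congr 1
          rw [mul_div_assoc]
          congr 1
          rw [show (-(1 / 4) : ℝ) = 3 / 4 - 1 by norm_num, Real.rpow_sub hy, Real.rpow_one]
        _ = _ := by
          rw [Real.mul_rpow (by norm_num) (by positivity), ← Real.rpow_mul hy.le]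
          congr 2; ring
    calc A * y / (N : ℝ) ^ 2 + |c| / N + B * (((N : ℝ) + 1) / y) ^ δ
        = A * (y / (N : ℝ) ^ 2) + |c| * (1 / N) + B * (((N : ℝ) + 1) / y) ^ δ := by ring
      _ ≤ A * y ^ (-(δ / 4)) + |c| * y ^ (-(δ / 4)) + B * (3 ^ δ * y ^ (-(δ / 4))) := by gcongr
      _ = (A + |c| + B * 3 ^ δ) * y ^ (-(δ / 4)) := by ring
      _ ≤ _ := by
        have : 0 ≤ L + |c * Real.log p| := by positivity
        exact mul_le_mul_of_nonneg_right (by linarith) (by positivity)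

/-! ### Powers of the logarithm, and the factor ζ(s+1) -/

lemma pow_succ_sub_pow_succ_le {a b : ℝ} (hb : 0 ≤ b) (hab : b ≤ a) (j : ℕ) :
    a ^ (j + 1) - b ^ (j + 1) ≤ (j + 1) * a ^ j * (a - b) := by
  induction j with
  | zero => simp
  | succ j ih =>
    have h1 : b ^ (j + 1) ≤ a ^ (j + 1) := by gcongr
    have ha : 0 ≤ a := hb.trans hab
    calc a ^ (j + 1 + 1) - b ^ (j + 1 + 1)
        = a * (a ^ (j + 1) - b ^ (j + 1)) + b ^ (j + 1) * (a - b) := by ring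
      _ ≤ a * ((j + 1) * a ^ j * (a - b)) + a ^ (j + 1) * (a - b) := by
        gcongr
      _ = _ := by push_cast; ring

lemma le_pow_succ_sub_pow_succ {a b : ℝ} (hb : 0 ≤ b) (hab : b ≤ a) (j : ℕ) :
    (j + 1) * b ^ j * (a - b) ≤ a ^ (j + 1) - b ^ (j + 1) := by
  induction j with
  | zero => simp
  | succ j ih =>
    have ha : 0 ≤ a := hb.trans hab
    have h1 : 0 ≤ (j + 1) * b ^ j * (a - b) :=
      mul_nonneg (by positivity) (by linarith)
    calc ((j + 1 : ℕ) + 1 : ℝ) * b ^ (j + 1) * (a - b)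
        = b * ((j + 1) * b ^ j * (a - b)) + b ^ (j + 1) * (a - b) := by push_cast; ring
      _ ≤ a * ((j + 1) * b ^ j * (a - b)) + b ^ (j + 1) * (a - b) := by gcongr
      _ ≤ a * (a ^ (j + 1) - b ^ (j + 1)) + b ^ (j + 1) * (a - b) := by gcongr
      _ = _ := by ring

/-- `∑ n ≤ y, (log (y / n)) ^ j / n`. -/
noncomputable def logPowSum (j : ℕ) (y : ℝ) : ℝ :=
  ∑ n ∈ Finset.range ⌊y⌋₊, ((n + 1 : ℕ) : ℝ)⁻¹ * Real.log (y / (n + 1 : ℕ)) ^ j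

lemma inv_succ_le_log {n : ℕ} (hn : 0 < n) :
    ((n + 1 : ℕ) : ℝ)⁻¹ ≤ Real.log (n + 1 : ℕ) - Real.log n := by
  have hn' : (0 : ℝ) < n := by exact_mod_cast hn
  have := Real.one_sub_inv_le_log_of_pos (x := (n + 1 : ℕ) / n) (by positivity)
  rw [Real.log_div (by positivity) (by positivity)] at this
  refine le_trans (le_of_eq ?_) this
  push_cast; field_simp; ring

/-- Telescope the powers log(y/n)^{j+1}: passing from n to n + 1 lowers the logarithm by at most
1/n. -/
lemma le_logPowSum (j : ℕ) {y : ℝ} (hy : 1 ≤ y) :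
    Real.log y ^ (j + 1) ≤ (j + 1) * logPowSum j y := by
  -- Truncating at 0 makes the telescoping sum end exactly at 0, since y/(⌊y⌋ + 1) < 1.
  set a : ℕ → ℝ := fun n => max 0 (Real.log (y / (n + 1 : ℕ))) with ha
  have hy0 : 0 < y := by linarith
  have h1 : ∀ n, n ∈ Finset.range ⌊y⌋₊ → a n ^ (j + 1) - a (n + 1) ^ (j + 1) ≤
      (j + 1) * (((n + 1 : ℕ) : ℝ)⁻¹ * Real.log (y / (n + 1 : ℕ)) ^ j) := by
    intro n hn
    have hny : ((n + 1 : ℕ) : ℝ) ≤ y := (Nat.le_floor_iff hy0.le).1 (Finset.mem_range.1 hn)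
    have e1 : a n = Real.log (y / (n + 1 : ℕ)) :=
      max_eq_right (Real.log_nonneg (by rwa [le_div_iff₀ (by positivity), one_mul]))
    have hle : Real.log (y / (n + 1 + 1 : ℕ)) ≤ Real.log (y / (n + 1 : ℕ)) :=
      Real.log_le_log (by positivity) (by gcongr; omega)
    have h2 : a (n + 1) ≤ a n := max_le_max le_rfl hle
    have h3 : a n - a (n + 1) ≤ ((n + 1 : ℕ) : ℝ)⁻¹ := by
      have : Real.log (y / (n + 1 + 1 : ℕ)) ≤ a (n + 1) := le_max_right _ _
      rw [Real.log_div (by positivity) (by positivity)] at this e1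
      have := log_succ_sub_log_le (N := ((n + 1 : ℕ) : ℝ)) (by positivity)
      rw [one_div] at this
      push_cast at *
      linarith
    rw [← e1]
    have h0 : 0 ≤ a n := le_max_left _ _
    calc _ ≤ (j + 1) * a n ^ j * (a n - a (n + 1)) :=
          pow_succ_sub_pow_succ_le (le_max_left _ _) h2 j
      _ ≤ (j + 1) * a n ^ j * ((n + 1 : ℕ) : ℝ)⁻¹ := by gcongr
      _ = _ := by ring
  have h4 := Finset.sum_le_sum h1
  rw [Finset.sum_range_sub' (fun n => a n ^ (j + 1)), ← Finset.mul_sum] at h4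
  have e0 : a 0 = Real.log y := by simp [ha, Real.log_nonneg hy]
  have e1 : a ⌊y⌋₊ = 0 := by
    refine max_eq_left (Real.log_nonpos (by positivity) ?_)
    rw [div_le_one (by positivity)]; push_cast; exact (Nat.lt_floor_add_one y).le
  rw [e0, e1] at h4
  simpa [logPowSum] using h4

/-- The same telescoping with the opposite inequality, which needs the later endpoint of each step.
The unmatched first term gives the extra power log(y)^j. -/
lemma logPowSum_le (j : ℕ) {y : ℝ} (hy : 1 ≤ y) :
    (j + 1) * logPowSum j y ≤ Real.log y ^ (j + 1) + (j + 1) * Real.log y ^ j := by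
  obtain ⟨N, hN⟩ : ∃ N, ⌊y⌋₊ = N + 1 :=
    ⟨⌊y⌋₊ - 1, by have := (Nat.one_le_floor_iff y).2 hy; omega⟩
  have hy0 : 0 < y := by linarith
  set a : ℕ → ℝ := fun n => Real.log (y / (n + 1 : ℕ)) with ha
  have hny : ∀ n, n ≤ N → 0 ≤ a n := fun n hn => by
    have : ((n + 1 : ℕ) : ℝ) ≤ y := (Nat.le_floor_iff hy0.le).1 (by omega)
    exact Real.log_nonneg (by rwa [le_div_iff₀ (by positivity), one_mul])
  have h1 : ∀ n ∈ Finset.range N, (j + 1) * (((n + 1 + 1 : ℕ) : ℝ)⁻¹ * a (n + 1) ^ j) ≤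
      a n ^ (j + 1) - a (n + 1) ^ (j + 1) := by
    intro n hn
    have hn := Finset.mem_range.1 hn
    have hle : a (n + 1) ≤ a n := Real.log_le_log (by positivity) (by gcongr; omega)
    have h0 := hny (n + 1) (by omega)
    have h3 : ((n + 1 + 1 : ℕ) : ℝ)⁻¹ ≤ a n - a (n + 1) := by
      have := inv_succ_le_log (n := n + 1) (by omega)
      simp only [ha]
      rw [Real.log_div (by positivity) (by positivity), Real.log_div (by positivity) (by positivity)]
      linarith
    calc _ = (j + 1) * a (n + 1) ^ j * ((n + 1 + 1 : ℕ) : ℝ)⁻¹ := by ring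
      _ ≤ (j + 1) * a (n + 1) ^ j * (a n - a (n + 1)) := by gcongr
      _ ≤ _ := le_pow_succ_sub_pow_succ h0 hle j
  have h4 := Finset.sum_le_sum h1
  rw [Finset.sum_range_sub' (fun n => a n ^ (j + 1)), ← Finset.mul_sum] at h4
  have e0 : a 0 = Real.log y := by simp [ha]
  have h5 : 0 ≤ a N ^ (j + 1) := pow_nonneg (hny N le_rfl) _
  rw [logPowSum, hN, Finset.sum_range_succ']
  simp only [zero_add, Nat.cast_one, inv_one, div_one, one_mul]
  rw [e0] at h4
  rw [mul_add]
  linarith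

lemma tendsto_logPowSum (j : ℕ) :
    Tendsto (fun y => logPowSum j y / Real.log y ^ (j + 1)) atTop (𝓝 (1 / (j + 1))) := by
  have hj : (0 : ℝ) < j + 1 := by positivity
  have hl : Tendsto (fun y : ℝ => 1 / ((j : ℝ) + 1) + (Real.log y)⁻¹) atTop (𝓝 (1 / (j + 1))) := by
    simpa using (Real.tendsto_log_atTop.inv_tendsto_atTop).const_add (1 / ((j : ℝ) + 1))
  refine tendsto_of_tendsto_of_tendsto_of_le_of_le' tendsto_const_nhds hl ?_ ?_
  · filter_upwards [eventually_gt_atTop 1] with y hy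
    have := Real.log_pos hy
    rw [div_le_div_iff₀ hj (by positivity), one_mul, mul_comm]
    exact le_logPowSum j hy.le
  · filter_upwards [eventually_gt_atTop 1] with y hy
    have hlog := Real.log_pos hy
    rw [div_le_iff₀ (by positivity)]
    have := logPowSum_le j hy.le
    refine le_of_mul_le_mul_left (this.trans (le_of_eq ?_)) hj
    field_simp
    ring

/-- Functions on `(0, ∞)` that are at most linear and asymptotic to `c * (log u) ^ j`. -/
structure HasLogGrowth (Φ : ℝ → ℝ) (j : ℕ) (c : ℝ) : Prop where
  linear : ∃ K, 0 ≤ K ∧ ∀ u, 0 < u → |Φ u| ≤ K * u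
  limit : Tendsto (fun u => Φ u / Real.log u ^ j) atTop (𝓝 c)

/-- The remainder is K/u rather than a constant so that, taken at u = y/n with weight 1/n, it
contributes K/y for each n ≤ y and O(1) in all. A constant would cost log y, too much when j = 0. -/
lemma HasLogGrowth.approx {Φ : ℝ → ℝ} {j : ℕ} {c : ℝ} (hΦ : HasLogGrowth Φ j c) {ε : ℝ}
    (hε : 0 < ε) : ∃ K, 0 ≤ K ∧ ∀ u, 1 ≤ u →
      |Φ u - c * Real.log u ^ j| ≤ ε * Real.log u ^ j + K / u := by
  obtain ⟨K, hK, h⟩ := hΦ.linear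
  obtain ⟨U, hU⟩ := eventually_atTop.1 ((Metric.tendsto_nhds.1 hΦ.limit) ε hε)
  set V := max U 2
  have hV : 2 ≤ V := le_max_right _ _
  refine ⟨(K * V + |c| * Real.log V ^ j) * V, ?_, fun u hu => ?_⟩
  · have := Real.log_nonneg (by linarith : 1 ≤ V)
    positivity
  have hlu := Real.log_nonneg hu
  rcases le_or_gt V u with hVu | hVu
  · have h1 := hU u ((le_max_left _ _).trans hVu)
    have hl : 0 < Real.log u := Real.log_pos (by linarith)
    rw [Real.dist_eq, div_sub' (by positivity), abs_div, abs_of_pos (by positivity : 0 < Real.log u ^ j),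
      div_lt_iff₀ (by positivity)] at h1
    rw [mul_comm c]
    refine h1.le.trans (le_add_of_nonneg_right ?_)
    have := Real.log_nonneg (by linarith : 1 ≤ V)
    positivity
  · have h2 : |Φ u - c * Real.log u ^ j| ≤ K * V + |c| * Real.log V ^ j := by
      calc _ ≤ |Φ u| + |c * Real.log u ^ j| := abs_sub _ _
        _ ≤ _ := by
          rw [abs_mul, abs_of_nonneg (pow_nonneg hlu j)]
          gcongr
          exact (h u (by linarith)).trans (by gcongr)
    have h3 : K * V + |c| * Real.log V ^ j ≤ (K * V + |c| * Real.log V ^ j) * V / u := by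
      rw [mul_div_assoc]
      refine le_mul_of_one_le_right ?_ ((one_le_div (by linarith)).2 hVu.le)
      have := Real.log_nonneg (by linarith : 1 ≤ V)
      positivity
    have : 0 ≤ ε * Real.log u ^ j := by positivity
    linarith

/-- Beyond n = ⌊y⌋ the terms are at most K y/n², whose sum is at most K y/⌊y⌋ ≤ 2K. -/
lemma abs_dilSum_invFun_sub_le {Φ : ℝ → ℝ} {K : ℝ} (hK : 0 ≤ K)
    (h : ∀ u, 0 < u → |Φ u| ≤ K * u) {y : ℝ} (hy : 1 ≤ y) :
    |dilSum invFun Φ y - ∑ n ∈ Finset.range (⌊y⌋₊ + 1), (n : ℝ)⁻¹ * Φ (y / n)| ≤ 2 * K := by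
  have hy0 : 0 < y := by linarith
  have s1 := (summable_term (wsummable_invFun one_pos) (K := K) (by simpa using h)
    hy0).hasSum.tendsto_sum_nat
  simp only [invFun_apply] at s1
  refine le_of_tendsto ((s1.sub_const _).abs) ?_
  filter_upwards [eventually_ge_atTop (⌊y⌋₊ + 1)] with X hX
  have hN : 0 < ⌊y⌋₊ := (Nat.one_le_floor_iff y).2 hy
  have hN' : (0 : ℝ) < ⌊y⌋₊ := by exact_mod_cast hN
  rw [← Finset.sum_range_add_sum_Ico _ hX, add_sub_cancel_left]
  have hIco : Finset.Ico (⌊y⌋₊ + 1) X = Finset.Ioc ⌊y⌋₊ (X - 1) := by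
    ext m; simp only [Finset.mem_Ico, Finset.mem_Ioc]; omega
  calc _ ≤ ∑ n ∈ Finset.Ico (⌊y⌋₊ + 1) X, |(n : ℝ)⁻¹ * Φ (y / n)| := Finset.abs_sum_le_sum_abs _ _
    _ ≤ ∑ n ∈ Finset.Ico (⌊y⌋₊ + 1) X, K * y * ((n : ℝ) ^ 2)⁻¹ := by
      refine Finset.sum_le_sum fun n hn => ?_
      have hn0 : (0 : ℝ) < n := by
        have := (Finset.mem_Ico.1 hn).1
        exact_mod_cast (by omega : 0 < n)
      rw [abs_mul, abs_of_pos (by positivity : 0 < (n : ℝ)⁻¹)]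
      calc _ ≤ (n : ℝ)⁻¹ * (K * (y / n)) := by gcongr; exact h _ (by positivity)
        _ = _ := by field_simp
    _ = K * y * ∑ n ∈ Finset.Ioc ⌊y⌋₊ (X - 1), ((n : ℝ) ^ 2)⁻¹ := by rw [Finset.mul_sum, hIco]
    _ ≤ K * y * ((⌊y⌋₊ : ℝ)⁻¹ - ((X - 1 : ℕ) : ℝ)⁻¹) := by
      gcongr
      exact sum_Ioc_inv_sq_le_sub hN.ne' (by omega)
    _ ≤ K * (2 * ⌊y⌋₊) * (⌊y⌋₊ : ℝ)⁻¹ := by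
      have h1 : y ≤ 2 * ⌊y⌋₊ := by
        have := Nat.lt_floor_add_one y
        have : (1 : ℝ) ≤ ⌊y⌋₊ := by exact_mod_cast hN
        linarith
      have h2 : 0 ≤ ((X - 1 : ℕ) : ℝ)⁻¹ := by positivity
      have h3 : (⌊y⌋₊ : ℝ)⁻¹ - ((X - 1 : ℕ) : ℝ)⁻¹ ≤ (⌊y⌋₊ : ℝ)⁻¹ := by linarith
      calc _ ≤ K * y * (⌊y⌋₊ : ℝ)⁻¹ := by gcongr
        _ ≤ _ := by gcongr
    _ = 2 * K := by field_simp

/-- The discrete form of integrating c (log u)^j against du/u over [1, y]; iterating it produces the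
factorial. -/
lemma HasLogGrowth.dilSum_invFun {Φ : ℝ → ℝ} {j : ℕ} {c : ℝ} (hΦ : HasLogGrowth Φ j c) :
    HasLogGrowth (dilSum invFun Φ) (j + 1) (c / (j + 1)) := by
  refine ⟨dilSum_linear (wsummable_invFun one_pos) hΦ.linear, ?_⟩
  obtain ⟨K, hK, h⟩ := hΦ.linear
  have hs := tendsto_logPowSum j
  have key : Tendsto (fun y => (dilSum invFun Φ y - c * logPowSum j y) / Real.log y ^ (j + 1)) atTop
      (𝓝 0) := by
    rw [Metric.tendsto_nhds]
    intro ε hε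
    obtain ⟨K₂, hK₂, h₂⟩ := hΦ.approx (half_pos hε)
    have hs2 : ∀ᶠ y in atTop, logPowSum j y / Real.log y ^ (j + 1) < 3 / 2 :=
      hs.eventually (gt_mem_nhds (by
        have : (1 : ℝ) / (j + 1) ≤ 1 := by
          rw [div_le_one (by positivity)]; linarith [j.cast_nonneg (α := ℝ)]
        linarith))
    have hl : Tendsto (fun y : ℝ => (2 * K + K₂) * (Real.log y ^ (j + 1))⁻¹) atTop (𝓝 0) := by
      have := ((tendsto_pow_atTop (by omega : j + 1 ≠ 0)).comp
        Real.tendsto_log_atTop).inv_tendsto_atTop.const_mul (2 * K + K₂)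
      simpa using this
    filter_upwards [hs2, hl.eventually (gt_mem_nhds (by positivity : (0 : ℝ) < ε / 4)),
      eventually_gt_atTop 1] with y hy2 hy3 hy
    have hlog := Real.log_pos hy
    have hy0 : 0 < y := by linarith
    have b1 := abs_dilSum_invFun_sub_le hK h hy.le
    have b2 : |∑ n ∈ Finset.range (⌊y⌋₊ + 1), (n : ℝ)⁻¹ * Φ (y / n) - c * logPowSum j y| ≤
        ε / 2 * logPowSum j y + K₂ := by
      rw [Finset.sum_range_succ']
      simp only [Nat.cast_zero, inv_zero, zero_mul, add_zero]
      rw [logPowSum, Finset.mul_sum, ← Finset.sum_sub_distrib]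
      calc _ ≤ ∑ n ∈ Finset.range ⌊y⌋₊, |((n + 1 : ℕ) : ℝ)⁻¹ * Φ (y / (n + 1 : ℕ)) -
              c * (((n + 1 : ℕ) : ℝ)⁻¹ * Real.log (y / (n + 1 : ℕ)) ^ j)| :=
            Finset.abs_sum_le_sum_abs _ _
        _ ≤ ∑ n ∈ Finset.range ⌊y⌋₊, (ε / 2 * (((n + 1 : ℕ) : ℝ)⁻¹ *
              Real.log (y / (n + 1 : ℕ)) ^ j) + K₂ / y) := by
            refine Finset.sum_le_sum fun n hn => ?_
            have hn1 : (0 : ℝ) < (n + 1 : ℕ) := by positivity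
            have hny : ((n + 1 : ℕ) : ℝ) ≤ y :=
              (Nat.le_floor_iff hy0.le).1 (Finset.mem_range.1 hn)
            have := h₂ (y / (n + 1 : ℕ)) (by rwa [le_div_iff₀ hn1, one_mul])
            set z : ℝ := ((n + 1 : ℕ) : ℝ)
            rw [show z⁻¹ * Φ (y / z) - c * (z⁻¹ * Real.log (y / z) ^ j) =
              z⁻¹ * (Φ (y / z) - c * Real.log (y / z) ^ j) by ring, abs_mul,
              abs_of_pos (by positivity : 0 < z⁻¹)]
            calc _ ≤ z⁻¹ * (ε / 2 * Real.log (y / z) ^ j + K₂ / (y / z)) := by gcongr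
              _ = _ := by field_simp
        _ ≤ _ := by
          rw [Finset.sum_add_distrib, ← Finset.mul_sum, Finset.sum_const, Finset.card_range,
            nsmul_eq_mul]
          gcongr
          calc (⌊y⌋₊ : ℝ) * (K₂ / y) ≤ y * (K₂ / y) := by gcongr; exact Nat.floor_le hy0.le
            _ = K₂ := by field_simp
    have b3 : |dilSum invFun Φ y - c * logPowSum j y| ≤ ε / 2 * logPowSum j y + (2 * K + K₂) := by
      have := abs_sub_le (dilSum invFun Φ y)
        (∑ n ∈ Finset.range (⌊y⌋₊ + 1), (n : ℝ)⁻¹ * Φ (y / n)) (c * logPowSum j y)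
      linarith
    rw [Real.dist_eq, sub_zero, abs_div, abs_of_pos (by positivity : 0 < Real.log y ^ (j + 1))]
    calc _ ≤ (ε / 2 * logPowSum j y + (2 * K + K₂)) / Real.log y ^ (j + 1) := by gcongr
      _ = ε / 2 * (logPowSum j y / Real.log y ^ (j + 1)) +
          (2 * K + K₂) * (Real.log y ^ (j + 1))⁻¹ := by ring
      _ < ε / 2 * (3 / 2) + ε / 4 := by gcongr
      _ = ε := by ring
  have := key.add (hs.const_mul c)
  rw [zero_add, mul_one_div] at this
  refine this.congr fun y => ?_
  ring

lemma HasLogGrowth.congr {Φ Ψ : ℝ → ℝ} {j : ℕ} {c : ℝ} (hΦ : HasLogGrowth Φ j c)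
    (h : ∀ u, 0 < u → Ψ u = Φ u) : HasLogGrowth Ψ j c := by
  obtain ⟨⟨K, hK, hK'⟩, h2⟩ := hΦ
  refine ⟨⟨K, hK, fun u hu => by rw [h u hu]; exact hK' u hu⟩, h2.congr' ?_⟩
  filter_upwards [eventually_gt_atTop 0] with u hu
  rw [h u hu]

lemma HasLimitRate.congr {Φ Ψ : ℝ → ℝ} {c δ : ℝ} (hΦ : HasLimitRate Φ c δ)
    (h : ∀ u, 0 < u → Ψ u = Φ u) : HasLimitRate Ψ c δ := by
  obtain ⟨⟨A, hA, hA'⟩, ⟨B, hB, hB'⟩, ⟨C, hC, hC'⟩⟩ := hΦ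
  exact ⟨⟨A, hA, fun u v hu hv => by rw [h u hu, h v hv]; exact hA' u v hu hv⟩,
    ⟨B, hB, fun u hu => by rw [h u hu]; exact hB' u hu⟩,
    ⟨C, hC, fun u hu => by rw [h u hu]; exact hC' u hu⟩⟩

lemma HasLimitRate.hasLogGrowth {Φ : ℝ → ℝ} {c δ : ℝ} (hΦ : HasLimitRate Φ c δ) (hδ : 0 < δ) :
    HasLogGrowth Φ 0 c := by
  refine ⟨hΦ.linear, ?_⟩
  obtain ⟨K, hK, h⟩ := hΦ.rate
  simp only [pow_zero, div_one]
  rw [tendsto_iff_norm_sub_tendsto_zero]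
  have h2 := (tendsto_rpow_neg_atTop hδ).const_mul K
  rw [mul_zero] at h2
  refine squeeze_zero' (Eventually.of_forall fun _ => norm_nonneg _) ?_ h2
  filter_upwards [eventually_gt_atTop 0] with u hu using h u hu

lemma HasLogGrowth.dilSum_invFun_pow {Φ : ℝ → ℝ} {c : ℝ} (hΦ : HasLogGrowth Φ 0 c) (j : ℕ) :
    HasLogGrowth (dilSum (invFun ^ j) Φ) j (c / j.factorial) := by
  induction j with
  | zero =>
    refine HasLogGrowth.congr (by simpa using hΦ) fun u _ => ?_
    rw [pow_zero, dilSum, tsum_eq_single 1 fun n hn => by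
      rw [ArithmeticFunction.one_apply_ne hn, zero_mul]]
    simp
  | succ j ih =>
    have h := ih.dilSum_invFun
    rw [div_div, show (j.factorial : ℝ) * (j + 1) = ((j + 1).factorial : ℝ) by
      rw [Nat.factorial_succ]; push_cast; ring] at h
    obtain ⟨K, -, hK⟩ := hΦ.linear
    refine h.congr fun u hu => ?_
    rw [pow_succ', dilSum_mul (σ := 1) (K := K) (wsummable_invFun one_pos)
      ((wsummable_invFun one_pos).pow j) (by simpa using hK) hu]

/-- A majorant uniform in u ≤ v, as dominated convergence requires. The condition v ≥ 3 ensures log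
v ≥ 1, so that the bounded part is absorbed. -/
lemma HasLogGrowth.bound {Φ : ℝ → ℝ} {j : ℕ} {c : ℝ} (hΦ : HasLogGrowth Φ j c) :
    ∃ K, 0 ≤ K ∧ ∀ u v, 0 < u → u ≤ v → 3 ≤ v → |Φ u| ≤ K * Real.log v ^ j := by
  obtain ⟨K, hK, h⟩ := hΦ.linear
  obtain ⟨K₂, hK₂, h₂⟩ := hΦ.approx one_pos
  refine ⟨K + (|c| + 1 + K₂), by positivity, fun u v hu huv hv => ?_⟩
  have hlv : 1 ≤ Real.log v := by
    rw [Real.le_log_iff_exp_le (by linarith)]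
    exact (Real.exp_one_lt_d9.le.trans (by norm_num)).trans hv
  have hlvj : 1 ≤ Real.log v ^ j := one_le_pow₀ hlv
  rcases le_or_gt u 1 with h1 | h1
  · calc |Φ u| ≤ K * 1 := (h u hu).trans (by gcongr)
      _ ≤ K + (|c| + 1 + K₂) := by linarith [abs_nonneg c]
      _ ≤ _ := le_mul_of_one_le_right (by positivity) hlvj
  · have h3 := h₂ u h1.le
    have hlu : 0 ≤ Real.log u := Real.log_nonneg h1.le
    have h4 : Real.log u ^ j ≤ Real.log v ^ j := by gcongr
    have h5 : K₂ / u ≤ K₂ * Real.log v ^ j :=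
      (div_le_self hK₂ h1.le).trans (le_mul_of_one_le_right hK₂ hlvj)
    calc |Φ u| = |(Φ u - c * Real.log u ^ j) + c * Real.log u ^ j| := by ring_nf
      _ ≤ |Φ u - c * Real.log u ^ j| + |c * Real.log u ^ j| := abs_add_le _ _
      _ ≤ (1 * Real.log u ^ j + K₂ / u) + |c| * Real.log u ^ j := by
        rw [abs_mul, abs_of_nonneg (pow_nonneg hlu j)]; gcongr
      _ ≤ (1 * Real.log v ^ j + K₂ * Real.log v ^ j) + |c| * Real.log v ^ j := by gcongr
      _ ≤ _ := by
        have : 0 ≤ K * Real.log v ^ j := by positivity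
        linarith

/-- For each fixed n, log(y/n)/log y tends to 1, so every term tends to c g(n); the terms are
dominated by K |g(n)|. -/
lemma HasLogGrowth.tendsto_dilSum {Φ : ℝ → ℝ} {j : ℕ} {c : ℝ} (hΦ : HasLogGrowth Φ j c)
    {g : ArithmeticFunction ℝ} (hg : WSummable 0 g) :
    Tendsto (fun y => dilSum g Φ y / Real.log y ^ j) atTop (𝓝 (c * ∑' n, g n)) := by
  obtain ⟨K, hK, h⟩ := hΦ.bound
  have hg' : Summable fun n => K * |g n| := by
    refine (hg.congr fun n => ?_).mul_left K
    simp
  have e : c * ∑' n, g n = ∑' n, g n * c := by rw [tsum_mul_right, mul_comm]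
  have e2 : (fun y => dilSum g Φ y / Real.log y ^ j) =
      fun y => ∑' n : ℕ, g n * (Φ (y / n) / Real.log y ^ j) := by
    ext y
    rw [dilSum, ← tsum_div_const]
    exact tsum_congr fun n => mul_div_assoc _ _ _
  rw [e, e2]
  refine tendsto_tsum_of_dominated_convergence hg' (fun n => ?_) ?_
  · rcases Nat.eq_zero_or_pos n with rfl | hn
    · simp
    have hn' : (0 : ℝ) < n := by exact_mod_cast hn
    refine Tendsto.const_mul _ ?_
    have ht : Tendsto (fun y : ℝ => y / n) atTop atTop := tendsto_id.atTop_div_const hn'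
    have h1 := hΦ.limit.comp ht
    have h2 : Tendsto (fun y : ℝ => (Real.log (y / n) / Real.log y) ^ j) atTop (𝓝 1) := by
      have h3 : Tendsto (fun y : ℝ => 1 - Real.log n * (Real.log y)⁻¹) atTop (𝓝 1) := by
        simpa using (Real.tendsto_log_atTop.inv_tendsto_atTop.const_mul (Real.log n)).const_sub 1
      have h4 : Tendsto (fun y : ℝ => Real.log (y / n) / Real.log y) atTop (𝓝 1) := by
        refine h3.congr' ?_
        filter_upwards [eventually_gt_atTop 1] with y hy
        have := Real.log_pos hy
        rw [Real.log_div (by positivity) (by positivity)]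
        field_simp
      simpa using h4.pow j
    have h5 := h1.mul h2
    rw [mul_one] at h5
    refine h5.congr' ?_
    filter_upwards [eventually_gt_atTop 1, ht.eventually_gt_atTop 1] with y hy hy'
    have := Real.log_pos hy
    have := Real.log_pos hy'
    simp only [Function.comp_apply]
    rw [div_pow]
    field_simp
  · filter_upwards [eventually_ge_atTop 3] with y hy n
    rcases Nat.eq_zero_or_pos n with rfl | hn
    · simp
    have hn' : (1 : ℝ) ≤ n := by exact_mod_cast hn
    have hl : 0 < Real.log y := Real.log_pos (by linarith)
    rw [Real.norm_eq_abs, abs_mul, abs_div, abs_of_pos (by positivity : 0 < Real.log y ^ j),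
      mul_comm K]
    gcongr
    rw [div_le_iff₀ (by positivity)]
    exact h _ _ (div_pos (by linarith) (by linarith)) (div_le_self (by linarith) hn') hy

/-! ### The pole of ζ(s+1)^k against the zeros of ∏ (1 - p^{-s}) -/

lemma HasLimitRate.dilSum_prod {Φ : ℝ → ℝ} {c δ : ℝ} (hΦ : HasLimitRate Φ c δ) (hδ : 0 < δ)
    (hδ1 : δ ≤ 1) (s : Finset ℕ) (hs : ∀ p ∈ s, 1 < p) :
    HasLimitRate (dilSum (∏ p ∈ s, diffFun p * invFun) Φ) (c * ∏ p ∈ s, Real.log p)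
      (δ / 4 ^ s.card) := by
  induction s using Finset.induction_on with
  | empty =>
    refine HasLimitRate.congr (by simpa using hΦ) fun u _ => ?_
    rw [Finset.prod_empty, dilSum, tsum_eq_single 1 fun n hn => by
      rw [ArithmeticFunction.one_apply_ne hn, zero_mul]]
    simp
  | insert p s hp ih =>
    have ih := ih fun q hq => hs q (by simp [hq])
    have h1 : δ / 4 ^ s.card ≤ 1 :=
      (div_le_self hδ.le (one_le_pow₀ (by norm_num))).trans hδ1
    have h := ih.diff_inv (by positivity) h1 (hs p (by simp))
    have hw : ∀ q, WSummable 1 (diffFun q * invFun) := fun q =>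
      (wsummable_diffFun 1 q).mul (wsummable_invFun one_pos)
    obtain ⟨K, -, hK⟩ := hΦ.linear
    rw [Finset.card_insert_of_notMem hp, Finset.prod_insert hp, Finset.prod_insert hp, pow_succ,
      ← div_div, show c * (Real.log p * ∏ p ∈ s, Real.log p) =
        c * (∏ p ∈ s, Real.log p) * Real.log p by ring]
    refine h.congr fun u hu => ?_
    rw [dilSum_mul (σ := 1) (K := K) (hw p) (WSummable.finset_prod s fun q _ => hw q)
      (by simpa using hK) hu]

/-- Every difference factor is paired with one reciprocal factor, which yields a limit. The unpaired
reciprocals then build up the logarithms, and g is applied last. -/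
theorem tendsto_dilSum_of_card_le {Φ : ℝ → ℝ} {c : ℝ} (hΦ : HasLimitRate Φ c 1)
    {g : ArithmeticFunction ℝ} (hg : WSummable 0 g) {s : Finset ℕ} (hs : ∀ p ∈ s, 1 < p) {k : ℕ}
    (hk : s.card ≤ k) :
    Tendsto (fun y => dilSum (g * (∏ p ∈ s, diffFun p) * invFun ^ k) Φ y /
      Real.log y ^ (k - s.card)) atTop
      (𝓝 (c * (∏ p ∈ s, Real.log p) / (k - s.card).factorial * ∑' n, g n)) := by
  have hw : WSummable 1 (∏ p ∈ s, diffFun p * invFun) := WSummable.finset_prod s fun q _ =>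
    (wsummable_diffFun 1 q).mul (wsummable_invFun one_pos)
  have h1 := (hΦ.dilSum_prod one_pos le_rfl s hs).hasLogGrowth (by positivity)
  have h2 := (h1.dilSum_invFun_pow (k - s.card)).tendsto_dilSum hg
  refine h2.congr' ?_
  filter_upwards [eventually_gt_atTop 0] with y hy
  have e : g * (∏ p ∈ s, diffFun p) * invFun ^ k =
      g * (invFun ^ (k - s.card) * ∏ p ∈ s, diffFun p * invFun) := by
    rw [Finset.prod_mul_distrib, Finset.prod_const]
    nth_rw 1 [← Nat.sub_add_cancel hk]
    rw [pow_add]; ring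
  obtain ⟨K, -, hK⟩ := hΦ.linear
  obtain ⟨K₂, -, hK₂⟩ := h1.linear
  have hw2 : WSummable 1 (invFun ^ (k - s.card)) := (wsummable_invFun one_pos).pow _
  have hK' : ∀ u, 0 < u → |Φ u| ≤ K * u ^ (1 : ℝ) := by simpa using hK
  rw [e, dilSum_mul (σ := 1) (K := K) (hg.mono zero_le_one) (hw2.mul hw) hK' hy]
  congr 1
  refine tsum_congr fun n => ?_
  rcases Nat.eq_zero_or_pos n with rfl | hn
  · simp
  have hn' : (0 : ℝ) < n := by exact_mod_cast hn
  rw [dilSum_mul (σ := 1) (K := K) hw2 hw hK' (by positivity)]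

/-- Pair all k reciprocals with the primes of a subset t, and pick a further prime q of s. In Ψ(u) -
Ψ(u/q) the limit cancels and only the rate u^{-1/4^k} survives; g and the other differences preserve
it. -/
theorem abs_dilSum_le_of_lt_card {Φ : ℝ → ℝ} {c : ℝ} (hΦ : HasLimitRate Φ c 1)
    {g : ArithmeticFunction ℝ} (hg : WSummable (-(1 / 4)) g) {s : Finset ℕ}
    (hs : ∀ p ∈ s, 1 < p) {k : ℕ} (hk1 : 1 ≤ k) (hk : k < s.card) :
    ∃ K, ∀ y, 0 < y → |dilSum (g * (∏ p ∈ s, diffFun p) * invFun ^ k) Φ y| ≤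
      K * y ^ (-(1 / 4 ^ k : ℝ)) := by
  obtain ⟨t, hts, ht⟩ := Finset.exists_subset_card_eq hk.le
  obtain ⟨q, hqs, hqt⟩ : ∃ q ∈ s, q ∉ t := by
    by_contra! hcon
    have := Finset.card_le_card hcon
    omega
  have hw : WSummable 1 (∏ p ∈ t, diffFun p * invFun) := WSummable.finset_prod t fun q _ =>
    (wsummable_diffFun 1 q).mul (wsummable_invFun one_pos)
  have h1 := hΦ.dilSum_prod one_pos le_rfl t fun p hp => hs p (hts hp)
  rw [ht] at h1
  set δ : ℝ := 1 / 4 ^ k with hδ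
  -- Here k ≥ 1 is used: the decay rate must stay within the range where the series of g converges
  -- absolutely.
  have hδ1 : δ ≤ 1 / 4 := by
    rw [hδ]; gcongr; exact le_self_pow₀ (by norm_num) (by omega)
  set Ψ := dilSum (∏ p ∈ t, diffFun p * invFun) Φ
  obtain ⟨K, hK0, hK⟩ := h1.rate
  set c' := c * ∏ p ∈ t, Real.log p
  have hq0 : (0 : ℝ) < q := by
    have := hs q hqs
    exact_mod_cast (by omega : 0 < q)
  have hdiff : ∀ u, 0 < u → |dilSum (diffFun q) Ψ u| ≤ (K * (1 + (q : ℝ) ^ δ)) * u ^ (-δ) := by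
    intro u hu
    rw [dilSum_diffFun (hs q hqs)]
    calc |Ψ u - Ψ (u / q)| = |(Ψ u - c') - (Ψ (u / q) - c')| := by ring_nf
      _ ≤ |Ψ u - c'| + |Ψ (u / q) - c'| := abs_sub _ _
      _ ≤ K * u ^ (-δ) + K * (u / q) ^ (-δ) := add_le_add (hK u hu) (hK _ (by positivity))
      _ = _ := by
        rw [Real.div_rpow hu.le hq0.le, Real.rpow_neg hq0.le, div_inv_eq_mul]; ring
  set α : ArithmeticFunction ℝ := g * ∏ p ∈ (s \ t).erase q, diffFun p with hα
  have hwα : ∀ σ, -(1 / 4) ≤ σ → WSummable σ α := fun σ hσ =>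
    (hg.mono hσ).mul (WSummable.finset_prod _ fun p _ => wsummable_diffFun σ p)
  have e : g * (∏ p ∈ s, diffFun p) * invFun ^ k =
      α * (diffFun q * ∏ p ∈ t, diffFun p * invFun) := by
    rw [← Finset.prod_sdiff hts, ← Finset.mul_prod_erase (s \ t) _ (Finset.mem_sdiff.2 ⟨hqs, hqt⟩),
      Finset.prod_mul_distrib, Finset.prod_const, ht, hα]
    ring
  obtain ⟨K', -, hK'⟩ := hΦ.linear
  have hK'' : ∀ u, 0 < u → |Φ u| ≤ K' * u ^ (1 : ℝ) := by simpa using hK'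
  refine ⟨(K * (1 + (q : ℝ) ^ δ)) * ∑' n : ℕ, |α n| * (n : ℝ) ^ (-(-δ)), fun y hy => ?_⟩
  rw [e, dilSum_mul (σ := 1) (K := K') (hwα 1 (by norm_num)) ((wsummable_diffFun 1 q).mul hw) hK'' hy]
  refine abs_dilSum_le (hwα (-δ) (by linarith)) (Φ := dilSum (diffFun q * ∏ p ∈ t, diffFun p * invFun) Φ) (fun u hu => ?_) hy
  rw [dilSum_mul (σ := 1) (K := K') (wsummable_diffFun 1 q) hw hK'' hu]
  exact hdiff u hu

/-! ### The two weights and their lattice discrepancies -/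

/-- The truncated linear weight `max 0 (min 1 z - 1 / 2)`. -/
noncomputable def rampWeight (z : ℝ) : ℝ := max 0 (min 1 z - 1 / 2)

/-- The weight `z` on `[1, 2)`, and `0` elsewhere. -/
noncomputable def dyadicWeight (z : ℝ) : ℝ := if 1 ≤ z ∧ z < 2 then z else 0

/-- The arithmetic zeta function with real values. -/
noncomputable def oneFun : ArithmeticFunction ℝ := ⟨fun n => if n = 0 then 0 else 1, by simp⟩

lemma oneFun_apply {n : ℕ} (hn : n ≠ 0) : oneFun n = 1 := if_neg hn

lemma wsummable_oneFun {σ : ℝ} (hσ : 1 < σ) : WSummable σ oneFun := by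
  have := Real.summable_nat_rpow (p := -σ) |>.2 (by linarith)
  refine this.congr fun n => ?_
  rcases Nat.eq_zero_or_pos n with rfl | hn
  · simp [Real.zero_rpow (by linarith : -σ ≠ 0)]
  rw [oneFun_apply hn.ne']; simp

lemma rampWeight_nonneg (z : ℝ) : 0 ≤ rampWeight z := le_max_left _ _

lemma rampWeight_le (z : ℝ) : rampWeight z ≤ 1 / 2 := by
  rw [rampWeight]
  refine max_le (by norm_num) ?_
  linarith [min_le_left 1 z]

lemma rampWeight_of_le {z : ℝ} (hz : z ≤ 1 / 2) : rampWeight z = 0 := by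
  rw [rampWeight, max_eq_left]
  linarith [min_le_right 1 z]

lemma rampWeight_of_ge {z : ℝ} (hz : 1 ≤ z) : rampWeight z = 1 / 2 := by
  rw [rampWeight, min_eq_left hz]; norm_num

lemma rampWeight_of_mem {z : ℝ} (h1 : 1 / 2 ≤ z) (h2 : z ≤ 1) : rampWeight z = z - 1 / 2 := by
  rw [rampWeight, min_eq_right h2, max_eq_right (by linarith)]

lemma rampWeight_mono {u v : ℝ} (h : u ≤ v) : rampWeight u ≤ rampWeight v := by
  unfold rampWeight; gcongr

lemma rampWeight_sub_le {u v : ℝ} (h : u ≤ v) : rampWeight v - rampWeight u ≤ v - u := by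
  unfold rampWeight
  rcases max_cases 0 (min 1 v - 1 / 2) with ⟨h1, h1'⟩ | ⟨h1, h1'⟩ <;>
  rcases max_cases 0 (min 1 u - 1 / 2) with ⟨h2, h2'⟩ | ⟨h2, h2'⟩ <;>
  rcases min_cases 1 v with ⟨h3, h3'⟩ | ⟨h3, h3'⟩ <;>
  rcases min_cases 1 u with ⟨h4, h4'⟩ | ⟨h4, h4'⟩ <;> linarith

lemma abs_rampWeight_le_sq (u : ℝ) : |rampWeight u| ≤ 1 * u ^ (2 : ℝ) := by
  rw [abs_of_nonneg (rampWeight_nonneg u), one_mul, Real.rpow_two]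
  refine max_le (by positivity) ?_
  nlinarith [min_le_right 1 u, sq_nonneg (u - 1 / 2)]

lemma abs_dyadicWeight_le_sq (u : ℝ) : |dyadicWeight u| ≤ 1 * u ^ (2 : ℝ) := by
  rw [one_mul, Real.rpow_two, dyadicWeight]
  split_ifs with h
  · rw [abs_of_nonneg (by linarith)]; nlinarith
  · simp [sq_nonneg]

lemma dilSum_oneFun_eq_sum {w : ℝ → ℝ} {c y : ℝ} (hc : 0 < c) (hw : ∀ z, 0 < z → z < c → w z = 0)
    (hy : 0 < y) : dilSum oneFun w y = ∑ m ∈ Finset.Ioc 0 ⌊y / c⌋₊, w (y / m) := by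
  rw [dilSum, tsum_eq_sum (s := Finset.Ioc 0 ⌊y / c⌋₊)]
  · refine Finset.sum_congr rfl fun m hm => ?_
    rw [oneFun_apply (by have := (Finset.mem_Ioc.1 hm).1; omega), one_mul]
  · intro m hm
    rcases Nat.eq_zero_or_pos m with rfl | hm0
    · simp
    have hm' : (0 : ℝ) < m := by exact_mod_cast hm0
    have : y / c < m := by
      rw [← Nat.floor_lt (by positivity)]
      simp only [Finset.mem_Ioc, not_and, not_le] at hm
      exact hm hm0
    rw [hw _ (by positivity), mul_zero]
    rw [div_lt_iff₀ hm']; rwa [div_lt_iff₀ hc, mul_comm] at this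

lemma dilSum_oneFun_rampWeight {y : ℝ} (hy : 0 < y) :
    dilSum oneFun rampWeight y = ∑ m ∈ Finset.Ioc 0 ⌊2 * y⌋₊, rampWeight (y / m) := by
  rw [dilSum_oneFun_eq_sum (c := 1 / 2) (by norm_num) (fun z _ hz => rampWeight_of_le hz.le) hy]
  congr 3; ring

/-- The discrepancy between the weighted lattice sum of `rampWeight` and its main term. -/
noncomputable def rampDefect (y : ℝ) : ℝ := dilSum oneFun rampWeight y - y * Real.log 2

/-- The discrepancy between the weighted lattice sum of `dyadicWeight` and its main term. -/
noncomputable def dyadicDefect (y : ℝ) : ℝ := dilSum oneFun dyadicWeight y - y * Real.log 2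

lemma dilSum_rampWeight_nonneg {y : ℝ} (hy : 0 < y) : 0 ≤ dilSum oneFun rampWeight y := by
  rw [dilSum_oneFun_rampWeight hy]
  exact Finset.sum_nonneg fun _ _ => rampWeight_nonneg _

lemma dilSum_rampWeight_le {y : ℝ} (hy : 0 < y) : dilSum oneFun rampWeight y ≤ y := by
  rw [dilSum_oneFun_rampWeight hy]
  calc _ ≤ ∑ m ∈ Finset.Ioc 0 ⌊2 * y⌋₊, (1 / 2 : ℝ) := Finset.sum_le_sum fun _ _ => rampWeight_le _
    _ = ⌊2 * y⌋₊ * (1 / 2) := by simp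
    _ ≤ (2 * y) * (1 / 2) := by gcongr; exact Nat.floor_le (by positivity)
    _ = y := by ring

lemma log_two_mem : 0 < Real.log 2 ∧ Real.log 2 < 1 :=
  ⟨Real.log_pos (by norm_num), Real.log_two_lt_d9.trans (by norm_num)⟩

lemma abs_rampDefect_le {y : ℝ} (hy : 0 < y) : |rampDefect y| ≤ 1 * y := by
  have h1 := dilSum_rampWeight_nonneg hy
  have h2 := dilSum_rampWeight_le hy
  obtain ⟨h3, h4⟩ := log_two_mem
  have h5 : y * Real.log 2 ≤ y * 1 := by gcongr
  have h6 : 0 ≤ y * Real.log 2 := by positivity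
  rw [rampDefect, abs_le]
  constructor <;> linarith

/-- The weight is constant for z ≥ 1 and zero for z ≤ 1/2, so when v < 2u only the m in (u, 2v]
contribute, each at most (v - u)/m. There are at most 4u of them if u ≥ 1 and at most 3 if u < 1.
For v ≥ 2u the bounds 0 and y for the sum are enough. -/
lemma dilSum_rampWeight_sub {u v : ℝ} (hu : 0 < u) (huv : u ≤ v) :
    |dilSum oneFun rampWeight v - dilSum oneFun rampWeight u| ≤ 5 * (v - u) := by
  have hv : 0 < v := hu.trans_le huv
  rcases le_or_gt (2 * u) v with h | h
  · have h1 := dilSum_rampWeight_nonneg hu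
    have h2 := dilSum_rampWeight_nonneg hv
    have h3 := dilSum_rampWeight_le hu
    have h4 := dilSum_rampWeight_le hv
    rw [abs_le]
    constructor <;> linarith
  · have hext : dilSum oneFun rampWeight u = ∑ m ∈ Finset.Ioc 0 ⌊2 * v⌋₊, rampWeight (u / m) := by
      rw [dilSum_oneFun_rampWeight hu]
      refine Finset.sum_subset (Finset.Ioc_subset_Ioc_right (by gcongr)) fun m hm hm2 => ?_
      have hm0 := (Finset.mem_Ioc.1 hm).1
      have hm' : (0 : ℝ) < m := by exact_mod_cast hm0
      simp only [Finset.mem_Ioc, not_and, not_le] at hm2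
      have := (Nat.floor_lt (by positivity)).1 (hm2 hm0)
      apply rampWeight_of_le
      rw [div_le_iff₀ hm']; linarith
    rw [hext, dilSum_oneFun_rampWeight hv, ← Finset.sum_sub_distrib]
    set s := (Finset.Ioc 0 ⌊2 * v⌋₊).filter fun m : ℕ => u < m with hs
    have hcard : ∀ B : ℝ, (∀ m ∈ s, (m : ℝ)⁻¹ ≤ B) → 0 ≤ B → (s.card : ℝ) * B ≤ 5 →
        |∑ m ∈ Finset.Ioc 0 ⌊2 * v⌋₊, (rampWeight (v / m) - rampWeight (u / m))| ≤ 5 * (v - u) := by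
      intro B hB hB0 hB5
      rw [← Finset.sum_filter_of_ne (p := fun m : ℕ => u < m)]
      · calc _ ≤ ∑ m ∈ s, |rampWeight (v / m) - rampWeight (u / m)| := Finset.abs_sum_le_sum_abs _ _
          _ ≤ ∑ m ∈ s, B * (v - u) := by
            refine Finset.sum_le_sum fun m hm => ?_
            have huvm : u / m ≤ v / m := by gcongr
            rw [abs_of_nonneg (sub_nonneg.2 (rampWeight_mono huvm))]
            refine (rampWeight_sub_le huvm).trans ?_
            rw [← sub_div, div_eq_inv_mul]
            have := hB m hm
            gcongr
          _ = (s.card * B) * (v - u) := by simp; ring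
          _ ≤ _ := by gcongr
      · intro m hm hne
        by_contra hmu
        have hm0 := (Finset.mem_Ioc.1 hm).1
        have hm' : (0 : ℝ) < m := by exact_mod_cast hm0
        push Not at hmu
        have hmv := hmu.trans huv
        apply hne
        rw [rampWeight_of_ge (by rw [le_div_iff₀ hm', one_mul]; linarith),
          rampWeight_of_ge (by rw [le_div_iff₀ hm', one_mul]; linarith), sub_self]
    rcases le_or_gt 1 u with hu1 | hu1
    · refine hcard u⁻¹ (fun m hm => ?_) (by positivity) ?_
      · exact inv_anti₀ hu (Finset.mem_filter.1 hm).2.le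
      · have hsub : s ⊆ Finset.Ioc ⌊u⌋₊ ⌊2 * v⌋₊ := by
          intro m hm
          obtain ⟨h1, h2⟩ := Finset.mem_filter.1 hm
          exact Finset.mem_Ioc.2 ⟨(Nat.floor_lt hu.le).2 h2, (Finset.mem_Ioc.1 h1).2⟩
        have h1 := Finset.card_le_card hsub
        rw [Nat.card_Ioc] at h1
        have h2 : (s.card : ℝ) ≤ ⌊2 * v⌋₊ - ⌊u⌋₊ := by
          have hle : ⌊u⌋₊ ≤ ⌊2 * v⌋₊ := by gcongr; linarith
          rw [← Nat.cast_sub hle]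
          exact_mod_cast h1
        have h3 : (⌊2 * v⌋₊ : ℝ) ≤ 2 * v := Nat.floor_le (by positivity)
        have h4 := Nat.lt_floor_add_one u
        rw [← div_eq_mul_inv, div_le_iff₀ hu]
        linarith
    · refine hcard 1 (fun m hm => ?_) zero_le_one ?_
      · have hm0 := (Finset.mem_Ioc.1 (Finset.mem_filter.1 hm).1).1
        exact inv_le_one_of_one_le₀ (by exact_mod_cast hm0)
      · have h1 : s.card ≤ (Finset.Ioc 0 ⌊2 * v⌋₊).card := Finset.card_filter_le _ _
        have h2 : (s.card : ℝ) ≤ (⌊2 * v⌋₊ : ℝ) := by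
          rw [Nat.card_Ioc, Nat.sub_zero] at h1; exact_mod_cast h1
        have h3 : (⌊2 * v⌋₊ : ℝ) ≤ 2 * v := Nat.floor_le (by positivity)
        linarith

lemma rampDefect_lipschitz {u v : ℝ} (hu : 0 < u) (hv : 0 < v) :
    |rampDefect u - rampDefect v| ≤ 6 * |u - v| := by
  wlog h : v ≤ u generalizing u v
  · rw [abs_sub_comm, abs_sub_comm u]
    exact this hv hu (le_of_not_ge h)
  obtain ⟨h3, h4⟩ := log_two_mem
  rw [abs_of_nonneg (sub_nonneg.2 h)]
  have e : rampDefect u - rampDefect v = (dilSum oneFun rampWeight u - dilSum oneFun rampWeight v)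
      - (u - v) * Real.log 2 := by rw [rampDefect, rampDefect]; ring
  rw [e]
  have h5 : |(u - v) * Real.log 2| ≤ (u - v) * 1 := by
    rw [abs_of_nonneg (mul_nonneg (by linarith) h3.le)]
    gcongr
  have := dilSum_rampWeight_sub hv h
  have := abs_sub (dilSum oneFun rampWeight u - dilSum oneFun rampWeight v) ((u - v) * Real.log 2)
  linarith

/-- Expanding log(1 - t) to second order at t = 1/(K+1), the terms in t and t² of the increment
cancel; the rest is O(t³) and can be summed over the tail. -/
lemma abs_harmonic_sub_log_sub_le {N : ℕ} (hN : 0 < N) :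
    |(harmonic N : ℝ) - Real.log N - 1 / (2 * N) - Real.eulerMascheroniConstant| ≤ 3 / (N : ℝ) ^ 2 := by
  set D : ℕ → ℝ := fun n => (harmonic n : ℝ) - Real.log n - 1 / (2 * n) with hD
  have hlim : Tendsto D atTop (𝓝 Real.eulerMascheroniConstant) := by
    have h1 : Tendsto (fun n : ℕ => 1 / (2 * (n : ℝ))) atTop (𝓝 0) := by
      have := tendsto_const_div_atTop_nhds_zero_nat (1 / 2 : ℝ)
      refine this.congr fun n => ?_
      rw [div_div]
    have := Real.tendsto_harmonic_sub_log.sub h1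
    rwa [sub_zero] at this
  rw [abs_sub_comm]
  refine abs_sub_le_of_tendsto (by norm_num) hlim (fun K => ?_) hN
  -- At K = 0 the junk values log 0 = 0 and 1/0 = 0 give D 0 = 0, and the bound is a numerical
  -- check.
  rcases Nat.eq_zero_or_pos K with rfl | hK
  · simp [hD, harmonic]; norm_num
  have hK' : (1 : ℝ) ≤ K := by exact_mod_cast hK
  set t : ℝ := 1 / ((K : ℝ) + 1) with ht
  have ht0 : 0 < t := by positivity
  have ht1 : t ≤ 1 / 2 := by rw [ht]; gcongr; linarith
  have h := Real.abs_log_sub_add_sum_range_le (x := t) (by rw [abs_of_pos ht0]; linarith) 2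
  rw [abs_of_pos ht0] at h
  have h1 : Real.log (1 - t) = Real.log K - Real.log (K + 1) := by
    rw [← Real.log_div (by positivity) (by positivity)]
    congr 1; rw [ht]; field_simp; ring
  have h2 : t ^ 3 / (1 - t) ≤ 2 * t ^ 3 := by
    rw [div_le_iff₀ (by linarith)]
    nlinarith [pow_pos ht0 3]
  have h3 : 1 / (2 * (K : ℝ)) = t / 2 + t ^ 2 / 2 + t ^ 3 / 2 / (1 - t) := by
    have : 1 - t = K / (K + 1) := by rw [ht]; field_simp; ring
    rw [this, ht]; field_simp; ring
  have e : D (K + 1) - D K =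
      (∑ i ∈ Finset.range 2, t ^ (i + 1) / ((i : ℝ) + 1) + Real.log (1 - t)) + t ^ 3 / (1 - t) / 2 := by
    have e1 : ((harmonic (K + 1) : ℚ) : ℝ) = (harmonic K : ℝ) + t := by
      rw [harmonic_succ]; push_cast; rw [ht, one_div]
    have e2 : 1 / (2 * (((K + 1 : ℕ)) : ℝ)) = t / 2 := by rw [ht]; push_cast; field_simp
    simp only [hD]
    rw [e1, e2, h3, h1, Finset.sum_range_succ, Finset.sum_range_one]
    push_cast
    ring
  have e3 : (3 : ℝ) / ((K : ℝ) + 1) ^ 3 = 3 * t ^ 3 := by rw [ht]; field_simp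
  have h4 : 0 ≤ t ^ 3 / (1 - t) := div_nonneg (by positivity) (by linarith)
  rw [e, e3]
  refine (abs_add_le _ _).trans ?_
  rw [abs_of_nonneg (by positivity : 0 ≤ t ^ 3 / (1 - t) / 2)]
  norm_num at h ⊢
  linarith

lemma sum_Ioc_inv_eq {a b : ℕ} (hab : a ≤ b) :
    ∑ m ∈ Finset.Ioc a b, (m : ℝ)⁻¹ = (harmonic b : ℝ) - harmonic a := by
  rw [← sum_range_inv_eq_harmonic, ← sum_range_inv_eq_harmonic,
    ← Finset.sum_Ico_eq_sub _ (by omega)]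
  congr 1
  ext m; simp only [Finset.mem_Ico, Finset.mem_Ioc]; omega

/-- The plateau of the weight is m ≤ ⌊y⌋, its sloping part ⌊y⌋ < m ≤ ⌊2y⌋. -/
lemma dilSum_rampWeight_eq {y : ℝ} (hy : 0 < y) :
    dilSum oneFun rampWeight y = ⌊y⌋₊ - ⌊2 * y⌋₊ / 2 +
      y * ((harmonic ⌊2 * y⌋₊ : ℝ) - harmonic ⌊y⌋₊) := by
  have hle : ⌊y⌋₊ ≤ ⌊2 * y⌋₊ := by gcongr; linarith
  rw [dilSum_oneFun_rampWeight hy, ← Finset.sum_Ioc_consecutive _ (Nat.zero_le _) hle]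
  have h1 : ∑ m ∈ Finset.Ioc 0 ⌊y⌋₊, rampWeight (y / m) = ⌊y⌋₊ / 2 := by
    rw [Finset.sum_congr rfl (g := fun _ => (1 / 2 : ℝ))]
    · simp; ring
    · intro m hm
      obtain ⟨h1, h2⟩ := Finset.mem_Ioc.1 hm
      have hm' : (0 : ℝ) < m := by exact_mod_cast h1
      apply rampWeight_of_ge
      rw [le_div_iff₀ hm', one_mul]
      exact (Nat.le_floor_iff hy.le).1 h2
  have h2 : ∑ m ∈ Finset.Ioc ⌊y⌋₊ ⌊2 * y⌋₊, rampWeight (y / m) =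
      ∑ m ∈ Finset.Ioc ⌊y⌋₊ ⌊2 * y⌋₊, (y * (m : ℝ)⁻¹ - 1 / 2) := by
    refine Finset.sum_congr rfl fun m hm => ?_
    obtain ⟨h1, h2⟩ := Finset.mem_Ioc.1 hm
    have hm' : (0 : ℝ) < m := by exact_mod_cast (Nat.zero_le _).trans_lt h1
    have h3 := (Nat.le_floor_iff (by positivity)).1 h2
    have h4 := (Nat.floor_lt hy.le).1 h1
    rw [rampWeight_of_mem, div_eq_mul_inv]
    · rw [le_div_iff₀ hm']; linarith
    · rw [div_le_iff₀ hm']; linarith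
  rw [h1, h2, Finset.sum_sub_distrib, ← Finset.mul_sum, sum_Ioc_inv_eq hle, Finset.sum_const,
    Nat.card_Ioc, nsmul_eq_mul, Nat.cast_sub hle]
  ring

lemma abs_log_one_sub_add_le {t : ℝ} (h0 : 0 ≤ t) (h1 : t ≤ 1 / 2) :
    |Real.log (1 - t) + t| ≤ 2 * t ^ 2 := by
  have h := Real.abs_log_sub_add_sum_range_le (x := t) (by rw [abs_of_nonneg h0]; linarith) 1
  rw [abs_of_nonneg h0] at h
  simp only [Finset.sum_range_one] at h
  norm_num at h
  rw [add_comm]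
  refine h.trans ?_
  rw [div_le_iff₀ (by linarith)]
  nlinarith [sq_nonneg t]

/-- The fractional parts of y and 2y cancel to first order: ⌊y⌋ - ⌊2y⌋/2 equals y(f₂ - f), which is
matched by the linear parts of log(1 - f₂) and log(1 - f). The constant comes from the 1/(2N) terms
of the harmonic numbers, as y/(2N₂) - y/(2N) tends to 1/4 - 1/2. -/
lemma abs_rampDefect_add_le {y : ℝ} (hy : 2 ≤ y) : |rampDefect y + 1 / 4| ≤ 40 * y⁻¹ := by
  have hy0 : 0 < y := by linarith
  rw [rampDefect, dilSum_rampWeight_eq hy0]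
  set N := ⌊y⌋₊ with hN
  set N₂ := ⌊2 * y⌋₊ with hN₂
  have a1 : (N : ℝ) ≤ y := Nat.floor_le hy0.le
  have a2 : y < N + 1 := Nat.lt_floor_add_one y
  have b1 : (N₂ : ℝ) ≤ 2 * y := Nat.floor_le (by positivity)
  have b2 : 2 * y < N₂ + 1 := Nat.lt_floor_add_one _
  have hNy : y / 2 ≤ N := by linarith
  have hN₂y : y ≤ N₂ := by linarith
  have hN0 : 0 < N := by
    have : (0 : ℝ) < N := by linarith
    exact_mod_cast this
  have hN₂0 : 0 < N₂ := by
    have : (0 : ℝ) < N₂ := by linarith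
    exact_mod_cast this
  have hN0' : (0 : ℝ) < N := by exact_mod_cast hN0
  have hN₂0' : (0 : ℝ) < N₂ := by exact_mod_cast hN₂0
  have e1 := abs_harmonic_sub_log_sub_le hN0
  have e2 := abs_harmonic_sub_log_sub_le hN₂0
  set f : ℝ := 1 - N / y with hf
  set f₂ : ℝ := 1 - N₂ / (2 * y) with hf₂
  have hf0 : 0 ≤ f := by rw [hf, sub_nonneg, div_le_one hy0]; exact a1
  have hfy : f ≤ y⁻¹ := by
    have : f * y ≤ 1 := by rw [hf, sub_mul, div_mul_cancel₀ _ hy0.ne']; linarith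
    rwa [← one_div, le_div_iff₀ hy0]
  have hf₂0 : 0 ≤ f₂ := by rw [hf₂, sub_nonneg, div_le_one (by positivity)]; exact b1
  have hf₂y : f₂ ≤ y⁻¹ := by
    have : f₂ * (2 * y) ≤ 1 := by rw [hf₂, sub_mul, div_mul_cancel₀ _ (by positivity)]; linarith
    rw [← one_div, le_div_iff₀ hy0]; nlinarith
  have hyi : y⁻¹ ≤ 1 / 2 := by rw [inv_le_comm₀ hy0 (by norm_num)]; norm_num; exact hy
  have hyi0 : 0 < y⁻¹ := by positivity
  have l1 := abs_log_one_sub_add_le hf0 (hfy.trans hyi)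
  have l2 := abs_log_one_sub_add_le hf₂0 (hf₂y.trans hyi)
  have g1 : Real.log (1 - f) = Real.log N - Real.log y := by
    rw [← Real.log_div (by positivity) (by positivity)]; congr 1; rw [hf]; ring
  have g2 : Real.log (1 - f₂) = Real.log N₂ - (Real.log 2 + Real.log y) := by
    rw [← Real.log_mul (by norm_num) (by positivity),
      ← Real.log_div (by positivity) (by positivity)]; congr 1; rw [hf₂]; ring
  set A := (harmonic N : ℝ) - Real.log N - 1 / (2 * N) - Real.eulerMascheroniConstant with hA
  set A₂ := (harmonic N₂ : ℝ) - Real.log N₂ - 1 / (2 * N₂) - Real.eulerMascheroniConstant with hA₂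
  have hNf : (N : ℝ) = y - y * f := by rw [hf]; field_simp; ring
  have hN₂f : (N₂ : ℝ) = 2 * y - 2 * y * f₂ := by rw [hf₂]; field_simp; ring
  have key : (N : ℝ) - N₂ / 2 + y * ((harmonic N₂ : ℝ) - harmonic N) - y * Real.log 2 + 1 / 4
      = (y * A₂ - y * A) + (y * (Real.log (1 - f₂) + f₂) - y * (Real.log (1 - f) + f)) +
        ((y / (2 * N₂) - 1 / 4) - (y / (2 * N) - 1 / 2)) := by
    have e3 : (N : ℝ) - N₂ / 2 = y * f₂ - y * f := by rw [hNf, hN₂f]; ring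
    rw [e3, g1, g2, hA, hA₂]; ring
  have c1 : |y * A₂| ≤ 3 * y⁻¹ := by
    rw [abs_mul, abs_of_pos hy0]
    calc y * |A₂| ≤ y * (3 / y ^ 2) := by
          gcongr; exact e2.trans (by gcongr)
      _ = _ := by field_simp
  have c2 : |y * A| ≤ 12 * y⁻¹ := by
    rw [abs_mul, abs_of_pos hy0]
    calc y * |A| ≤ y * (3 / (y / 2) ^ 2) := by
          gcongr; exact e1.trans (by gcongr)
      _ = _ := by field_simp; norm_num
  have c3 : |y * (Real.log (1 - f) + f)| ≤ 2 * y⁻¹ := by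
    rw [abs_mul, abs_of_pos hy0]
    calc _ ≤ y * (2 * (y⁻¹) ^ 2) := by gcongr; exact l1.trans (by gcongr)
      _ = _ := by field_simp
  have c4 : |y * (Real.log (1 - f₂) + f₂)| ≤ 2 * y⁻¹ := by
    rw [abs_mul, abs_of_pos hy0]
    calc _ ≤ y * (2 * (y⁻¹) ^ 2) := by gcongr; exact l2.trans (by gcongr)
      _ = _ := by field_simp
  have c5 : |y / (2 * N₂) - 1 / 4| ≤ y⁻¹ := by
    have e : y / (2 * N₂) - 1 / 4 = (2 * y - N₂) / (4 * N₂) := by field_simp; ring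
    rw [e, abs_of_nonneg (div_nonneg (by linarith) (by positivity)), ← one_div]
    gcongr <;> linarith
  have c6 : |y / (2 * N) - 1 / 2| ≤ y⁻¹ := by
    have e : y / (2 * N) - 1 / 2 = (y - N) / (2 * N) := by field_simp
    rw [e, abs_of_nonneg (div_nonneg (by linarith) (by positivity)), ← one_div]
    gcongr <;> linarith
  rw [key]
  refine (abs_add_three _ _ _).trans ?_
  have d1 := (abs_sub (y * A₂) (y * A)).trans (add_le_add c1 c2)
  have d2 := (abs_sub _ _).trans (add_le_add c4 c3)
  have d3 := (abs_sub _ _).trans (add_le_add c5 c6)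
  linarith only [d1, d2, d3, hyi0]

lemma hasLimitRate_rampDefect : HasLimitRate rampDefect (-(1 / 4)) 1 := by
  refine ⟨⟨6, by norm_num, fun u v hu hv => rampDefect_lipschitz hu hv⟩,
    ⟨1, by norm_num, fun u hu => abs_rampDefect_le hu⟩, ⟨40, by norm_num, fun u hu => ?_⟩⟩
  rw [sub_neg_eq_add, Real.rpow_neg_one]
  rcases le_or_gt 2 u with h | h
  · exact abs_rampDefect_add_le h
  · have h1 := abs_rampDefect_le hu
    have h2 := abs_add_le (rampDefect u) (1 / 4)
    rw [abs_of_pos (by norm_num : (0 : ℝ) < 1 / 4)] at h2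
    have h3 : 1 / 2 ≤ u⁻¹ := by
      rw [one_div]; exact inv_anti₀ hu h.le
    linarith

lemma dilSum_dyadicWeight_eq {y : ℝ} (hy : 0 < y) :
    dilSum oneFun dyadicWeight y = ∑ m ∈ Finset.Ioc ⌊y / 2⌋₊ ⌊y⌋₊, y / m := by
  rw [dilSum_oneFun_eq_sum (c := 1) one_pos
    (fun z _ hz => by rw [dyadicWeight, if_neg (by intro h; linarith)]) hy, div_one]
  have hle : ⌊y / 2⌋₊ ≤ ⌊y⌋₊ := by gcongr; linarith
  symm
  refine Finset.sum_subset_zero_on_sdiff (Finset.Ioc_subset_Ioc_left (Nat.zero_le _)) ?_ ?_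
  · intro m hm
    obtain ⟨h1, h2⟩ := Finset.mem_sdiff.1 hm
    have hm0 := (Finset.mem_Ioc.1 h1).1
    have hm' : (0 : ℝ) < m := by exact_mod_cast hm0
    have h3 : m ≤ ⌊y / 2⌋₊ := by
      by_contra hcon
      exact h2 (Finset.mem_Ioc.2 ⟨by omega, (Finset.mem_Ioc.1 h1).2⟩)
    have h4 := (Nat.le_floor_iff (by positivity)).1 h3
    rw [dyadicWeight, if_neg]
    rintro ⟨-, h5⟩
    rw [div_lt_iff₀ hm'] at h5
    linarith
  · intro m hm
    obtain ⟨h1, h2⟩ := Finset.mem_Ioc.1 hm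
    have hm' : (0 : ℝ) < m := by exact_mod_cast (Nat.zero_le _).trans_lt h1
    have h3 := (Nat.le_floor_iff (by positivity)).1 h2
    have h4 := (Nat.floor_lt (by positivity)).1 h1
    rw [dyadicWeight, if_pos]
    constructor
    · rw [le_div_iff₀ hm']; linarith
    · rw [div_lt_iff₀ hm']; linarith

lemma abs_harmonic_sub_log_le {x : ℝ} (hx : 1 ≤ x) :
    |(harmonic ⌊x⌋₊ : ℝ) - Real.log x - Real.eulerMascheroniConstant| ≤ 2 / x := by
  have hN : 0 < ⌊x⌋₊ := (Nat.one_le_floor_iff x).2 hx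
  obtain ⟨h1, h2⟩ := harmonic_bounds hN
  have hN' : (0 : ℝ) < ⌊x⌋₊ := by exact_mod_cast hN
  have hN1 : (1 : ℝ) ≤ ⌊x⌋₊ := by exact_mod_cast hN
  have h3 := log_succ_sub_log_le hN'
  have h4 : (⌊x⌋₊ : ℝ) ≤ x := Nat.floor_le (by linarith)
  have h5 := (Nat.lt_floor_add_one x).le
  have h6 := Real.log_le_log hN' h4
  have h7 := Real.log_le_log (by linarith) h5
  have h8 : 1 / (⌊x⌋₊ : ℝ) ≤ 2 / x := by
    rw [div_le_div_iff₀ hN' (by linarith)]; linarith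
  rw [abs_le]
  constructor <;> linarith

/-- For y ≥ 1 the defect is in fact bounded. A positive exponent is stated because
`wsummable_kernelFun` gives convergence only at positive exponents, and 1/4 is small enough for the
error at x/M. -/
lemma abs_dyadicDefect_le {y : ℝ} (hy : 0 < y) : |dyadicDefect y| ≤ 6 * y ^ (1 / 4 : ℝ) := by
  obtain ⟨l3, l4⟩ := log_two_mem
  rw [dyadicDefect, dilSum_dyadicWeight_eq hy]
  have hle : ⌊y / 2⌋₊ ≤ ⌊y⌋₊ := by gcongr; linarith
  have e : ∑ m ∈ Finset.Ioc ⌊y / 2⌋₊ ⌊y⌋₊, y / m = y * ((harmonic ⌊y⌋₊ : ℝ) - harmonic ⌊y / 2⌋₊) := by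
    rw [← sum_Ioc_inv_eq hle, Finset.mul_sum]
    exact Finset.sum_congr rfl fun m _ => div_eq_mul_inv _ _
  rw [e]
  rcases lt_or_ge y 1 with h1 | h1
  · have : ⌊y⌋₊ = 0 := Nat.floor_eq_zero.2 h1
    have h2 : ⌊y / 2⌋₊ = 0 := Nat.floor_eq_zero.2 (by linarith)
    rw [this, h2, sub_self, mul_zero, zero_sub, abs_neg, abs_of_pos (by positivity)]
    have h3 : y ≤ y ^ (1 / 4 : ℝ) := by
      calc y = y ^ (1 : ℝ) := (Real.rpow_one y).symm
        _ ≤ _ := Real.rpow_le_rpow_of_exponent_ge hy h1.le (by norm_num)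
    nlinarith
  have hy1 : 1 ≤ y ^ (1 / 4 : ℝ) := Real.one_le_rpow h1 (by norm_num)
  refine le_trans ?_ (le_mul_of_one_le_right (by norm_num) hy1)
  rcases lt_or_ge y 2 with h2 | h2
  · have : ⌊y⌋₊ = 1 := by rw [Nat.floor_eq_iff hy.le]; norm_num; exact ⟨h1, h2⟩
    have h3 : ⌊y / 2⌋₊ = 0 := Nat.floor_eq_zero.2 (by linarith)
    rw [this, h3]
    simp only [harmonic, Finset.sum_range_one, Finset.range_zero, Finset.sum_empty]
    norm_num
    rw [abs_le]
    constructor <;> nlinarith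
  · have a1 := abs_harmonic_sub_log_le h1
    have a2 := abs_harmonic_sub_log_le (x := y / 2) (by linarith)
    rw [Real.log_div (by positivity) (by norm_num)] at a2
    set A := (harmonic ⌊y⌋₊ : ℝ) - Real.log y - Real.eulerMascheroniConstant
    set A₂ := (harmonic ⌊y / 2⌋₊ : ℝ) - (Real.log y - Real.log 2) - Real.eulerMascheroniConstant
    have e2 : y * ((harmonic ⌊y⌋₊ : ℝ) - harmonic ⌊y / 2⌋₊) - y * Real.log 2 = y * (A - A₂) := by
      ring
    rw [e2, abs_mul, abs_of_pos hy]
    calc y * |A - A₂| ≤ y * (2 / y + 2 / (y / 2)) := by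
          gcongr; exact (abs_sub _ _).trans (add_le_add a1 a2)
      _ = 6 := by field_simp; norm_num

/-! ### Multiplicative functions from local power series -/

/-- The multiplicative arithmetic function with local power series `G p` at `p`. -/
noncomputable def eulerArith (G : ℕ → PowerSeries ℝ) : ArithmeticFunction ℝ :=
  ⟨fun n => if n = 0 then 0 else n.factorization.prod fun p e => PowerSeries.coeff e (G p), by simp⟩

lemma eulerArith_apply (G : ℕ → PowerSeries ℝ) {n : ℕ} (hn : n ≠ 0) :
    eulerArith G n = ∏ p ∈ n.primeFactors, PowerSeries.coeff (n.factorization p) (G p) := if_neg hn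

lemma eulerArith_congr {G G' : ℕ → PowerSeries ℝ} (h : ∀ p, p.Prime → G p = G' p) :
    eulerArith G = eulerArith G' := by
  ext n
  rcases eq_or_ne n 0 with rfl | hn
  · simp
  rw [eulerArith_apply _ hn, eulerArith_apply _ hn]
  exact Finset.prod_congr rfl fun p hp => by rw [h p (Nat.prime_of_mem_primeFactors hp)]

lemma eulerArith_isMultiplicative (G : ℕ → PowerSeries ℝ) :
    (eulerArith G).IsMultiplicative := by
  rw [ArithmeticFunction.IsMultiplicative.iff_ne_zero]
  refine ⟨by simp [eulerArith_apply _ one_ne_zero], fun {m n} hm hn hmn => ?_⟩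
  have e : ∀ n, n ≠ 0 → eulerArith G n = n.factorization.prod fun p e => PowerSeries.coeff e (G p) :=
    fun n hn => if_neg hn
  rw [e _ (mul_ne_zero hm hn), e _ hm, e _ hn, Nat.factorization_mul_of_coprime hmn]
  exact Finsupp.prod_add_index_of_disjoint hmn.disjoint_primeFactors _

lemma eulerArith_prime_pow {G : ℕ → PowerSeries ℝ} (hG : ∀ p, PowerSeries.coeff 0 (G p) = 1) {p : ℕ}
    (hp : p.Prime) (e : ℕ) : eulerArith G (p ^ e) = PowerSeries.coeff e (G p) := by
  have h : eulerArith G (p ^ e) =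
      (p ^ e).factorization.prod fun p e => PowerSeries.coeff e (G p) := if_neg (pow_ne_zero _ hp.ne_zero)
  rw [h, hp.factorization_pow, Finsupp.prod_single_index (hG p)]

lemma coeff_zero_mul_eq (f g : PowerSeries ℝ) :
    PowerSeries.coeff 0 (f * g) = PowerSeries.coeff 0 f * PowerSeries.coeff 0 g := by
  simp

/-- Multiplicative functions are determined on prime powers, where Dirichlet convolution is the
Cauchy product. Identities between Dirichlet series thus reduce to one power series identity at each
prime. -/
lemma eulerArith_mul {G G' : ℕ → PowerSeries ℝ} (hG : ∀ p, PowerSeries.coeff 0 (G p) = 1)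
    (hG' : ∀ p, PowerSeries.coeff 0 (G' p) = 1) :
    eulerArith G * eulerArith G' = eulerArith fun p => G p * G' p := by
  have hGG : ∀ p, PowerSeries.coeff 0 (G p * G' p) = 1 := fun p => by
    rw [coeff_zero_mul_eq, hG, hG', one_mul]
  rw [ArithmeticFunction.IsMultiplicative.eq_iff_eq_on_prime_powers _
    ((eulerArith_isMultiplicative G).mul (eulerArith_isMultiplicative G')) _
    (eulerArith_isMultiplicative _)]
  intro p e hp
  rw [ArithmeticFunction.mul_apply, eulerArith_prime_pow hGG hp,
    Nat.sum_divisorsAntidiagonal fun a b => eulerArith G a * eulerArith G' b,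
    Nat.sum_divisors_prime_pow hp, PowerSeries.coeff_mul,
    Finset.Nat.sum_antidiagonal_eq_sum_range_succ fun a b =>
      PowerSeries.coeff a (G p) * PowerSeries.coeff b (G' p)]
  refine Finset.sum_congr rfl fun i hi => ?_
  rw [Nat.pow_div (by have := Finset.mem_range.1 hi; omega) hp.pos, eulerArith_prime_pow hG hp,
    eulerArith_prime_pow hG' hp]

lemma eulerArith_one : eulerArith (fun _ => 1) = 1 := by
  rw [ArithmeticFunction.IsMultiplicative.eq_iff_eq_on_prime_powers _
    (eulerArith_isMultiplicative _) _ ArithmeticFunction.isMultiplicative_one]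
  intro p e hp
  rw [eulerArith_prime_pow (by simp) hp, PowerSeries.coeff_one, ArithmeticFunction.one_apply]
  simp [hp.ne_one]

lemma eulerArith_pow {G : ℕ → PowerSeries ℝ} (hG : ∀ p, PowerSeries.coeff 0 (G p) = 1) (j : ℕ) :
    eulerArith G ^ j = eulerArith fun p => G p ^ j := by
  induction j with
  | zero => simp [eulerArith_one]
  | succ j ih =>
    simp only [pow_succ]
    rw [ih, eulerArith_mul _ hG]
    intro p
    rw [PowerSeries.coeff_zero_eq_constantCoeff_apply, map_pow,
      ← PowerSeries.coeff_zero_eq_constantCoeff_apply, hG, one_pow]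

lemma eulerArith_finset_prod {G : ℕ → ℕ → PowerSeries ℝ}
    (hG : ∀ q p, PowerSeries.coeff 0 (G q p) = 1) (s : Finset ℕ) :
    ∏ q ∈ s, eulerArith (G q) = eulerArith fun p => ∏ q ∈ s, G q p := by
  induction s using Finset.induction_on with
  | empty => simp [eulerArith_one]
  | insert q s hq ih =>
    simp only [Finset.prod_insert hq]
    rw [ih, eulerArith_mul (hG q)]
    intro p
    rw [PowerSeries.coeff_zero_eq_constantCoeff_apply, map_prod]
    exact Finset.prod_eq_one fun r _ => by
      rw [← PowerSeries.coeff_zero_eq_constantCoeff_apply, hG]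

lemma oneFun_eq_eulerArith : oneFun = eulerArith fun _ => PowerSeries.mk 1 := by
  ext n
  rcases eq_or_ne n 0 with rfl | hn
  · simp
  rw [oneFun_apply hn, eulerArith_apply _ hn]
  simp

lemma invFun_eq_eulerArith :
    invFun = eulerArith fun p => PowerSeries.mk fun e => ((p : ℝ)⁻¹) ^ e := by
  ext n
  rcases eq_or_ne n 0 with rfl | hn
  · simp
  rw [eulerArith_apply _ hn, invFun_apply]
  simp only [PowerSeries.coeff_mk]
  nth_rw 1 [← Nat.prod_factorization_pow_eq_self hn]
  rw [Finsupp.prod, Nat.cast_prod, ← Finset.prod_inv_distrib]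
  simp

lemma diffFun_eq_eulerArith {q : ℕ} (hq : q.Prime) :
    diffFun q = eulerArith fun p => if p = q then 1 - PowerSeries.X else 1 := by
  have hG : ∀ p, PowerSeries.coeff 0 ((if p = q then 1 - PowerSeries.X else 1 : PowerSeries ℝ)) = 1 := by
    intro p; split_ifs <;> simp
  ext n
  rcases eq_or_ne n 0 with rfl | hn
  · simp
  by_cases h : ∃ e, n = q ^ e
  · obtain ⟨e, rfl⟩ := h
    rw [eulerArith_prime_pow hG hq, if_pos rfl, diffFun_apply, map_sub, PowerSeries.coeff_one,
      PowerSeries.coeff_X]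
    have h1 : q ^ e = 1 ↔ e = 0 := by rw [Nat.pow_eq_one]; simp [hq.ne_one]
    have h2 : q ^ e = q ↔ e = 1 := by
      nth_rw 2 [← pow_one q]
      exact (Nat.pow_right_injective hq.two_le).eq_iff
    simp only [h1, h2, ne_eq, pow_eq_zero_iff', hq.ne_zero, false_and, not_false_eq_true, and_true]
  · have h1 : n ≠ 1 := fun h1 => h ⟨0, by simpa using h1⟩
    have h2 : n ≠ q := fun h2 => h ⟨1, by simpa using h2⟩
    rw [diffFun_apply, if_neg h1, if_neg (by tauto), sub_zero, eulerArith_apply _ hn]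
    obtain ⟨r, hr, hrn, hrq⟩ : ∃ r, r.Prime ∧ r ∣ n ∧ r ≠ q := by
      by_contra! hcon
      exact h ⟨_, Nat.eq_prime_pow_of_unique_prime_dvd hn fun hd hdn => hcon _ hd hdn⟩
    symm
    refine Finset.prod_eq_zero (Nat.mem_primeFactors.2 ⟨hr, hrn, hn⟩) ?_
    rw [if_neg hrq, PowerSeries.coeff_one, if_neg]
    exact (hr.factorization_pos_of_dvd hn hrn).ne'

lemma one_sub_mul_mk_pow (a : ℝ) :
    (1 - PowerSeries.C a * PowerSeries.X) * PowerSeries.mk (fun e => a ^ e) = 1 := by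
  have h := congrArg (PowerSeries.rescale a) (PowerSeries.mk_one_mul_one_sub_eq_one ℝ)
  rw [map_mul, map_sub, map_one, PowerSeries.rescale_X, mul_comm] at h
  convert h using 2
  ext e
  simp [PowerSeries.coeff_rescale]

/-! ### Factoring 1/γ, and convergence of the correction factor -/

/-- The local excess `ν(p) / (p - ν(p))`, away from the divisors of `P`. -/
noncomputable def excess (ν : ℕ → ℕ) (P p : ℕ) : ℝ :=
  if p ∣ P then 0 else (ν p : ℝ) / ((p : ℝ) - ν p)

/-- The local polynomial `(1 + h X) (1 - X / p) ^ k`, with `h` the local excess. -/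
noncomputable def corrPoly (k : ℕ) (ν : ℕ → ℕ) (P p : ℕ) : Polynomial ℝ :=
  (1 + Polynomial.C (excess ν P p) * Polynomial.X) *
    (((1 - Polynomial.X : Polynomial ℝ) ^ k).comp (Polynomial.C (p : ℝ)⁻¹ * Polynomial.X))

/-- The arithmetic function with Euler factors `corrPoly`. -/
noncomputable def corrFun (k : ℕ) (ν : ℕ → ℕ) (P : ℕ) : ArithmeticFunction ℝ :=
  eulerArith fun p => (corrPoly k ν P p : PowerSeries ℝ)

/-- The function `n ↦ ∏ p ∣ n, (1 - ν(p) / p)⁻¹` restricted to the `n` coprime to `P`. -/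
noncomputable def recipGam (ν : ℕ → ℕ) (P : ℕ) : ArithmeticFunction ℝ :=
  ⟨fun n => if n ≠ 0 ∧ n.Coprime P then (∏ p ∈ n.primeFactors, (1 - (ν p : ℝ) / p))⁻¹ else 0, by simp⟩

lemma recipGam_apply (ν : ℕ → ℕ) (P n : ℕ) : recipGam ν P n =
    if n ≠ 0 ∧ n.Coprime P then (∏ p ∈ n.primeFactors, (1 - (ν p : ℝ) / p))⁻¹ else 0 := rfl

/-- The Dirichlet convolution quotient of `recipGam` by the constant function `1`. -/
noncomputable def kernelFun (k : ℕ) (ν : ℕ → ℕ) (P : ℕ) : ArithmeticFunction ℝ :=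
  corrFun k ν P * (∏ p ∈ P.primeFactors, diffFun p) * invFun ^ k

lemma recipGam_eq_eulerArith (ν : ℕ → ℕ) (P : ℕ) :
    recipGam ν P = eulerArith fun p => PowerSeries.mk fun e =>
      if e = 0 then 1 else if p ∣ P then 0 else (1 - (ν p : ℝ) / p)⁻¹ := by
  ext n
  rcases eq_or_ne n 0 with rfl | hn
  · simp
  rw [eulerArith_apply _ hn, recipGam_apply]
  have h0 : ∀ p ∈ n.primeFactors, n.factorization p ≠ 0 := fun p hp =>
    ((Nat.prime_of_mem_primeFactors hp).factorization_pos_of_dvd hn (Nat.dvd_of_mem_primeFactors hp)).ne'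
  split_ifs with h
  · rw [← Finset.prod_inv_distrib]
    refine Finset.prod_congr rfl fun p hp => ?_
    rw [PowerSeries.coeff_mk, if_neg (h0 p hp), if_neg]
    intro hpP
    exact Nat.not_coprime_of_dvd_of_dvd (Nat.prime_of_mem_primeFactors hp).one_lt
      (Nat.dvd_of_mem_primeFactors hp) hpP h.2
  · obtain ⟨p, hp, hpn, hpP⟩ := Nat.Prime.not_coprime_iff_dvd.1 (fun hc => h ⟨hn, hc⟩)
    have hmem := Nat.mem_primeFactors.2 ⟨hp, hpn, hn⟩
    symm
    refine Finset.prod_eq_zero hmem ?_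
    rw [PowerSeries.coeff_mk, if_neg (h0 p hmem), if_pos hpP]

lemma corrPoly_coe (k : ℕ) (ν : ℕ → ℕ) (P p : ℕ) : (corrPoly k ν P p : PowerSeries ℝ) =
    (1 + PowerSeries.C (excess ν P p) * PowerSeries.X) *
      (1 - PowerSeries.C (p : ℝ)⁻¹ * PowerSeries.X) ^ k := by
  have h : corrPoly k ν P p = (1 + Polynomial.C (excess ν P p) * Polynomial.X) *
      (1 - Polynomial.C (p : ℝ)⁻¹ * Polynomial.X) ^ k := by
    rw [corrPoly]; simp
  rw [h]
  have h2 : ∀ q : Polynomial ℝ, ((1 - q : Polynomial ℝ) : PowerSeries ℝ) = 1 - (q : PowerSeries ℝ) := by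
    intro q
    simp [← Polynomial.coeToPowerSeries.ringHom_apply]
  rw [Polynomial.coe_mul, Polynomial.coe_pow, h2]
  simp

lemma coeff_zero_corrPoly (k : ℕ) (ν : ℕ → ℕ) (P p : ℕ) :
    PowerSeries.coeff 0 (corrPoly k ν P p : PowerSeries ℝ) = 1 := by
  rw [corrPoly_coe]; simp

/-- At p ∤ P the powers of 1 - X/p cancel and (1 + hX)/(1 - X) remains, all of whose higher
coefficients are 1 + h = (1 - ν/p)⁻¹. At p ∣ P the factor 1 - X cancels the geometric series and
leaves 1. The powers of 1 - X/p are inserted because h is about k/p, so that they remove the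
divergent part of ∏ (1 + hX). -/
theorem oneFun_mul_kernelFun (k : ℕ) {ν : ℕ → ℕ} (hν : ∀ p, p.Prime → ν p < p) {P : ℕ} (hP : P ≠ 0) :
    oneFun * kernelFun k ν P = recipGam ν P := by
  have hG : ∀ q p : ℕ, PowerSeries.coeff 0 ((if p = q then 1 - PowerSeries.X else 1 : PowerSeries ℝ)) = 1 := by
    intro q p; split_ifs <;> simp
  have hI : ∀ p : ℕ, PowerSeries.coeff 0 (PowerSeries.mk fun e => ((p : ℝ)⁻¹) ^ e) = 1 := by simp
  have hI' : ∀ p : ℕ, PowerSeries.coeff 0 ((PowerSeries.mk fun e => ((p : ℝ)⁻¹) ^ e) ^ k) = 1 := by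
    intro p
    rw [PowerSeries.coeff_zero_eq_constantCoeff_apply, map_pow,
      ← PowerSeries.coeff_zero_eq_constantCoeff_apply, hI, one_pow]
  have hD : ∀ p, PowerSeries.coeff 0 (∏ q ∈ P.primeFactors,
      (if p = q then 1 - PowerSeries.X else 1 : PowerSeries ℝ)) = 1 := by
    intro p
    rw [PowerSeries.coeff_zero_eq_constantCoeff_apply, map_prod]
    exact Finset.prod_eq_one fun r _ => by
      rw [← PowerSeries.coeff_zero_eq_constantCoeff_apply, hG]
  rw [kernelFun, Finset.prod_congr rfl fun q hq =>
    diffFun_eq_eulerArith (Nat.prime_of_mem_primeFactors hq), eulerArith_finset_prod hG,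
    invFun_eq_eulerArith, eulerArith_pow hI, corrFun, eulerArith_mul (coeff_zero_corrPoly k ν P) hD,
    eulerArith_mul _ hI', oneFun_eq_eulerArith, eulerArith_mul (by simp), recipGam_eq_eulerArith ν P]
  · refine eulerArith_congr fun p hp => ?_
    have e1 : (1 - PowerSeries.C (p : ℝ)⁻¹ * PowerSeries.X) ^ k *
        (PowerSeries.mk fun e => ((p : ℝ)⁻¹) ^ e) ^ k = 1 := by
      rw [← mul_pow, one_sub_mul_mk_pow, one_pow]
    have e2 : ∏ q ∈ P.primeFactors, (if p = q then 1 - PowerSeries.X else 1 : PowerSeries ℝ) =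
        if p ∣ P then 1 - PowerSeries.X else 1 := by
      rw [Finset.prod_ite_eq]
      simp [hp, hP]
    rw [corrPoly_coe, e2]
    calc _ = PowerSeries.mk 1 * (1 + PowerSeries.C (excess ν P p) * PowerSeries.X) *
          (if p ∣ P then 1 - PowerSeries.X else 1) *
          ((1 - PowerSeries.C (p : ℝ)⁻¹ * PowerSeries.X) ^ k *
          (PowerSeries.mk fun e => ((p : ℝ)⁻¹) ^ e) ^ k) := by ring
      _ = _ := by
        rw [e1, mul_one, excess]
        split_ifs with h
        · simp only [map_zero, zero_mul, add_zero, mul_one]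
          rw [PowerSeries.mk_one_mul_one_sub_eq_one]
          ext e
          simp [PowerSeries.coeff_one]
        · ext e
          have hp0 : (0 : ℝ) < p := by exact_mod_cast hp.pos
          have hpν : (ν p : ℝ) < p := by exact_mod_cast hν p hp
          have hne : (p : ℝ) - ν p ≠ 0 := by linarith
          rw [mul_one, mul_add, mul_one, map_add, ← mul_assoc, mul_comm (PowerSeries.mk 1),
            mul_assoc, PowerSeries.coeff_C_mul]
          rcases e with _ | e
          · simp
          · rw [PowerSeries.coeff_succ_mul_X]
            simp only [PowerSeries.coeff_mk, Pi.one_apply, mul_one]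
            rw [if_neg (by omega)]
            field_simp; ring
  · intro p
    rw [coeff_zero_mul_eq, coeff_zero_mul_eq, hD, hI', coeff_zero_corrPoly]
    norm_num
  · intro p
    rw [coeff_zero_mul_eq, hD, coeff_zero_corrPoly, one_mul]

/-- A finite set of nonzero n involves finitely many primes, so its sum is at most a finite Euler
product, hence at most the exponential of ∑ b(p). -/
lemma summable_of_local_bounds {F : ℕ → ℝ} (hF : ∀ n, 0 ≤ F n) (hF0 : F 0 = 0) (hF1 : F 1 = 1)
    (hmul : ∀ {m n : ℕ}, m.Coprime n → F (m * n) = F m * F n)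
    (hs : ∀ {p : ℕ}, p.Prime → Summable fun e => F (p ^ e)) {b : ℕ → ℝ} (hb0 : ∀ p, 0 ≤ b p)
    (hb : Summable b) (hFb : ∀ p, p.Prime → ∑' e, F (p ^ e) ≤ 1 + b p) : Summable F := by
  refine summable_of_sum_le hF (c := Real.exp (∑' p, b p)) fun u => ?_
  set s := u.biUnion Nat.primeFactors with hsdef
  obtain ⟨-, h⟩ := EulerProduct.summable_and_hasSum_factoredNumbers_prod_filter_prime_tsum hF1 hmul
    (fun {p} hp => (hs hp).congr fun e => (abs_of_nonneg (hF _)).symm) s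
  have h1 : ∑ n ∈ u, F n ≤ ∏ p ∈ s with p.Prime, ∑' e : ℕ, F (p ^ e) := by
    rw [← Finset.sum_filter_add_sum_filter_not u (fun n => n ≠ 0),
      Finset.sum_eq_zero (s := u.filter fun n => ¬ n ≠ 0)
        (fun n hn => by rw [not_not.1 (Finset.mem_filter.1 hn).2, hF0]), add_zero]
    have hmem : ∀ n ∈ u.filter (· ≠ 0), n ∈ Nat.factoredNumbers s := by
      intro n hn
      obtain ⟨hn, hn0⟩ := Finset.mem_filter.1 hn
      refine Nat.mem_factoredNumbers.2 ⟨hn0, fun p hp => ?_⟩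
      exact Finset.mem_biUnion.2 ⟨n, hn, List.mem_toFinset.2 hp⟩
    rw [← Finset.sum_attach]
    have h2 := sum_le_hasSum ((u.filter (· ≠ 0)).attach.map
      ⟨fun n => (⟨n.1, hmem n.1 n.2⟩ : Nat.factoredNumbers s), fun a b hab => by
        exact Subtype.ext (congrArg (fun z : Nat.factoredNumbers s => (z : ℕ)) hab)⟩) (fun n _ => hF n) h
    rw [Finset.sum_map] at h2
    exact h2
  refine h1.trans ?_
  calc _ ≤ ∏ p ∈ s with p.Prime, Real.exp (b p) := by
        refine Finset.prod_le_prod (fun p _ => tsum_nonneg fun e => hF _) fun p hp => ?_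
        refine (hFb p (Finset.mem_filter.1 hp).2).trans ?_
        rw [add_comm]; exact Real.add_one_le_exp _
    _ = Real.exp (∑ p ∈ s with p.Prime, b p) := (Real.exp_sum _ _).symm
    _ ≤ _ := Real.exp_le_exp.2 (hb.sum_le_tsum _ fun p _ => hb0 p)

lemma coeff_one_one_sub_X_pow (k : ℕ) : ((1 - Polynomial.X : Polynomial ℝ) ^ k).coeff 1 = -k := by
  induction k with
  | zero => simp [Polynomial.coeff_one]
  | succ k ih =>
    rw [pow_succ, mul_sub, mul_one, Polynomial.coeff_sub, ih, Polynomial.coeff_mul_X,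
      Polynomial.coeff_zero_eq_eval_zero]
    simp; ring

lemma coeff_corrPoly_succ (k : ℕ) (ν : ℕ → ℕ) (P p e : ℕ) :
    (corrPoly k ν P p).coeff (e + 1) =
      ((1 - Polynomial.X : Polynomial ℝ) ^ k).coeff (e + 1) * ((p : ℝ)⁻¹) ^ (e + 1) +
      excess ν P p * (((1 - Polynomial.X : Polynomial ℝ) ^ k).coeff e * ((p : ℝ)⁻¹) ^ e) := by
  rw [corrPoly, add_mul, one_mul, Polynomial.coeff_add, Polynomial.comp_C_mul_X_coeff, mul_assoc,
    mul_comm Polynomial.X, Polynomial.coeff_C_mul, Polynomial.coeff_mul_X,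
    Polynomial.comp_C_mul_X_coeff]

lemma coeff_corrPoly_zero (k : ℕ) (ν : ℕ → ℕ) (P p : ℕ) : (corrPoly k ν P p).coeff 0 = 1 := by
  rw [← Polynomial.coeff_coe]; exact coeff_zero_corrPoly k ν P p

lemma natDegree_one_sub_X_pow_le (k : ℕ) : ((1 - Polynomial.X : Polynomial ℝ) ^ k).natDegree ≤ k := by
  refine Polynomial.natDegree_pow_le.trans ?_
  have : (1 - Polynomial.X : Polynomial ℝ).natDegree ≤ 1 :=
    (Polynomial.natDegree_sub_le _ _).trans (by simp)
  nlinarith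

lemma coeff_corrPoly_eq_zero {k : ℕ} (ν : ℕ → ℕ) (P p : ℕ) {e : ℕ} (he : k + 1 < e) :
    (corrPoly k ν P p).coeff e = 0 := by
  obtain ⟨e, rfl⟩ : ∃ e', e = e' + 1 := ⟨e - 1, by omega⟩
  have hd := natDegree_one_sub_X_pow_le k
  rw [coeff_corrPoly_succ, Polynomial.coeff_eq_zero_of_natDegree_lt (by omega),
    Polynomial.coeff_eq_zero_of_natDegree_lt (by omega)]
  simp

lemma eval_one_corrPoly (k : ℕ) (ν : ℕ → ℕ) (P p : ℕ) :
    (corrPoly k ν P p).eval 1 = (1 + excess ν P p) * (1 - 1 / (p : ℝ)) ^ k := by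
  rw [corrPoly]; simp

lemma hasSum_coeff_corrPoly (k : ℕ) (ν : ℕ → ℕ) (P p : ℕ) :
    HasSum (fun e => (corrPoly k ν P p).coeff e) ((corrPoly k ν P p).eval 1) := by
  rw [Polynomial.eval_eq_sum_range]
  simp only [one_pow, mul_one]
  refine hasSum_sum_of_ne_finset_zero fun e he => Polynomial.coeff_eq_zero_of_natDegree_lt ?_
  simpa using he

lemma excess_nonneg {ν : ℕ → ℕ} {p : ℕ} (hν : ν p < p) (P : ℕ) : 0 ≤ excess ν P p := by
  have : (ν p : ℝ) < p := by exact_mod_cast hν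
  rw [excess]
  split_ifs
  · exact le_rfl
  · exact div_nonneg (by positivity) (by linarith)

lemma excess_le {ν : ℕ → ℕ} {p : ℕ} (hν : ν p < p) (P : ℕ) : excess ν P p ≤ p := by
  have h1 : (ν p : ℝ) + 1 ≤ p := by exact_mod_cast hν
  rw [excess]
  split_ifs
  · positivity
  · have : (0 : ℝ) ≤ ν p := by positivity
    rw [div_le_iff₀ (by linarith)]
    nlinarith

/-- For large p the excess is k/(p - k), and k/(p - k) - k/p = k²/(p(p - k)). The primes below B
only affect the constant, through the trivial bound by p. -/
lemma exists_excess_bound (k : ℕ) {ν : ℕ → ℕ} (hν : ∀ p, p.Prime → ν p < p) {p₀ : ℕ}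
    (hνk : ∀ p, p.Prime → p₀ ≤ p → ν p = k) {P : ℕ} (hP : P ≠ 0) :
    ∃ D : ℝ, 0 ≤ D ∧ ∀ p, p.Prime → excess ν P p ≤ D * (p : ℝ)⁻¹ ∧
      |excess ν P p - k * (p : ℝ)⁻¹| ≤ D * ((p : ℝ)⁻¹) ^ 2 := by
  -- From B on, p does not divide P, ν(p) = k, and p - k ≥ p/2.
  set B := p₀ + 2 * k + P + 1 with hB
  refine ⟨2 * k + 2 * k ^ 2 + (B + k : ℝ) * B ^ 2, by positivity, fun p hp => ?_⟩
  have hp1 : (1 : ℝ) ≤ p := by exact_mod_cast hp.one_lt.le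
  have hp0 : (0 : ℝ) < p := by linarith
  have hB1 : (1 : ℝ) ≤ B := by rw [hB]; push_cast; linarith [(by positivity : (0 : ℝ) ≤ p₀ + 2 * k + P)]
  rcases lt_or_ge p B with h | h
  · have hpB : (p : ℝ) ≤ B := by exact_mod_cast h.le
    have h0 := excess_nonneg (hν p hp) P
    have h1 := excess_le (hν p hp) P
    have hBp : 1 ≤ (B : ℝ) * (p : ℝ)⁻¹ := by
      rw [← div_eq_mul_inv, le_div_iff₀ hp0]; linarith
    have hBp2 : 1 ≤ (B : ℝ) ^ 2 * ((p : ℝ)⁻¹) ^ 2 := by rw [← mul_pow]; exact one_le_pow₀ hBp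
    have h3 : (0 : ℝ) ≤ 2 * k + 2 * k ^ 2 := by positivity
    have hkp : (k : ℝ) * (p : ℝ)⁻¹ ≤ k := mul_le_of_le_one_right (by positivity) (inv_le_one_of_one_le₀ hp1)
    constructor
    · calc excess ν P p ≤ (B + k : ℝ) * 1 := by linarith [(by positivity : (0 : ℝ) ≤ k)]
        _ ≤ (B + k : ℝ) * (B ^ 2 * (p : ℝ)⁻¹) := by
          gcongr
          calc (1 : ℝ) ≤ B * (p : ℝ)⁻¹ := hBp
            _ ≤ B ^ 2 * (p : ℝ)⁻¹ := by gcongr; nlinarith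
        _ ≤ _ := by
          rw [← mul_assoc]
          exact mul_le_mul_of_nonneg_right (by linarith) (by positivity)
    · calc |excess ν P p - k * (p : ℝ)⁻¹| ≤ (B + k : ℝ) * 1 := by
            have : 0 ≤ (k : ℝ) * (p : ℝ)⁻¹ := by positivity
            rw [abs_le]; constructor <;> linarith
        _ ≤ (B + k : ℝ) * (B ^ 2 * ((p : ℝ)⁻¹) ^ 2) := by gcongr
        _ ≤ _ := by
          rw [← mul_assoc]
          exact mul_le_mul_of_nonneg_right (by linarith) (by positivity)
  · have hnd : ¬ p ∣ P := fun hd => by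
      have := Nat.le_of_dvd (Nat.pos_of_ne_zero hP) hd
      omega
    rw [excess, if_neg hnd, hνk p hp (by omega)]
    have hkp : 2 * (k : ℝ) ≤ p := by exact_mod_cast (by omega : 2 * k ≤ p)
    have hpk : 0 < (p : ℝ) - k := by linarith [(by positivity : (0 : ℝ) ≤ k)]
    have hpk2 : (p : ℝ) / 2 ≤ p - k := by linarith
    have h3 : (0 : ℝ) ≤ (B + k : ℝ) * B ^ 2 := by positivity
    have h4 : (0 : ℝ) ≤ 2 * k ^ 2 := by positivity
    have h5 : (0 : ℝ) ≤ k := by positivity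
    constructor
    · calc (k : ℝ) / (p - k) ≤ k / (p / 2) := by gcongr
        _ = 2 * k * (p : ℝ)⁻¹ := by field_simp
        _ ≤ _ := mul_le_mul_of_nonneg_right (by linarith) (by positivity)
    · have e : (k : ℝ) / (p - k) - k * (p : ℝ)⁻¹ = k ^ 2 / (p * (p - k)) := by field_simp; ring
      rw [e, abs_of_nonneg (by positivity)]
      calc (k : ℝ) ^ 2 / (p * (p - k)) ≤ k ^ 2 / (p * (p / 2)) := by gcongr
        _ = 2 * k ^ 2 * ((p : ℝ)⁻¹) ^ 2 := by field_simp
        _ ≤ _ := mul_le_mul_of_nonneg_right (by linarith) (by positivity)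

/-- The linear coefficient is h - k/p = O(p⁻²) by the choice of the power k; a coefficient of degree
e ≥ 2 is O(p^{-e}). The weight p^{e/4} leaves exponents -7/4 and -3e/4, both at most -3/2. -/
lemma exists_corrPoly_bound (k : ℕ) {ν : ℕ → ℕ} (hν : ∀ p, p.Prime → ν p < p) {p₀ : ℕ}
    (hνk : ∀ p, p.Prime → p₀ ≤ p → ν p = k) {P : ℕ} (hP : P ≠ 0) :
    ∃ D : ℝ, 0 ≤ D ∧ ∀ p, p.Prime → ∀ e,
      |(corrPoly k ν P p).coeff (e + 1)| * (p : ℝ) ^ (((e + 1 : ℕ) : ℝ) * (1 / 4)) ≤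
        D * (p : ℝ) ^ (-(3 / 2) : ℝ) := by
  obtain ⟨D, hD, h⟩ := exists_excess_bound k hν hνk hP
  set q : ℕ → ℝ := fun e => ((1 - Polynomial.X : Polynomial ℝ) ^ k).coeff e with hq
  obtain ⟨T, hT⟩ : ∃ T, ∀ e, |q e| ≤ T := by
    refine ⟨∑ e ∈ Finset.range (k + 1), |q e|, fun e => ?_⟩
    rcases lt_or_ge e (k + 1) with he | he
    · exact Finset.single_le_sum (f := fun e => |q e|) (fun _ _ => abs_nonneg _) (Finset.mem_range.2 he)
    · have : q e = 0 := Polynomial.coeff_eq_zero_of_natDegree_lt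
        ((natDegree_one_sub_X_pow_le k).trans_lt (by omega))
      rw [this, abs_zero]
      exact Finset.sum_nonneg fun _ _ => abs_nonneg _
  have hT0 : 0 ≤ T := (abs_nonneg _).trans (hT 0)
  refine ⟨D + T * (1 + D), by positivity, fun p hp e => ?_⟩
  obtain ⟨h1, h2⟩ := h p hp
  have h0 := excess_nonneg (hν p hp) P
  have hp1 : (1 : ℝ) ≤ p := by exact_mod_cast hp.one_lt.le
  have hp0 : (0 : ℝ) < p := by linarith
  rw [coeff_corrPoly_succ]
  change |q (e + 1) * _ + excess ν P p * (q e * _)| * _ ≤ _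
  rcases e with _ | e
  · have e1 : q (0 + 1) * ((p : ℝ)⁻¹) ^ (0 + 1) + excess ν P p * (q 0 * ((p : ℝ)⁻¹) ^ 0) =
        excess ν P p - k * (p : ℝ)⁻¹ := by
      have hq1 : q 1 = -k := coeff_one_one_sub_X_pow k
      have hq0 : q 0 = 1 := by simp [hq, Polynomial.coeff_zero_eq_eval_zero]
      rw [zero_add, hq1, hq0]; ring
    rw [e1]
    calc _ ≤ D * ((p : ℝ)⁻¹) ^ 2 * (p : ℝ) ^ (((0 + 1 : ℕ) : ℝ) * (1 / 4)) := by gcongr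
      _ = D * (p : ℝ) ^ (-2 + 1 / 4 : ℝ) := by
        rw [Real.rpow_add hp0, mul_assoc]; congr 2
        · rw [Real.rpow_neg hp0.le, inv_pow]; norm_cast
        · norm_num
      _ ≤ D * (p : ℝ) ^ (-(3 / 2) : ℝ) := by
        gcongr
        norm_num
      _ ≤ _ := mul_le_mul_of_nonneg_right (by linarith [(by positivity : 0 ≤ T * (1 + D))]) (by positivity)
  · have b1 : |q (e + 1 + 1) * ((p : ℝ)⁻¹) ^ (e + 1 + 1) +
        excess ν P p * (q (e + 1) * ((p : ℝ)⁻¹) ^ (e + 1))| ≤ T * (1 + D) * ((p : ℝ)⁻¹) ^ (e + 1 + 1) := by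
      calc _ ≤ |q (e + 1 + 1) * ((p : ℝ)⁻¹) ^ (e + 1 + 1)| +
            |excess ν P p * (q (e + 1) * ((p : ℝ)⁻¹) ^ (e + 1))| := abs_add_le _ _
        _ ≤ T * ((p : ℝ)⁻¹) ^ (e + 1 + 1) + D * (p : ℝ)⁻¹ * (T * ((p : ℝ)⁻¹) ^ (e + 1)) := by
          rw [abs_mul, abs_mul, abs_mul, abs_of_nonneg h0,
            abs_of_nonneg (by positivity : 0 ≤ ((p : ℝ)⁻¹) ^ (e + 1 + 1)),
            abs_of_nonneg (by positivity : 0 ≤ ((p : ℝ)⁻¹) ^ (e + 1))]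
          gcongr
          · exact hT _
          · exact hT _
        _ = _ := by ring
    calc _ ≤ T * (1 + D) * ((p : ℝ)⁻¹) ^ (e + 1 + 1) * (p : ℝ) ^ (((e + 1 + 1 : ℕ) : ℝ) * (1 / 4)) := by
          gcongr
      _ = T * (1 + D) * (p : ℝ) ^ (-(((e + 1 + 1 : ℕ) : ℝ)) + ((e + 1 + 1 : ℕ) : ℝ) * (1 / 4)) := by
        rw [Real.rpow_add hp0, mul_assoc, Real.rpow_neg hp0.le, inv_pow, Real.rpow_natCast]
      _ ≤ T * (1 + D) * (p : ℝ) ^ (-(3 / 2) : ℝ) := by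
        gcongr
        push_cast; linarith [e.cast_nonneg (α := ℝ)]
      _ ≤ _ := mul_le_mul_of_nonneg_right (by linarith) (by positivity)

lemma corrFun_prime_pow (k : ℕ) (ν : ℕ → ℕ) (P : ℕ) {p : ℕ} (hp : p.Prime) (e : ℕ) :
    corrFun k ν P (p ^ e) = (corrPoly k ν P p).coeff e := by
  rw [corrFun, eulerArith_prime_pow (coeff_zero_corrPoly k ν P) hp, Polynomial.coeff_coe]

/-- A summable bound for the local factors of `corrFun`. -/
lemma exists_local_bound (k : ℕ) {ν : ℕ → ℕ} (hν : ∀ p, p.Prime → ν p < p) {p₀ : ℕ}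
    (hνk : ∀ p, p.Prime → p₀ ≤ p → ν p = k) {P : ℕ} (hP : P ≠ 0) :
    ∃ b : ℕ → ℝ, (∀ p, 0 ≤ b p) ∧ Summable b ∧ ∀ p, p.Prime →
      (∑ e ∈ Finset.range (k + 1),
        |(corrPoly k ν P p).coeff (e + 1)| * (p : ℝ) ^ (((e + 1 : ℕ) : ℝ) * (1 / 4))) ≤ b p := by
  obtain ⟨D, hD, h⟩ := exists_corrPoly_bound k hν hνk hP
  refine ⟨fun p => (k + 1) * (D * (p : ℝ) ^ (-(3 / 2) : ℝ)), fun p => by positivity,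
    ((Real.summable_nat_rpow.2 (by norm_num)).mul_left D).mul_left _, fun p hp => ?_⟩
  refine (Finset.sum_le_sum fun e _ => h p hp e).trans (le_of_eq ?_)
  simp

theorem wsummable_corrFun (k : ℕ) {ν : ℕ → ℕ} (hν : ∀ p, p.Prime → ν p < p) {p₀ : ℕ}
    (hνk : ∀ p, p.Prime → p₀ ≤ p → ν p = k) {P : ℕ} (hP : P ≠ 0) :
    WSummable (-(1 / 4)) (corrFun k ν P) := by
  obtain ⟨b, hb0, hb, h⟩ := exists_local_bound k hν hνk hP
  have hm : (corrFun k ν P).IsMultiplicative := eulerArith_isMultiplicative _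
  set F : ℕ → ℝ := fun n => |corrFun k ν P n| * (n : ℝ) ^ (-(-(1 / 4)) : ℝ) with hF
  have hFp : ∀ {p : ℕ}, p.Prime → ∀ e, F (p ^ e) =
      |(corrPoly k ν P p).coeff e| * (p : ℝ) ^ ((e : ℝ) * (1 / 4)) := by
    intro p hp e
    simp only [hF]
    rw [corrFun_prime_pow k ν P hp, neg_neg, Nat.cast_pow, ← Real.rpow_natCast, ← Real.rpow_mul
      (by positivity)]
  have hzero : ∀ {p : ℕ}, p.Prime → ∀ e, e ∉ Finset.range (k + 2) → F (p ^ e) = 0 := by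
    intro p hp e he
    rw [hFp hp, coeff_corrPoly_eq_zero _ _ _ (by rw [Finset.mem_range] at he; omega)]; simp
  refine summable_of_local_bounds (F := F) (fun n => by positivity) (by simp [hF])
    (by simp [hF, hm.map_one]) ?_ (fun hp => summable_of_ne_finset_zero (hzero hp)) hb0 hb ?_
  · intro m n hmn
    simp only [hF]
    rw [hm.map_mul_of_coprime hmn, abs_mul, Nat.cast_mul,
      Real.mul_rpow (by positivity) (by positivity)]
    ring
  · intro p hp
    rw [tsum_eq_sum (s := Finset.range (k + 2)) (fun e he => hzero hp e he), Finset.sum_range_succ',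
      add_comm]
    simp only [hFp hp]
    rw [coeff_corrPoly_zero]
    have := h p hp
    simp only [Nat.cast_zero, zero_mul, Real.rpow_zero, abs_one, mul_one]
    linarith

lemma abs_eval_one_corrPoly_sub_le {k : ℕ} {ν : ℕ → ℕ} {P p : ℕ} (hp : p.Prime) {B : ℝ}
    (h : (∑ e ∈ Finset.range (k + 1),
      |(corrPoly k ν P p).coeff (e + 1)| * (p : ℝ) ^ (((e + 1 : ℕ) : ℝ) * (1 / 4))) ≤ B) :
    |(corrPoly k ν P p).eval 1 - 1| ≤ B := by
  have hs := hasSum_coeff_corrPoly k ν P p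
  have e : (corrPoly k ν P p).eval 1 =
      ∑ e ∈ Finset.range (k + 1), (corrPoly k ν P p).coeff (e + 1) + 1 := by
    rw [← hs.tsum_eq, tsum_eq_sum (s := Finset.range (k + 2)), Finset.sum_range_succ',
      coeff_corrPoly_zero]
    intro e he
    exact coeff_corrPoly_eq_zero _ _ _ (by rw [Finset.mem_range] at he; omega)
  rw [e, add_sub_cancel_right]
  refine (Finset.abs_sum_le_sum_abs _ _).trans (le_trans (Finset.sum_le_sum fun e _ => ?_) h)
  refine le_mul_of_one_le_right (abs_nonneg _) (Real.one_le_rpow ?_ (by positivity))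
  exact_mod_cast hp.one_lt.le

/-! ### The singular series as an Euler product -/

/-- The local factor of the singular series. -/
noncomputable def localFactor (k : ℕ) (ν : ℕ → ℕ) (p : ℕ) : ℝ :=
  (1 - (ν p : ℝ) / p) * ((1 - 1 / (p : ℝ)) ^ k)⁻¹

lemma localFactor_mul_eval (k : ℕ) {ν : ℕ → ℕ} {p : ℕ} (hp : p.Prime) (hν : ν p < p) (P : ℕ) :
    localFactor k ν p * (corrPoly k ν P p).eval 1 = if p ∣ P then 1 - (ν p : ℝ) / p else 1 := by
  have hp1 : (1 : ℝ) < p := by exact_mod_cast hp.one_lt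
  have hp0 : (0 : ℝ) < p := by linarith
  have h1 : 0 < 1 - 1 / (p : ℝ) := by rw [sub_pos, div_lt_one hp0]; exact hp1
  have hpν : (ν p : ℝ) < p := by exact_mod_cast hν
  have h2 : (p : ℝ) - ν p ≠ 0 := by linarith
  have h3 : (1 - 1 / (p : ℝ)) ^ k ≠ 0 := by positivity
  rw [eval_one_corrPoly, localFactor, excess]
  split_ifs
  · rw [add_zero, one_mul, mul_assoc, inv_mul_cancel₀ h3, mul_one]
  · rw [show ∀ A B C D : ℝ, A * B * (C * D) = A * C * (B * D) by intros; ring, inv_mul_cancel₀ h3]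
    field_simp; ring

/-- With P = 1 the local factor is the inverse of the value of `corrPoly` at 1, whose distance from
1 is summable. Away from finitely many primes that value is at least 1/2, so inverting costs a
factor 2. -/
theorem multipliable_localFactor (k : ℕ) {ν : ℕ → ℕ} (hν : ∀ p, p.Prime → ν p < p) {p₀ : ℕ}
    (hνk : ∀ p, p.Prime → p₀ ≤ p → ν p = k) :
    Multipliable fun p : Nat.Primes => localFactor k ν p := by
  obtain ⟨b, hb0, hb, h⟩ := exists_local_bound k hν hνk one_ne_zero
  have hb' : Summable fun p : Nat.Primes => 2 * b p :=
    (hb.comp_injective (i := ((↑) : Nat.Primes → ℕ)) Subtype.val_injective).mul_left 2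
  have hev : ∀ᶠ p : Nat.Primes in cofinite, b p < 1 / 2 :=
    (hb.comp_injective (i := ((↑) : Nat.Primes → ℕ)) Subtype.val_injective).tendsto_cofinite_zero.eventually
      (gt_mem_nhds (by norm_num))
  have hs : Summable fun p : Nat.Primes => localFactor k ν p - 1 := by
    refine Summable.of_norm_bounded_eventually hb' ?_
    filter_upwards [hev] with p hp
    have h1 := abs_eval_one_corrPoly_sub_le p.2 (h p p.2)
    have h2 := localFactor_mul_eval k p.2 (hν p p.2) 1
    rw [if_neg (fun hd => p.2.one_lt.ne' (Nat.dvd_one.1 hd))] at h2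
    set z := (corrPoly k ν 1 p).eval 1
    have hz : 1 / 2 ≤ z := by have := (abs_le.1 h1).1; linarith
    have h3 : localFactor k ν p - 1 = -(z - 1) / z := by
      rw [eq_div_iff (by positivity)]; linarith
    rw [Real.norm_eq_abs, h3, abs_div, abs_neg, abs_of_pos (by linarith : 0 < z),
      div_le_iff₀ (by linarith)]
    have := hb0 p
    nlinarith
  have := Real.multipliable_one_add_of_summable hs
  simpa using this

lemma hasProd_primes_dvd (f : ℕ → ℝ) {n : ℕ} (hn : n ≠ 0) :
    HasProd (fun p : Nat.Primes => if (p : ℕ) ∣ n then f p else 1) (∏ p ∈ n.primeFactors, f p) := by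
  rw [← Finset.prod_subtype_of_mem f fun p hp => Nat.prime_of_mem_primeFactors hp]
  have h : HasProd (fun p : Nat.Primes => if (p : ℕ) ∣ n then f p else 1)
      (∏ p ∈ (n.primeFactors.subtype Nat.Prime : Finset Nat.Primes),
        if (p : ℕ) ∣ n then f p else 1) := by
    refine hasProd_prod_of_ne_finset_one fun p hp => if_neg fun hd => hp ?_
    exact Finset.mem_subtype.2 (Nat.mem_primeFactors.2 ⟨p.2, hd, hn⟩)
  convert! h using 1
  refine Finset.prod_congr rfl fun p hp => (if_pos ?_).symm
  exact Nat.dvd_of_mem_primeFactors (Finset.mem_subtype.1 hp)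

theorem tprod_localFactor_mul_tsum (k : ℕ) {ν : ℕ → ℕ} (hν : ∀ p, p.Prime → ν p < p) {p₀ : ℕ}
    (hνk : ∀ p, p.Prime → p₀ ≤ p → ν p = k) {P : ℕ} (hP : P ≠ 0) :
    (∏' p : Nat.Primes, localFactor k ν p) * ∑' n, corrFun k ν P n =
      ∏ p ∈ P.primeFactors, (1 - (ν p : ℝ) / p) := by
  have hs : Summable fun n => ‖corrFun k ν P n‖ := by
    have := (wsummable_corrFun k hν hνk hP).mono (by norm_num : (-(1 / 4) : ℝ) ≤ 0)
    simpa [WSummable] using this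
  have h1 := (eulerArith_isMultiplicative _).eulerProduct_hasProd hs
  have h2 : ∀ p : Nat.Primes, ∑' e, corrFun k ν P (p ^ e) = (corrPoly k ν P p).eval 1 := by
    intro p
    rw [← (hasSum_coeff_corrPoly k ν P p).tsum_eq]
    exact tsum_congr fun e => corrFun_prime_pow k ν P p.2 e
  change HasProd (fun p : Nat.Primes => ∑' e, corrFun k ν P (p ^ e)) (∑' n, corrFun k ν P n) at h1
  simp only [h2] at h1
  have h3 := (multipliable_localFactor k hν hνk).hasProd.mul h1
  simp only [fun p : Nat.Primes => localFactor_mul_eval k p.2 (hν p p.2) P] at h3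
  exact h3.unique (hasProd_primes_dvd _ hP)

/-- It is a limit of nonnegative products, and the case P = 1 of `tprod_localFactor_mul_tsum`
exhibits it as a divisor of 1. -/
theorem tprod_localFactor_pos (k : ℕ) {ν : ℕ → ℕ} (hν : ∀ p, p.Prime → ν p < p) {p₀ : ℕ}
    (hνk : ∀ p, p.Prime → p₀ ≤ p → ν p = k) : 0 < ∏' p : Nat.Primes, localFactor k ν p := by
  have h := tprod_localFactor_mul_tsum k hν hνk one_ne_zero
  simp only [Nat.primeFactors_one, Finset.prod_empty] at h
  refine lt_of_le_of_ne ?_ (fun h0 => by rw [← h0, zero_mul] at h; norm_num at h)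
  refine ge_of_tendsto' (multipliable_localFactor k hν hνk).hasProd fun s => ?_
  refine Finset.prod_nonneg fun p _ => ?_
  have hp0 : (1 : ℝ) ≤ (p : ℕ) := by exact_mod_cast p.2.one_lt.le
  have hpν : (ν p : ℝ) ≤ (p : ℕ) := by exact_mod_cast (hν p p.2).le
  refine mul_nonneg ?_ (inv_nonneg.2 (pow_nonneg ?_ _))
  · rw [sub_nonneg]; exact div_le_one_of_le₀ hpν (by linarith)
  · rw [sub_nonneg]; exact div_le_one_of_le₀ hp0 (by linarith)

/-! ### Residue counts of admissible tuples and of their shifts -/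

section Tuples

variable {k : ℕ}

/-- The reduction of `P(n; H)` mod `p`. -/
def prodFormsMod (H : Fin k → LinForm) (p : ℕ) (z : ZMod p) : ZMod p :=
  ∏ i, (((H i).slope : ZMod p) * z + ((H i).const : ZMod p))

lemma intCast_prodForms (H : Fin k → LinForm) (p : ℕ) (n : ℤ) :
    ((prodForms H n : ℤ) : ZMod p) = prodFormsMod H p n := by
  simp [prodForms, prodFormsMod, LinForm.eval]

lemma nu_eq_card (H : Fin k → LinForm) {p : ℕ} [NeZero p] :
    nu H p = (Finset.univ.filter fun z : ZMod p => prodFormsMod H p z = 0).card := by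
  refine Finset.card_nbij' (fun n => (n : ZMod p)) ZMod.val ?_ ?_ ?_ ?_
  · intro n hn
    obtain ⟨-, h⟩ := Finset.mem_filter.1 (Finset.mem_coe.1 hn)
    refine Finset.mem_coe.2 (Finset.mem_filter.2 ⟨Finset.mem_univ _, ?_⟩)
    rw [← ZMod.intCast_zmod_eq_zero_iff_dvd, intCast_prodForms] at h
    simpa using h
  · intro z hz
    obtain ⟨-, h⟩ := Finset.mem_filter.1 (Finset.mem_coe.1 hz)
    refine Finset.mem_coe.2 (Finset.mem_filter.2 ⟨Finset.mem_range.2 z.val_lt, ?_⟩)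
    rw [← ZMod.intCast_zmod_eq_zero_iff_dvd, intCast_prodForms]
    simpa using h
  · intro n hn
    obtain ⟨h, -⟩ := Finset.mem_filter.1 (Finset.mem_coe.1 hn)
    exact ZMod.val_cast_of_lt (Finset.mem_range.1 h)
  · intro z _
    exact ZMod.natCast_zmod_val z

/-- A prime dividing both coefficients would make the form vanish identically mod p, so that ν(p) =
p. -/
lemma IsAdmissible.isCoprime {H : Fin k → LinForm} (hH : IsAdmissible H) (i : Fin k) :
    IsCoprime (H i).slope (H i).const := by
  rw [Int.isCoprime_iff_gcd_eq_one]
  by_contra hg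
  obtain ⟨p, hp, hpg⟩ := Nat.exists_prime_and_dvd hg
  have : NeZero p := ⟨hp.ne_zero⟩
  have h1 : ((H i).slope : ZMod p) = 0 := (ZMod.intCast_zmod_eq_zero_iff_dvd _ _).2
    ((Int.natCast_dvd_natCast.2 hpg).trans (Int.gcd_dvd_left _ _))
  have h2 : ((H i).const : ZMod p) = 0 := (ZMod.intCast_zmod_eq_zero_iff_dvd _ _).2
    ((Int.natCast_dvd_natCast.2 hpg).trans (Int.gcd_dvd_right _ _))
  have h3 := hH.nu_lt p hp
  rw [nu_eq_card, Finset.filter_true_of_mem, Finset.card_univ, ZMod.card] at h3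
  · exact lt_irrefl _ h3
  · intro z _
    exact Finset.prod_eq_zero (Finset.mem_univ i) (by rw [h1, h2]; ring)

/-- Proportional primitive forms with positive slopes coincide. -/
lemma IsAdmissible.cross_ne {H : Fin k → LinForm} (hH : IsAdmissible H) {i j : Fin k} (hij : i ≠ j) :
    (H i).slope * (H j).const - (H j).slope * (H i).const ≠ 0 := by
  intro h
  have hi := hH.slope_pos i
  have hj := hH.slope_pos j
  have d1 : (H i).slope ∣ (H j).slope :=
    (hH.isCoprime i).dvd_of_dvd_mul_right ⟨(H j).const, by linarith⟩
  have d2 : (H j).slope ∣ (H i).slope :=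
    (hH.isCoprime j).dvd_of_dvd_mul_right ⟨(H i).const, by linarith⟩
  have e := Int.dvd_antisymm (by omega) (by omega) d1 d2
  rw [e, ← mul_sub] at h
  rcases mul_eq_zero.1 h with h | h
  · omega
  · exact hij (hH.distinct (LinForm.ext e (by omega)))

/-- If p divides neither a slope nor a cross determinant, the roots -b_i/a_i mod p exist and are
distinct; D collects these finitely many obstructions. -/
lemma IsAdmissible.exists_nu_eq {H : Fin k → LinForm} (hH : IsAdmissible H) :
    ∃ p₀, ∀ p, p.Prime → p₀ ≤ p → nu H p = k := by
  set D : ℤ := (∏ i, (H i).slope) *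
    ∏ x ∈ Finset.univ.filter (fun x : Fin k × Fin k => x.1 ≠ x.2),
      ((H x.1).slope * (H x.2).const - (H x.2).slope * (H x.1).const) with hD
  have hD0 : D ≠ 0 := by
    refine mul_ne_zero (Finset.prod_ne_zero_iff.2 fun i _ => ?_)
      (Finset.prod_ne_zero_iff.2 fun x hx => hH.cross_ne (Finset.mem_filter.1 hx).2)
    have := hH.slope_pos i
    omega
  refine ⟨D.natAbs + 1, fun p hp hpD => ?_⟩
  have : Fact p.Prime := ⟨hp⟩
  have hnd : ∀ d : ℤ, d ∣ D → (d : ZMod p) ≠ 0 := by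
    intro d hd h0
    rw [ZMod.intCast_zmod_eq_zero_iff_dvd] at h0
    have := Nat.le_of_dvd (Int.natAbs_pos.2 hD0) (Int.natCast_dvd.1 (h0.trans hd))
    omega
  have hs : ∀ i, ((H i).slope : ZMod p) ≠ 0 := fun i =>
    hnd _ ((Finset.dvd_prod_of_mem _ (Finset.mem_univ i)).trans (dvd_mul_right _ _))
  have hc : ∀ i j, i ≠ j →
      ((H i).slope : ZMod p) * (H j).const - (H j).slope * (H i).const ≠ 0 := fun i j hij => by
    have := hnd _ ((Finset.dvd_prod_of_mem (fun x : Fin k × Fin k =>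
      (H x.1).slope * (H x.2).const - (H x.2).slope * (H x.1).const)
      (Finset.mem_filter.2 ⟨Finset.mem_univ (i, j), hij⟩)).trans (dvd_mul_left _ _))
    exact_mod_cast this
  rw [nu_eq_card]
  have e : (Finset.univ.filter fun z : ZMod p => prodFormsMod H p z = 0) =
      Finset.univ.image fun i : Fin k => -((H i).const : ZMod p) / (H i).slope := by
    ext z
    simp only [Finset.mem_filter, Finset.mem_univ, true_and, Finset.mem_image, prodFormsMod,
      Finset.prod_eq_zero_iff]
    refine exists_congr fun i => ?_
    rw [div_eq_iff (hs i)]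
    constructor <;> intro h <;> linear_combination -h
  rw [e, Finset.card_image_of_injective, Finset.card_univ, Fintype.card_fin]
  intro i j hij
  by_contra hne
  apply hc i j hne
  simp only [div_eq_div_iff (hs i) (hs j)] at hij
  linear_combination hij

/-- The tuple of forms `r ↦ ℒ_i (a + q r)` in the variable `q`. -/
def shiftTuple (H : Fin k → LinForm) (a : ℤ) (r : ℕ) (i : Fin k) : LinForm :=
  ⟨(H i).slope * r, (H i).eval a⟩

lemma shiftTuple_eval (H : Fin k → LinForm) (a : ℤ) (r : ℕ) (i : Fin k) (q : ℤ) :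
    (shiftTuple H a r i).eval q = (H i).eval (a + q * r) := by
  simp only [shiftTuple, LinForm.eval]; ring

lemma prodFormsMod_shiftTuple (H : Fin k → LinForm) (a : ℤ) (r p : ℕ) (z : ZMod p) :
    prodFormsMod (shiftTuple H a r) p z = prodFormsMod H p (a + r * z) := by
  refine Finset.prod_congr rfl fun i _ => ?_
  simp only [shiftTuple, LinForm.eval]
  push_cast
  ring

/-- The substitution z ↦ a + rz permutes the residues mod p. -/
lemma nu_shiftTuple_of_not_dvd (H : Fin k → LinForm) (a : ℤ) {r p : ℕ} (hp : p.Prime) (hr : ¬ p ∣ r) :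
    nu (shiftTuple H a r) p = nu H p := by
  have : Fact p.Prime := ⟨hp⟩
  have hr0 : (r : ZMod p) ≠ 0 := by rwa [Ne, ZMod.natCast_eq_zero_iff]
  rw [nu_eq_card, nu_eq_card]
  refine Finset.card_nbij' (fun z => (a : ZMod p) + r * z) (fun z => (z - a) / r) ?_ ?_ ?_ ?_
  · intro z hz
    simpa [prodFormsMod_shiftTuple] using hz
  · intro z hz
    have : (a : ZMod p) + r * ((z - a) / r) = z := by field_simp; ring
    simpa [prodFormsMod_shiftTuple, this] using hz
  · intro z _
    simp [hr0]
  · intro z _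
    simp only
    field_simp; ring

/-- Mod p the product of the shifted forms is the nonzero constant P(a; H). -/
lemma nu_shiftTuple_of_dvd (H : Fin k → LinForm) (a : ℤ) {r p : ℕ} (hp : p.Prime) (hr : p ∣ r)
    (hP : ¬ (p : ℤ) ∣ prodForms H a) : nu (shiftTuple H a r) p = 0 := by
  have : Fact p.Prime := ⟨hp⟩
  have hr0 : (r : ZMod p) = 0 := by rwa [ZMod.natCast_eq_zero_iff]
  rw [nu_eq_card, Finset.card_eq_zero, Finset.filter_eq_empty_iff]
  intro z _
  rw [prodFormsMod_shiftTuple, hr0, zero_mul, add_zero, ← intCast_prodForms,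
    ZMod.intCast_zmod_eq_zero_iff_dvd]
  exact hP

lemma not_dvd_prodForms {H : Fin k → LinForm} {a : ℤ} {r p : ℕ} (hp : p.Prime) (hr : p ∣ r)
    (hc : r.Coprime (prodForms H a).natAbs) : ¬ (p : ℤ) ∣ prodForms H a := fun h =>
  Nat.not_coprime_of_dvd_of_dvd hp.one_lt hr (Int.natCast_dvd.1 h) hc

lemma IsAdmissible.shiftTuple {H : Fin k → LinForm} (hH : IsAdmissible H) {a : ℤ} {r : ℕ} (hr : 0 < r)
    (hc : r.Coprime (prodForms H a).natAbs) : IsAdmissible (shiftTuple H a r) := by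
  refine ⟨fun i j hij => hH.distinct ?_, fun i => ?_, fun p hp => ?_⟩
  · simp only [PrimeTuples.shiftTuple, LinForm.eval, LinForm.mk.injEq] at hij
    obtain ⟨h1, h2⟩ := hij
    have h3 : (H i).slope = (H j).slope := mul_right_cancel₀ (by omega) h1
    rw [h3] at h2
    exact LinForm.ext h3 (by linarith)
  · have h1 := hH.slope_pos i
    change 1 ≤ (H i).slope * r
    have : (1 : ℤ) ≤ r := by omega
    nlinarith
  · by_cases hpr : p ∣ r
    · rw [nu_shiftTuple_of_dvd H a hp hpr (not_dvd_prodForms hp hpr hc)]; exact hp.pos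
    · rw [nu_shiftTuple_of_not_dvd H a hp hpr]; exact hH.nu_lt p hp

lemma one_sub_nu_div_pos {H : Fin k → LinForm} (hH : IsAdmissible H) {p : ℕ} (hp : p.Prime) :
    0 < 1 - (nu H p : ℝ) / p := by
  have hp0 : (0 : ℝ) < p := by exact_mod_cast hp.pos
  rw [sub_pos, div_lt_one hp0]
  exact_mod_cast hH.nu_lt p hp

lemma gam_pos {H : Fin k → LinForm} (hH : IsAdmissible H) (q : ℕ) : 0 < gam H q :=
  Finset.prod_pos fun _ hp => one_sub_nu_div_pos hH (Nat.prime_of_mem_primeFactors hp)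

lemma singularSeries_eq (H : Fin k → LinForm) :
    singularSeries H = ∏' p : Nat.Primes, localFactor k (nu H) p := rfl

lemma singularSeries_pos {H : Fin k → LinForm} (hH : IsAdmissible H) : 0 < singularSeries H := by
  obtain ⟨p₀, hp₀⟩ := hH.exists_nu_eq
  exact tprod_localFactor_pos k hH.nu_lt hp₀

/-- Only the factors at p ∣ r change: there 1 - ν(p)/p becomes 1. -/
lemma singularSeries_shiftTuple {H : Fin k → LinForm} (hH : IsAdmissible H) {a : ℤ} {r : ℕ}
    (hr : 0 < r) (hc : r.Coprime (prodForms H a).natAbs) :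
    singularSeries (shiftTuple H a r) = singularSeries H * (gam H r)⁻¹ := by
  obtain ⟨p₀, hp₀⟩ := hH.exists_nu_eq
  have h1 := (multipliable_localFactor k hH.nu_lt hp₀).hasProd.mul
    (hasProd_primes_dvd (fun p => (1 - (nu H p : ℝ) / p)⁻¹) hr.ne')
  rw [singularSeries_eq, singularSeries_eq, gam, ← Finset.prod_inv_distrib, ← h1.tprod_eq]
  refine tprod_congr fun p => ?_
  split_ifs with h
  · rw [localFactor, nu_shiftTuple_of_dvd H a p.2 h (not_dvd_prodForms p.2 h hc), localFactor,
      mul_right_comm, mul_inv_cancel₀ (one_sub_nu_div_pos hH p.2).ne']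
    simp
  · rw [localFactor, nu_shiftTuple_of_not_dvd H a p.2 h, localFactor, mul_one]

/-! ### What the conjecture and the regularity of L imply -/

lemma countAll_congr_floor (H : Fin k → LinForm) {u v : ℝ} (h : ⌊u⌋₊ = ⌊v⌋₊) :
    countAll H u = countAll H v := by
  rw [countAll, countAll, h]

lemma self_le_rpow_one_add {t η : ℝ} (ht : 1 ≤ t) (hη : 0 ≤ η) : t ≤ t ^ (1 + η) := by
  calc t = t ^ (1 : ℝ) := (Real.rpow_one t).symm
    _ ≤ _ := Real.rpow_le_rpow_of_exponent_le ht (by linarith)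

lemma rpow_two_add {t : ℝ} (ht : 0 ≤ t) (δ : ℝ) : t ^ (2 + 2 * δ) = (t ^ (1 + δ)) ^ 2 := by
  rw [← Real.rpow_natCast, ← Real.rpow_mul ht]; congr 1; push_cast; ring

/-- The uniform Hardy-Littlewood hypothesis with a nonnegative constant and a threshold. -/
lemma UniformHardyLittlewood.exists_threshold {δ : ℝ} {L : ℝ → ℝ} (hHL : UniformHardyLittlewood k δ L)
    (B : ℝ) : ∃ C X : ℝ, 0 ≤ C ∧ ∀ x, X ≤ x → 0 < x → 0 < L x → ∀ H : Fin k → LinForm,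
      IsAdmissible H → (∀ i, ((H i).slope : ℝ) ≤ L x ^ (1 + δ)) → (∀ i, |((H i).const : ℝ)| ≤ B) →
      |countAll H x - singularSeries H * x| ≤ C * (x / L x ^ (2 + 2 * δ)) := by
  obtain ⟨C, hC⟩ := hHL B
  obtain ⟨X, hX⟩ := eventually_atTop.1 hC
  refine ⟨|C|, X, abs_nonneg _, fun x hx hx0 hL H h1 h2 h3 => (hX x hx H h1 h2 h3).trans ?_⟩
  gcongr
  exact le_abs_self C

/-- If x/(2L(x)) stayed bounded along some x → ∞, monotonicity would bound the right side of the
regularity condition while its left side is unbounded. -/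
lemma tendsto_div_two_mul {δ η : ℝ} (hδ : 0 < δ) (hη : 0 < η) {L : ℝ → ℝ}
    (hLmono : MonotoneOn L (Set.Ici 0)) (hLtop : Tendsto L atTop atTop)
    (hreg : ∀ᶠ x : ℝ in atTop, L x ^ (1 + η) ≤ L (x / (2 * L x)) ^ (1 + δ)) :
    Tendsto (fun x => x / (2 * L x)) atTop atTop := by
  rw [tendsto_atTop]
  intro Y
  set Z := max Y 0
  set B := max |L 0| |L Z|
  filter_upwards [hreg, hLtop.eventually_gt_atTop (max 1 (B ^ (1 + δ))), eventually_ge_atTop 0]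
    with x hx hL hx0
  have hL1 : 1 < L x := (le_max_left _ _).trans_lt hL
  by_contra! hcon
  have hy0 : 0 ≤ x / (2 * L x) := by positivity
  have hyZ : x / (2 * L x) ≤ Z := hcon.le.trans (le_max_left _ _)
  set y := x / (2 * L x)
  have h1 : L 0 ≤ L y := hLmono (Set.self_mem_Ici) hy0 hy0
  have h2 : L y ≤ L Z := hLmono hy0 (le_max_right Y 0) hyZ
  have h3 : |L y| ≤ B := abs_le_max_abs_abs h1 h2
  have h4 : L y ^ (1 + δ) ≤ B ^ (1 + δ) :=
    (le_abs_self _).trans ((Real.abs_rpow_le_abs_rpow _ _).trans (by gcongr))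
  have h5 := self_le_rpow_one_add hL1.le hη.le
  have h6 : B ^ (1 + δ) < L x := (le_max_right _ _).trans_lt hL
  linarith

/-- The counting function is constant between consecutive integers while 𝔖(H) u is not, so the error
term in the conjecture cannot tend to 0; this limits the growth of L. -/
lemma exists_rpow_le {δ : ℝ} (hδ : 0 < δ) {L : ℝ → ℝ}
    (hLmono : MonotoneOn L (Set.Ici 0)) (hLtop : Tendsto L atTop atTop)
    (hHL : UniformHardyLittlewood k δ L) {H : Fin k → LinForm} (hH : IsAdmissible H) :
    ∃ C, 0 ≤ C ∧ ∀ᶠ y in atTop, L y ^ (2 + 2 * δ) ≤ C * y := by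
  obtain ⟨C, X, hC, hX⟩ := hHL.exists_threshold (∑ i, |((H i).const : ℝ)|)
  have hS := singularSeries_pos hH
  refine ⟨10 * C / singularSeries H, by positivity, ?_⟩
  filter_upwards [eventually_ge_atTop X, eventually_ge_atTop 1,
    hLtop.eventually_ge_atTop (max 1 (∑ i, |((H i).slope : ℝ)|))] with y hyX hy1 hL
  have hL1 : 1 ≤ L y := (le_max_left _ _).trans hL
  set N := ⌊y⌋₊ with hN
  have hNy : (N : ℝ) ≤ y := Nat.floor_le (by linarith)
  have hyN : y < N + 1 := Nat.lt_floor_add_one y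
  have key : ∀ u, y ≤ u → |countAll H u - singularSeries H * u| ≤ C * (u / L y ^ (2 + 2 * δ)) := by
    intro u hu
    have hLu : L y ≤ L u := hLmono (show (0 : ℝ) ≤ y by linarith) (show (0 : ℝ) ≤ u by linarith) hu
    refine (hX u (hyX.trans hu) (by linarith) (by linarith) H hH (fun i => ?_) (fun i => ?_)).trans ?_
    · have h1 := self_le_rpow_one_add (hL1.trans hLu) hδ.le
      have h2 := Finset.single_le_sum (f := fun i => |((H i).slope : ℝ)|) (fun _ _ => abs_nonneg _)
        (Finset.mem_univ i)
      have h3 := (le_max_right _ _).trans hL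
      exact (le_abs_self _).trans (by linarith)
    · exact Finset.single_le_sum (f := fun i => |((H i).const : ℝ)|) (fun _ _ => abs_nonneg _)
        (Finset.mem_univ i)
    · have hu0 : 0 ≤ u := by linarith
      gcongr
  -- The points N + 1 and N + 3/2 have the same floor, and the main term moves by 𝔖(H)/2 between
  -- them.
  have h1 := key (N + 1) hyN.le
  have h2 := key (N + 3 / 2) (by linarith)
  rw [countAll_congr_floor H (u := (N : ℝ) + 3 / 2) (v := N + 1)] at h2
  · set D := L y ^ (2 + 2 * δ)
    have hD : 0 < D := by positivity
    have h3 : singularSeries H / 2 ≤ C * (((N : ℝ) + 1) / D) + C * (((N : ℝ) + 3 / 2) / D) := by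
      have a1 := (abs_le.1 h1).2
      have a2 := (abs_le.1 h2).1
      linarith
    have h4 : C * (((N : ℝ) + 1) / D) + C * (((N : ℝ) + 3 / 2) / D) ≤ C * (5 * y) / D := by
      rw [← mul_add, ← add_div, mul_div_assoc]
      gcongr
      linarith
    have h5 := h3.trans h4
    rw [le_div_iff₀ hD] at h5
    rw [div_mul_eq_mul_div, le_div_iff₀ hS]
    linarith
  · have e1 : ⌊(N : ℝ) + 3 / 2⌋₊ = N + 1 := by
      rw [Nat.floor_eq_iff (by positivity)]; push_cast; constructor <;> linarith
    rw [e1]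
    exact_mod_cast (Nat.floor_natCast (R := ℝ) (N + 1)).symm

/-- Apply `exists_rpow_le` at y = x/(2L(x)): by regularity L(x)² ≤ L(y)^{2+2δ}, which is O(x/L(x)).
-/
lemma exists_cube_le {δ η : ℝ} (hδ : 0 < δ) (hη : 0 < η) {L : ℝ → ℝ}
    (hLmono : MonotoneOn L (Set.Ici 0)) (hLtop : Tendsto L atTop atTop)
    (hreg : ∀ᶠ x : ℝ in atTop, L x ^ (1 + η) ≤ L (x / (2 * L x)) ^ (1 + δ))
    (hHL : UniformHardyLittlewood k δ L) {H : Fin k → LinForm} (hH : IsAdmissible H) :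
    ∃ C, 0 ≤ C ∧ ∀ᶠ x in atTop, L x ^ 3 ≤ C * x := by
  obtain ⟨C, hC, h⟩ := exists_rpow_le hδ hLmono hLtop hHL hH
  have ht := tendsto_div_two_mul hδ hη hLmono hLtop hreg
  refine ⟨C / 2, by positivity, ?_⟩
  filter_upwards [ht.eventually h, hreg, hLtop.eventually_ge_atTop 1,
    (hLtop.comp ht).eventually_ge_atTop 0] with x h1 h2 hL hLy
  simp only [Function.comp_apply] at hLy
  rw [rpow_two_add hLy] at h1
  have h3 := self_le_rpow_one_add hL hη.le
  have h4 : L x ^ 2 ≤ C * (x / (2 * L x)) := by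
    refine le_trans ?_ h1
    gcongr
    exact h3.trans h2
  calc L x ^ 3 = L x ^ 2 * L x := by ring
    _ ≤ C * (x / (2 * L x)) * L x := by gcongr
    _ = C / 2 * x := by field_simp

/-- The Hardy-Littlewood asymptotics for the tuples `shiftTuple H a r`, `r ≤ 4 M`. -/
lemma exists_shiftTuple_bound {δ η : ℝ} (hδ : 0 < δ) (hη : 0 < η) {L : ℝ → ℝ}
    (hLmono : MonotoneOn L (Set.Ici 0)) (hLtop : Tendsto L atTop atTop)
    (hreg : ∀ᶠ x : ℝ in atTop, L x ^ (1 + η) ≤ L (x / (2 * L x)) ^ (1 + δ))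
    (hHL : UniformHardyLittlewood k δ L) {H : Fin k → LinForm} (hH : IsAdmissible H) (a : ℤ)
    {M : ℝ → ℝ} (hMtop : Tendsto M atTop atTop) (hML : ∀ᶠ x : ℝ in atTop, M x ≤ L x) :
    ∃ C, 0 ≤ C ∧ ∀ᶠ x in atTop, ∀ r : ℕ, 0 < r → (r : ℝ) ≤ 4 * M x →
      r.Coprime (prodForms H a).natAbs → ∀ z, x / (2 * M x) ≤ z → z ≤ x / M x →
      |countAll (shiftTuple H a r) z - singularSeries H * (gam H r)⁻¹ * z| ≤
        C * (x / M x / M x ^ 2) := by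
  obtain ⟨C, X, hC, hX⟩ := hHL.exists_threshold (∑ i, |((H i).eval a : ℝ)|)
  have ht := tendsto_div_two_mul hδ hη hLmono hLtop hreg
  set A := ∑ i, |((H i).slope : ℝ)|
  -- The slopes of the shifted tuples are at most 4 A M ≤ 4 A L(x). The exponent η absorbs 4A, and
  -- regularity passes from L(x) to L(z)^{1+δ} for z ≥ x/(2L(x)).
  have hpow : ∀ᶠ x in atTop, 4 * A * L x ≤ L x ^ (1 + η) := by
    filter_upwards [((tendsto_rpow_atTop hη).comp hLtop).eventually_ge_atTop (4 * A),
      hLtop.eventually_gt_atTop 0] with x hx hL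
    rw [Real.rpow_add hL, Real.rpow_one, mul_comm]
    exact mul_le_mul_of_nonneg_left hx hL.le
  refine ⟨C, hC, ?_⟩
  filter_upwards [hpow, hreg, hML, hMtop.eventually_ge_atTop 1, hLtop.eventually_ge_atTop 1,
    ht.eventually_ge_atTop X, ht.eventually_gt_atTop 0, (hLtop.comp ht).eventually_ge_atTop 1,
    eventually_gt_atTop 0] with x h1 h2 h3 hM hL hXx hx0 hLy hx r hr hrM hc z hz1 hz2
  simp only [Function.comp_apply] at hLy
  have hyz : x / (2 * L x) ≤ z := le_trans (by gcongr) hz1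
  have hz0 : 0 < z := hx0.trans_le hyz
  have hLz : L (x / (2 * L x)) ≤ L z := hLmono hx0.le hz0.le hyz
  have hLz1 : 1 ≤ L z := hLy.trans hLz
  have h4 : L x ^ (1 + η) ≤ L z ^ (1 + δ) := h2.trans (by gcongr)
  have h5 := hX z (hXx.trans hyz) hz0 (by linarith) (shiftTuple H a r) (hH.shiftTuple hr hc)
    (fun i => ?_) (fun i => ?_)
  · rw [singularSeries_shiftTuple hH hr hc] at h5
    refine h5.trans ?_
    rw [rpow_two_add (by linarith)]
    have h6 : M x ≤ L z ^ (1 + δ) := (h3.trans (self_le_rpow_one_add hL hη.le)).trans h4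
    gcongr
  · have hA := Finset.single_le_sum (f := fun i => |((H i).slope : ℝ)|) (fun _ _ => abs_nonneg _)
        (Finset.mem_univ i)
    have hA' : ((H i).slope : ℝ) ≤ A := (le_abs_self _).trans hA
    have hA0 : 0 ≤ A := (abs_nonneg _).trans hA
    calc ((shiftTuple H a r i).slope : ℝ) = (H i).slope * r := by simp [shiftTuple]
      _ ≤ A * (4 * M x) := by gcongr
      _ ≤ A * (4 * L x) := by gcongr
      _ = 4 * A * L x := by ring
      _ ≤ _ := h1.trans h4
  · exact Finset.single_le_sum (f := fun i => |((H i).eval a : ℝ)|) (fun _ _ => abs_nonneg _)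
        (Finset.mem_univ i)

lemma exists_countAll_bound {δ : ℝ} (hδ : 0 < δ) {L : ℝ → ℝ} (hLtop : Tendsto L atTop atTop)
    (hHL : UniformHardyLittlewood k δ L) {H : Fin k → LinForm} (hH : IsAdmissible H)
    {M : ℝ → ℝ} (hMtop : Tendsto M atTop atTop) (hML : ∀ᶠ x : ℝ in atTop, M x ≤ L x) :
    ∃ C, 0 ≤ C ∧ ∀ᶠ x in atTop,
      |countAll H x - singularSeries H * x| ≤ C * (x / M x ^ 2) := by
  obtain ⟨C, X, hC, hX⟩ := hHL.exists_threshold (∑ i, |((H i).const : ℝ)|)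
  refine ⟨C, hC, ?_⟩
  filter_upwards [hML, hMtop.eventually_ge_atTop 1, eventually_ge_atTop X, eventually_gt_atTop 0,
    hLtop.eventually_ge_atTop (max 1 (∑ i, |((H i).slope : ℝ)|))] with x h1 hM hxX hx hL
  have hL1 : 1 ≤ L x := (le_max_left _ _).trans hL
  have h3 := self_le_rpow_one_add hL1 hδ.le
  refine (hX x hxX hx (by linarith) H hH (fun i => ?_) (fun i => ?_)).trans ?_
  · have h2 := Finset.single_le_sum (f := fun i => |((H i).slope : ℝ)|) (fun _ _ => abs_nonneg _)
      (Finset.mem_univ i)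
    have h4 := (le_max_right _ _).trans hL
    exact (le_abs_self _).trans (by linarith)
  · exact Finset.single_le_sum (f := fun i => |((H i).const : ℝ)|) (fun _ _ => abs_nonneg _)
      (Finset.mem_univ i)
  · rw [rpow_two_add (by linarith)]
    have : M x ≤ L x ^ (1 + δ) := h1.trans h3
    gcongr

/-! ### Exchanging the modulus q for the cofactor r -/

/-- The value of `seq H` at `a + q r`, cut off at `x`. -/
noncomputable def cutSeq (H : Fin k → LinForm) (a : ℤ) (x : ℝ) (q r : ℕ) : ℝ :=
  if ((a + q * r : ℤ) : ℝ) ≤ x then seq H (a + q * r) else 0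

/-- Substitute n = a + qr. As q > |a|, a negative r gives n ≤ 0, and r = 0 gives exactly the
subtracted term (which is 0 when a ≤ 0). -/
lemma countProg_eq (H : Fin k → LinForm) {a : ℤ} {x : ℝ} {q R : ℕ} (hq : a.natAbs < q)
    (hx : (a.natAbs : ℝ) ≤ x) (hR : ∀ r : ℕ, ((a + q * r : ℤ) : ℝ) ≤ x → r ≤ R) :
    countProg H x q a = seq H a + ∑ r ∈ Finset.Icc 1 R, cutSeq H a x q r := by
  have h0 : seq H a = cutSeq H a x q 0 := by
    have : (a : ℝ) ≤ x := (by exact_mod_cast Int.le_natAbs (a := a) : (a : ℝ) ≤ (a.natAbs : ℤ)).trans hx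
    simp [cutSeq, this]
  have h1 : Finset.range (R + 1) = insert 0 (Finset.Icc 1 R) := by ext r; simp; omega
  rw [h0, ← Finset.sum_insert (by simp), ← h1]
  have hx0 : 0 ≤ x := le_trans (Nat.cast_nonneg _) hx
  have h2 : ∑ r ∈ Finset.range (R + 1), cutSeq H a x q r =
      ∑ r ∈ (Finset.range (R + 1)).filter
        (fun r : ℕ => 1 ≤ a + q * r ∧ ((a + q * r : ℤ) : ℝ) ≤ x), seq H (a + q * r) := by
    rw [Finset.sum_filter]
    refine Finset.sum_congr rfl fun r _ => ?_
    unfold cutSeq seq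
    split_ifs <;> first | rfl | tauto
  rw [h2, countProg]
  have hq0 : (0 : ℤ) < q := by omega
  have key : ∀ n : ℕ, 1 ≤ n → (n : ℤ) ≡ a [ZMOD q] →
      0 ≤ ((n : ℤ) - a) / q ∧ a + q * (((n : ℤ) - a) / q) = n := by
    intro n hn hna
    obtain ⟨c, hc⟩ := hna.symm.dvd
    rw [hc, Int.mul_ediv_cancel_left _ hq0.ne']
    refine ⟨?_, by omega⟩
    by_contra! hneg
    have : (q : ℤ) * c ≤ q * (-1) := by gcongr; omega
    omega
  refine Finset.sum_nbij' (fun n => (((n : ℤ) - a) / q).toNat) (fun r => (a + q * r : ℤ).toNat)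
    ?_ ?_ ?_ ?_ ?_
  · intro n hn
    simp only [Finset.mem_filter, Finset.mem_Icc] at hn
    obtain ⟨h3, h4⟩ := key n hn.1.1 hn.2
    have h5 : (a + q * ((((n : ℤ) - a) / q).toNat : ℕ) : ℤ) = n := by
      rw [Int.toNat_of_nonneg h3, h4]
    have h6 : ((n : ℤ) : ℝ) ≤ x := by exact_mod_cast (Nat.le_floor_iff hx0).1 hn.1.2
    simp only [Finset.mem_filter, Finset.mem_range, h5]
    refine ⟨Nat.lt_succ_of_le (hR _ ?_), by omega, h6⟩
    rw [h5]; exact h6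
  · intro r hr
    simp only [Finset.mem_filter] at hr
    have h3 : ((a + q * r : ℤ).toNat : ℤ) = a + q * r := Int.toNat_of_nonneg (by omega)
    simp only [Finset.mem_filter, Finset.mem_Icc, h3]
    refine ⟨⟨by omega, Nat.le_floor ?_⟩, ?_⟩
    · rw [← Int.cast_natCast, h3]; exact hr.2.2
    · exact (Int.emod_emod_of_dvd _ dvd_rfl).symm.trans (by simp)
  · intro n hn
    simp only [Finset.mem_filter, Finset.mem_Icc] at hn
    obtain ⟨h3, h4⟩ := key n hn.1.1 hn.2
    simp only [Int.toNat_of_nonneg h3, h4, Int.toNat_natCast]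
  · intro r hr
    simp only [Finset.mem_filter] at hr
    have h3 : ((a + q * r : ℤ).toNat : ℤ) = a + q * r := Int.toNat_of_nonneg (by omega)
    simp only [h3, add_sub_cancel_left, Int.mul_ediv_cancel_left _ hq0.ne', Int.toNat_natCast]
  · intro n hn
    simp only [Finset.mem_filter, Finset.mem_Icc] at hn
    obtain ⟨h3, h4⟩ := key n hn.1.1 hn.2
    simp only [Int.toNat_of_nonneg h3, h4]

lemma one_le_add_mul {a : ℤ} {q r : ℕ} (hq : a.natAbs < q) (hr : 0 < r) : 1 ≤ a + (q * r : ℤ) := by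
  have : (q : ℤ) * 1 ≤ q * r := by gcongr; omega
  omega

/-- For fixed r the cutoff a + qr ≤ x reads q ≤ (x - a)/r; the outer `max` covers the case where no
q is left. -/
lemma countAll_shiftTuple_sub (H : Fin k → LinForm) {a : ℤ} {x y z : ℝ} {r : ℕ} (hr : 0 < r)
    (hy : (a.natAbs : ℝ) ≤ y) (hyz : y ≤ z) :
    countAll (shiftTuple H a r) (max y (min z ((x - a) / r))) - countAll (shiftTuple H a r) y =
      ∑ q ∈ Finset.Ioc ⌊y⌋₊ ⌊z⌋₊, cutSeq H a x q r := by
  have hr' : (0 : ℝ) < r := by exact_mod_cast hr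
  have hy0 : 0 ≤ y := le_trans (Nat.cast_nonneg _) hy
  set w := max y (min z ((x - a) / r)) with hw
  have hyw : y ≤ w := le_max_left _ _
  have h1 : countAll (shiftTuple H a r) w - countAll (shiftTuple H a r) y =
      ∑ q ∈ Finset.Ioc ⌊y⌋₊ ⌊w⌋₊, seq (shiftTuple H a r) q := by
    have hI : ∀ n, Finset.Icc 1 n = Finset.Ioc 0 n := fun n => by ext; simp; omega
    rw [sub_eq_iff_eq_add', countAll, countAll, hI, hI,
      Finset.sum_Ioc_consecutive _ (Nat.zero_le _) (Nat.floor_le_floor hyw)]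
  rw [h1]
  unfold cutSeq
  rw [← Finset.sum_filter]
  refine Finset.sum_congr ?_ fun q hq => ?_
  · ext q
    simp only [Finset.mem_filter, Finset.mem_Ioc, and_assoc]
    refine and_congr_right fun hq => ?_
    rw [Nat.floor_lt hy0] at hq
    rw [Nat.le_floor_iff (hy0.trans hyw), Nat.le_floor_iff (hy0.trans hyz), hw, le_max_iff,
      or_iff_right (not_le.2 hq), le_min_iff, le_div_iff₀ hr']
    refine and_congr_right fun _ => ?_
    push_cast
    constructor <;> intro h <;> linarith
  · simp only [Finset.mem_filter, Finset.mem_Ioc] at hq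
    have hq1 : y < q := (Nat.floor_lt hy0).1 hq.1.1
    have hq2 : a.natAbs < q := by exact_mod_cast hy.trans_lt hq1
    unfold seq
    rw [if_pos (one_le_add_mul hq2 hr), if_pos (by omega)]
    simp only [shiftTuple_eval]

/-- A bound for the growth of the forms of a tuple. -/
def coeffSum (H : Fin k → LinForm) : ℤ := 1 + ∑ i, (|(H i).slope| + |(H i).const|)

lemma eval_le_coeffSum (H : Fin k → LinForm) (i : Fin k) {n : ℤ} (hn : 1 ≤ n) :
    (H i).eval n ≤ coeffSum H * n := by
  have h1 := Finset.single_le_sum (f := fun i => |(H i).slope| + |(H i).const|)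
    (fun _ _ => by positivity) (Finset.mem_univ i)
  have h2 : |(H i).const| ≤ |(H i).const| * n := le_mul_of_one_le_right (abs_nonneg _) hn
  have h3 : (H i).slope * n ≤ |(H i).slope| * n := by gcongr; exact le_abs_self _
  have h4 := le_abs_self (H i).const
  have h5 : (|(H i).slope| + |(H i).const|) * n ≤ coeffSum H * n := by
    gcongr; unfold coeffSum; linarith
  unfold LinForm.eval
  linarith

lemma one_le_coeffSum (H : Fin k → LinForm) : 1 ≤ coeffSum H := by
  unfold coeffSum
  have : 0 ≤ ∑ i, (|(H i).slope| + |(H i).const|) := Finset.sum_nonneg fun _ _ => by positivity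
  linarith

lemma toNat_eval_le (H : Fin k → LinForm) (i : Fin k) {n : ℤ} (hn : 1 ≤ n) {x : ℝ} (hnx : (n : ℝ) ≤ x) :
    ((((H i).eval n).toNat : ℕ) : ℝ) ≤ coeffSum H * x := by
  have h1 : (((H i).eval n).toNat : ℤ) ≤ coeffSum H * n := by
    rw [Int.toNat_eq_max]
    exact max_le (eval_le_coeffSum H i hn) (mul_nonneg (by linarith [one_le_coeffSum H]) (by omega))
  have h2 : ((((H i).eval n).toNat : ℕ) : ℝ) ≤ coeffSum H * n := by exact_mod_cast h1
  have h3 : (0 : ℝ) ≤ coeffSum H := by exact_mod_cast (by linarith [one_le_coeffSum H])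
  exact h2.trans (by gcongr)

lemma abs_cutSeq_le (H : Fin k → LinForm) (a : ℤ) {x : ℝ} (hx : 1 ≤ x) (q r : ℕ) :
    |cutSeq H a x q r| ≤ Real.log (coeffSum H * x) ^ k := by
  have hA : (1 : ℝ) ≤ coeffSum H := by exact_mod_cast one_le_coeffSum H
  have hAx : 1 ≤ coeffSum H * x := one_le_mul_of_one_le_of_one_le hA hx
  have h0 := Real.log_nonneg hAx
  unfold cutSeq seq
  split_ifs with h1 h2
  · rw [Finset.abs_prod]
    calc _ ≤ ∏ _i : Fin k, Real.log (coeffSum H * x) := by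
          refine Finset.prod_le_prod (fun _ _ => abs_nonneg _) fun i _ => ?_
          rw [abs_of_nonneg ArithmeticFunction.vonMangoldt_nonneg]
          refine ArithmeticFunction.vonMangoldt_le_log.trans ?_
          rcases Nat.eq_zero_or_pos ((H i).eval (a + q * r)).toNat with h | h
          · rw [h]; simpa using h0
          · exact Real.log_le_log (by exact_mod_cast h) (toNat_eval_le H i h2 h1)
      _ = _ := by simp
  · simpa using pow_nonneg h0 k
  · simpa using pow_nonneg h0 k

/-- A prime p dividing both qr and P divides some ℒ_i(a), hence also ℒ_i(a + qr). Nonvanishing of Λ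
there forces a power of p, with logarithmically bounded exponent. -/
lemma exists_eval_eq_prime_pow {H : Fin k → LinForm} {a : ℤ} (hP : prodForms H a ≠ 0) {x : ℝ}
    {q r : ℕ} (hqr : ¬ (q * r).Coprime (prodForms H a).natAbs) (hne : cutSeq H a x q r ≠ 0) :
    ∃ t : Fin k × ℕ × ℕ, t ∈ (Finset.univ : Finset (Fin k)) ×ˢ
      ((prodForms H a).natAbs.primeFactors ×ˢ Finset.range (Nat.log 2 ⌊coeffSum H * x⌋₊ + 1)) ∧
      (H t.1).eval (a + q * r) = (t.2.1 : ℤ) ^ t.2.2 := by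
  obtain ⟨p, hp, hpqr, hpP⟩ := Nat.Prime.not_coprime_iff_dvd.1 hqr
  have hpP' : (p : ℤ) ∣ prodForms H a := Int.natCast_dvd.2 hpP
  obtain ⟨i, -, hi⟩ := (Nat.prime_iff_prime_int.1 hp).exists_mem_finset_dvd hpP'
  have hn1 : ((a + q * r : ℤ) : ℝ) ≤ x := by
    by_contra h; exact hne (if_neg h)
  rw [cutSeq, if_pos hn1] at hne
  have hn2 : 1 ≤ a + (q * r : ℤ) := by
    by_contra h; exact hne (if_neg h)
  rw [seq, if_pos hn2] at hne
  have hi2 := (Finset.prod_ne_zero_iff.1 hne) i (Finset.mem_univ i)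
  rw [ArithmeticFunction.vonMangoldt_ne_zero_iff] at hi2
  set m := (H i).eval (a + q * r) with hm
  have hm0 : 0 < m.toNat := hi2.pos
  have hm1 : (m.toNat : ℤ) = m := Int.toNat_of_nonneg (by omega)
  have hpm : p ∣ m.toNat := by
    have : (p : ℤ) ∣ m := by
      have e : m = (H i).eval a + (H i).slope * (q * r : ℕ) := by
        rw [hm]; simp only [LinForm.eval]; push_cast; ring
      rw [e]
      exact dvd_add hi (Dvd.dvd.mul_left (Int.natCast_dvd_natCast.2 hpqr) _)
    rw [← hm1] at this
    exact Int.natCast_dvd_natCast.1 this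
  obtain ⟨p', j, hp', hj, hpj⟩ := hi2
  have hp'' : p = p' := by
    rw [← hpj] at hpm
    exact (Nat.prime_dvd_prime_iff_eq hp hp'.nat_prime).1 (hp.dvd_of_dvd_pow hpm)
  subst hp''
  refine ⟨(i, p, j), ?_, ?_⟩
  · simp only [Finset.mem_product, Finset.mem_univ, true_and, Nat.mem_primeFactors, Finset.mem_range]
    refine ⟨⟨hp, hpP, Int.natAbs_ne_zero.2 hP⟩, Nat.lt_succ_of_le ?_⟩
    have hle : p ^ j ≤ ⌊coeffSum H * x⌋₊ := by
      rw [hpj]; exact Nat.le_floor (toNat_eval_le H i hn2 hn1)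
    exact Nat.le_log_of_pow_le (by norm_num) ((Nat.pow_le_pow_left hp.two_le j).trans hle)
  · change m = _
    rw [← hm1, ← hpj]; push_cast; rfl

/-- For fixed r, the form i and its value p^j determine q, because the slope and r are nonzero. So
the exceptional q are no more numerous than the triples (i, p, j). -/
lemma card_bad_le {H : Fin k → LinForm} (hH : IsAdmissible H) {a : ℤ} (hP : prodForms H a ≠ 0) {x : ℝ}
    {r : ℕ} (hr : 0 < r) (s : Finset ℕ) :
    (s.filter fun q : ℕ => ¬ (q * r).Coprime (prodForms H a).natAbs ∧ cutSeq H a x q r ≠ 0).card ≤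
      k * ((prodForms H a).natAbs.primeFactors.card * (Nat.log 2 ⌊coeffSum H * x⌋₊ + 1)) := by
  set T := (Finset.univ : Finset (Fin k)) ×ˢ
      ((prodForms H a).natAbs.primeFactors ×ˢ Finset.range (Nat.log 2 ⌊coeffSum H * x⌋₊ + 1)) with hT
  have hc : T.card = k * ((prodForms H a).natAbs.primeFactors.card *
      (Nat.log 2 ⌊coeffSum H * x⌋₊ + 1)) := by simp [hT, Finset.card_product]
  rw [← hc]
  refine Finset.card_le_card_of_forall_subsingleton
    (fun (q : ℕ) (t : Fin k × ℕ × ℕ) => (H t.1).eval (a + q * r) = (t.2.1 : ℤ) ^ t.2.2)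
    (fun q hq => ?_) (fun t _ q hq q' hq' => ?_)
  · obtain ⟨h1, h2⟩ := (Finset.mem_filter.1 hq).2
    exact exists_eval_eq_prime_pow hP h1 h2
  · have h1 := hq.2
    have h2 := hq'.2
    rw [← h1] at h2
    have hs := hH.slope_pos t.1
    simp only [LinForm.eval, add_left_inj] at h2
    have h3 := mul_left_cancel₀ (by omega) h2
    have h4 : (q' * r : ℤ) = q * r := by linarith
    have h5 := mul_right_cancel₀ (by exact_mod_cast hr.ne') h4
    exact_mod_cast h5.symm

/-- Interchanging the roles of `q` and `r` in the sum over the coprime moduli. -/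
lemma abs_switch_le {H : Fin k → LinForm} (hH : IsAdmissible H) {a : ℤ} (hP : prodForms H a ≠ 0) {x : ℝ}
    (hx : 1 ≤ x) (s : Finset ℕ) (R : ℕ) :
    |∑ q ∈ s.filter (fun q => q.Coprime (prodForms H a).natAbs), ∑ r ∈ Finset.Icc 1 R, cutSeq H a x q r -
      ∑ r ∈ (Finset.Icc 1 R).filter (fun r => r.Coprime (prodForms H a).natAbs), ∑ q ∈ s,
        cutSeq H a x q r| ≤
      R * (k * ((prodForms H a).natAbs.primeFactors.card * (Nat.log 2 ⌊coeffSum H * x⌋₊ + 1)) *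
        Real.log (coeffSum H * x) ^ k) := by
  have hl : 0 ≤ Real.log (coeffSum H * x) ^ k := (abs_nonneg _).trans (abs_cutSeq_le H a hx 0 0)
  set P := (prodForms H a).natAbs with hPdef
  rw [Finset.sum_comm, Finset.sum_filter, ← Finset.sum_sub_distrib]
  refine (Finset.abs_sum_le_sum_abs _ _).trans ?_
  calc _ ≤ ∑ r ∈ Finset.Icc 1 R, (k * (P.primeFactors.card *
        (Nat.log 2 ⌊coeffSum H * x⌋₊ + 1)) * Real.log (coeffSum H * x) ^ k : ℝ) := by
        refine Finset.sum_le_sum fun r hr => ?_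
        have hr0 : 0 < r := (Finset.mem_Icc.1 hr).1
        have e : (∑ q ∈ s.filter (fun q => q.Coprime P), cutSeq H a x q r -
            if r.Coprime P then ∑ q ∈ s, cutSeq H a x q r else 0) =
            ∑ q ∈ s, ((if q.Coprime P then cutSeq H a x q r else 0) -
              if r.Coprime P then cutSeq H a x q r else 0) := by
          rw [Finset.sum_sub_distrib, Finset.sum_filter]
          split_ifs <;> simp
        rw [e]
        calc _ ≤ ∑ q ∈ s, |(if q.Coprime P then cutSeq H a x q r else 0) -
              if r.Coprime P then cutSeq H a x q r else 0| := Finset.abs_sum_le_sum_abs _ _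
          -- The conditions (q, P) = 1 and (r, P) = 1 can only differ when qr is not coprime to P.
          _ ≤ ∑ q ∈ s, if ¬ (q * r).Coprime P ∧ cutSeq H a x q r ≠ 0 then
              Real.log (coeffSum H * x) ^ k else 0 := by
              refine Finset.sum_le_sum fun q _ => ?_
              have hc : (q * r).Coprime P ↔ q.Coprime P ∧ r.Coprime P := Nat.coprime_mul_iff_left
              have hb := abs_cutSeq_le H a hx q r
              by_cases h3 : cutSeq H a x q r = 0
              · simp [h3]
              · split_ifs <;> first | tauto | (simp [hl]; done) | simp [hb]
          _ = (s.filter fun q => ¬ (q * r).Coprime P ∧ cutSeq H a x q r ≠ 0).card *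
              Real.log (coeffSum H * x) ^ k := by
              rw [← Finset.sum_filter, Finset.sum_const, nsmul_eq_mul]
          _ ≤ _ := by
              gcongr
              exact_mod_cast card_bad_le hH hP hr0 s
    _ = _ := by rw [Finset.sum_const, Nat.card_Icc, Nat.add_sub_cancel, nsmul_eq_mul]

/-! ### Evaluating both sums and cancelling the main terms -/

lemma dilSum_eq_sum (α : ArithmeticFunction ℝ) {w : ℝ → ℝ} {c y : ℝ} (hc : 0 < c)
    (hw : ∀ z, 0 < z → z < c → w z = 0) (hy : 0 < y) {N : ℕ} (hN : y < c * (N + 1)) :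
    dilSum α w y = ∑ m ∈ Finset.Icc 1 N, α m * w (y / m) := by
  rw [dilSum, tsum_eq_sum (s := Finset.Icc 1 N)]
  intro m hm
  rcases Nat.eq_zero_or_pos m with rfl | hm0
  · simp
  have hm' : (0 : ℝ) < m := by exact_mod_cast hm0
  have hmN : N + 1 ≤ m := by
    by_contra hcon
    exact hm (Finset.mem_Icc.2 ⟨hm0, by omega⟩)
  rw [hw _ (by positivity), mul_zero]
  rw [div_lt_iff₀ hm']
  calc y < c * (N + 1) := hN
    _ ≤ c * m := by gcongr; exact_mod_cast hmN

lemma wsummable_kernelFun (k : ℕ) {ν : ℕ → ℕ} (hν : ∀ p, p.Prime → ν p < p) {p₀ : ℕ}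
    (hνk : ∀ p, p.Prime → p₀ ≤ p → ν p = k) {P : ℕ} (hP : P ≠ 0) {σ : ℝ} (hσ : 0 < σ) :
    WSummable σ (kernelFun k ν P) :=
  (((wsummable_corrFun k hν hνk hP).mono (by linarith)).mul
    (WSummable.finset_prod _ fun p _ => wsummable_diffFun σ p)).mul ((wsummable_invFun hσ).pow k)

/-- Splitting off the linear main term of a sum weighted by `recipGam`. -/
lemma dilSum_recipGam_eq (k : ℕ) {ν : ℕ → ℕ} (hν : ∀ p, p.Prime → ν p < p) {p₀ : ℕ}
    (hνk : ∀ p, p.Prime → p₀ ≤ p → ν p = k) {P : ℕ} (hP : P ≠ 0) {w : ℝ → ℝ}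
    (hw : ∀ u, |w u| ≤ 1 * u ^ (2 : ℝ)) {K τ c : ℝ} (hτ : 0 < τ)
    (hd : ∀ u, 0 < u → |dilSum oneFun w u - u * c| ≤ K * u ^ τ) {y : ℝ} (hy : 0 < y) :
    dilSum (recipGam ν P) w y = dilSum (kernelFun k ν P) (fun u => dilSum oneFun w u - u * c) y +
      y * c * ∑' n : ℕ, kernelFun k ν P n / n := by
  rw [← oneFun_mul_kernelFun k hν hP, mul_comm,
    dilSum_mul (wsummable_kernelFun k hν hνk hP two_pos) (wsummable_oneFun one_lt_two)
      (fun u _ => hw u) hy]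
  have h1 := summable_term (wsummable_kernelFun k hν hνk hP hτ) hd hy
  have h2 := summable_term (wsummable_kernelFun k hν hνk hP one_pos)
    (Φ := fun u => u * c) (K := |c|) (fun u hu => by
      rw [abs_mul, abs_of_pos hu, Real.rpow_one, mul_comm]) hy
  have e : ∀ n : ℕ, kernelFun k ν P n * (y / n * c) = y * c * (kernelFun k ν P n / n) := by
    intro n; ring
  rw [← tsum_mul_left, dilSum, dilSum]
  simp only [← e]
  rw [← h1.tsum_add h2]
  exact tsum_congr fun n => by ring

lemma recipGam_nu (H : Fin k → LinForm) (P n : ℕ) :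
    recipGam (nu H) P n = if n ≠ 0 ∧ n.Coprime P then (gam H n)⁻¹ else 0 := rfl

/-- Since ν(p) ≤ p - 1, each inverse factor is at most p, and the product of the primes dividing n
is at most n. -/
lemma inv_gam_le {H : Fin k → LinForm} (hH : IsAdmissible H) {n : ℕ} (hn : n ≠ 0) :
    (gam H n)⁻¹ ≤ n := by
  rw [gam, ← Finset.prod_inv_distrib]
  calc _ ≤ ∏ p ∈ n.primeFactors, (p : ℝ) := by
        refine Finset.prod_le_prod (fun p hp => inv_nonneg.2
          (one_sub_nu_div_pos hH (Nat.prime_of_mem_primeFactors hp)).le) fun p hp => ?_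
        have hp' := Nat.prime_of_mem_primeFactors hp
        have hp0 : (0 : ℝ) < p := by exact_mod_cast hp'.pos
        have h1 : (nu H p : ℝ) + 1 ≤ p := by exact_mod_cast hH.nu_lt p hp'
        rw [inv_le_comm₀ (one_sub_nu_div_pos hH hp') hp0, le_sub_iff_add_le, ← one_div,
          ← add_div, div_le_one hp0]
        linarith
    _ = ((∏ p ∈ n.primeFactors, p : ℕ) : ℝ) := by push_cast; rfl
    _ ≤ n := by exact_mod_cast Nat.le_of_dvd (Nat.pos_of_ne_zero hn) (Nat.prod_primeFactors_dvd n)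

lemma sum_inv_mul_gam_eq (H : Fin k → LinForm) (P : ℕ) {y : ℝ} (hy : 0 < y) :
    y * ∑ q ∈ (Finset.Ioc ⌊y / 2⌋₊ ⌊y⌋₊).filter (fun q : ℕ => q.Coprime P), ((q : ℝ) * gam H q)⁻¹ =
      dilSum (recipGam (nu H) P) dyadicWeight y := by
  rw [dilSum_eq_sum _ (c := 1) one_pos
    (fun z _ hz => by rw [dyadicWeight, if_neg (by intro h; linarith)]) hy
    (N := ⌊y⌋₊) (by rw [one_mul]; exact Nat.lt_floor_add_one y), Finset.mul_sum]
  refine Finset.sum_subset_zero_on_sdiff ?_ ?_ ?_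
  · intro q hq
    have := Finset.mem_Ioc.1 (Finset.mem_filter.1 hq).1
    exact Finset.mem_Icc.2 ⟨by omega, this.2⟩
  · intro m hm
    obtain ⟨h1, h2⟩ := Finset.mem_sdiff.1 hm
    obtain ⟨hm0, hm1⟩ := Finset.mem_Icc.1 h1
    have hm' : (0 : ℝ) < m := by exact_mod_cast hm0
    by_cases hc : m.Coprime P
    · have h3 : m ≤ ⌊y / 2⌋₊ := by
        by_contra hcon
        exact h2 (Finset.mem_filter.2 ⟨Finset.mem_Ioc.2 ⟨by omega, hm1⟩, hc⟩)
      have h4 := (Nat.le_floor_iff (by positivity)).1 h3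
      rw [dyadicWeight, if_neg, mul_zero]
      rintro ⟨-, h5⟩
      rw [div_lt_iff₀ hm'] at h5
      linarith
    · rw [recipGam_nu, if_neg (fun h => hc h.2), zero_mul]
  · intro m hm
    obtain ⟨h0, hc⟩ := Finset.mem_filter.1 hm
    obtain ⟨h1, h2⟩ := Finset.mem_Ioc.1 h0
    have hm0 : 0 < m := by omega
    have hm' : (0 : ℝ) < m := by exact_mod_cast hm0
    have h3 := (Nat.le_floor_iff hy.le).1 h2
    have h4 := (Nat.floor_lt (by positivity)).1 h1
    rw [dyadicWeight, if_pos, recipGam_nu, if_pos ⟨hm0.ne', hc⟩, mul_inv]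
    · ring
    · constructor
      · rw [le_div_iff₀ hm']; linarith
      · rw [div_lt_iff₀ hm']; linarith

/-- This is where the ramp comes from: without the shift by a, the q allowed for a given r fill an
interval of length (x/M) w(M/r). As `max` and `min` are 1-Lipschitz, the shift costs at most |a|/r.
-/
lemma abs_max_min_sub_le {a x M r : ℝ} (hM : 0 < M) (hr : 0 < r) (hx : 0 < x) :
    |max (x / (2 * M)) (min (x / M) ((x - a) / r)) - x / (2 * M) - x / M * rampWeight (M / r)| ≤
      |a| / r := by
  have h1 : x / M * rampWeight (M / r) =
      max (x / (2 * M)) (min (x / M) (x / r)) - x / (2 * M) := by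
    rw [rampWeight, ← max_sub_sub_right, sub_self, mul_max_of_nonneg _ _ (by positivity), mul_zero,
      mul_sub, mul_min_of_nonneg _ _ (by positivity)]
    congr 2
    · congr 1
      · ring
      · field_simp
    · ring
  rw [h1, sub_sub_sub_cancel_right]
  refine (abs_max_sub_max_le_max _ _ _ _).trans (max_le (by simp; positivity) ?_)
  refine (abs_min_sub_min_le_max _ _ _ _).trans (max_le (by simp; positivity) ?_)
  rw [← sub_div, abs_div, abs_of_pos hr, sub_sub_cancel_left, abs_neg]

/-- The bound for the terms that are lost when `q` and `r` are interchanged. -/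
noncomputable def switchBound (H : Fin k → LinForm) (P : ℕ) (x : ℝ) : ℝ :=
  k * (P.primeFactors.card * (Nat.log 2 ⌊coeffSum H * x⌋₊ + 1)) * Real.log (coeffSum H * x) ^ k

lemma switchBound_nonneg (H : Fin k → LinForm) (P : ℕ) {x : ℝ} (hx : 1 ≤ x) :
    0 ≤ switchBound H P x := by
  have hA : (1 : ℝ) ≤ coeffSum H := by exact_mod_cast one_le_coeffSum H
  have := Real.log_nonneg (one_le_mul_of_one_le_of_one_le hA hx)
  unfold switchBound
  positivity

/-- The sum over `r`, evaluated by means of the asymptotics for the tuples `shiftTuple H a r`. -/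
lemma abs_sum_cutSeq_sub_le {H : Fin k → LinForm} (hH : IsAdmissible H) {a : ℤ} {x M E : ℝ}
    (hM : 1 ≤ M) (hx : (a.natAbs : ℝ) + 1 ≤ x / (2 * M))
    (hE : ∀ r : ℕ, 0 < r → (r : ℝ) ≤ 4 * M → r.Coprime (prodForms H a).natAbs →
      ∀ z, x / (2 * M) ≤ z → z ≤ x / M →
      |countAll (shiftTuple H a r) z - singularSeries H * (gam H r)⁻¹ * z| ≤ E) :
    |∑ r ∈ (Finset.Icc 1 ⌊4 * M⌋₊).filter (fun r => r.Coprime (prodForms H a).natAbs),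
        ∑ q ∈ Finset.Ioc ⌊x / (2 * M)⌋₊ ⌊x / M⌋₊, cutSeq H a x q r -
      singularSeries H * (x / M * dilSum (recipGam (nu H) (prodForms H a).natAbs) rampWeight M)| ≤
      4 * M * (2 * E + singularSeries H * |(a : ℝ)|) := by
  have hM0 : 0 < M := by linarith
  have hy0 : (0 : ℝ) < x / (2 * M) := by
    have : (0 : ℝ) ≤ a.natAbs := Nat.cast_nonneg _
    linarith
  have hx0 : 0 < x := by
    by_contra! h
    exact absurd hy0 (not_lt.2 (div_nonpos_of_nonpos_of_nonneg h (by positivity)))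
  have hyy : x / (2 * M) ≤ x / M := by gcongr; linarith
  have hS := singularSeries_pos hH
  have hE0 : 0 ≤ E := (abs_nonneg _).trans
    (hE 1 one_pos (by push_cast; linarith) (Nat.coprime_one_left _) _ le_rfl hyy)
  have hfl : ((⌊4 * M⌋₊ : ℕ) : ℝ) ≤ 4 * M := Nat.floor_le (by linarith)
  set P := (prodForms H a).natAbs with hP
  rw [dilSum_eq_sum _ (c := 1 / 2) (by norm_num)
    (fun z _ hz => rampWeight_of_le hz.le) hM0 (N := ⌊4 * M⌋₊)
    (by have := Nat.lt_floor_add_one (4 * M); linarith)]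
  have e1 : ∑ r ∈ Finset.Icc 1 ⌊4 * M⌋₊, recipGam (nu H) P r * rampWeight (M / r) =
      ∑ r ∈ (Finset.Icc 1 ⌊4 * M⌋₊).filter (fun r => r.Coprime P),
        (gam H r)⁻¹ * rampWeight (M / r) := by
    rw [Finset.sum_filter]
    refine Finset.sum_congr rfl fun r hr => ?_
    have : r ≠ 0 := by have := (Finset.mem_Icc.1 hr).1; omega
    rw [recipGam_nu]
    by_cases hc : r.Coprime P
    · rw [if_pos ⟨this, hc⟩, if_pos hc]
    · rw [if_neg (fun h => hc h.2), if_neg hc, zero_mul]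
  rw [e1, Finset.mul_sum, Finset.mul_sum, ← Finset.sum_sub_distrib]
  refine (Finset.abs_sum_le_sum_abs _ _).trans ?_
  calc _ ≤ ∑ r ∈ (Finset.Icc 1 ⌊4 * M⌋₊).filter (fun r => r.Coprime P),
        (2 * E + singularSeries H * |(a : ℝ)|) := by
        refine Finset.sum_le_sum fun r hr => ?_
        obtain ⟨h1, hc⟩ := Finset.mem_filter.1 hr
        obtain ⟨hr1, hr2⟩ := Finset.mem_Icc.1 h1
        have hr0 : (0 : ℝ) < r := by exact_mod_cast hr1
        have hrM : (r : ℝ) ≤ 4 * M := le_trans (by exact_mod_cast hr2) hfl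
        rw [← countAll_shiftTuple_sub H hr1 (by linarith) hyy]
        set z := max (x / (2 * M)) (min (x / M) ((x - a) / r)) with hz
        have hz1 : x / (2 * M) ≤ z := le_max_left _ _
        have hz2 : z ≤ x / M := max_le hyy (min_le_left _ _)
        have b1 := hE r hr1 hrM hc z hz1 hz2
        have b2 := hE r hr1 hrM hc _ le_rfl hyy
        have b3 := abs_max_min_sub_le (a := a) hM0 hr0 hx0
        rw [← hz] at b3
        set G := singularSeries H * (gam H r)⁻¹ with hG
        have hG0 : 0 ≤ G := mul_nonneg hS.le (inv_nonneg.2 (gam_pos hH r).le)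
        -- The crude bound 1/γ(r) ≤ r suffices, being cancelled by the r in |a|/r.
        have b4 : G * |z - x / (2 * M) - x / M * rampWeight (M / r)| ≤
            singularSeries H * |(a : ℝ)| := by
          calc _ ≤ singularSeries H * r * (|(a : ℝ)| / r) := by
                have := inv_gam_le hH (n := r) (by omega)
                gcongr
                exact mul_le_mul_of_nonneg_left this hS.le
            _ = _ := by field_simp
        rw [← abs_of_nonneg hG0, ← abs_mul] at b4
        have e2 : countAll (shiftTuple H a r) z - countAll (shiftTuple H a r) (x / (2 * M)) -
            singularSeries H * (x / M * ((gam H r)⁻¹ * rampWeight (M / r))) =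
            (countAll (shiftTuple H a r) z - G * z) -
            (countAll (shiftTuple H a r) (x / (2 * M)) - G * (x / (2 * M))) +
            G * (z - x / (2 * M) - x / M * rampWeight (M / r)) := by
          rw [hG]; ring
        rw [e2]
        have b5 := abs_add_le ((countAll (shiftTuple H a r) z - G * z) -
            (countAll (shiftTuple H a r) (x / (2 * M)) - G * (x / (2 * M))))
            (G * (z - x / (2 * M) - x / M * rampWeight (M / r)))
        have b6 := abs_sub (countAll (shiftTuple H a r) z - G * z)
            (countAll (shiftTuple H a r) (x / (2 * M)) - G * (x / (2 * M)))
        linarith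
    _ ≤ ∑ r ∈ Finset.Icc 1 ⌊4 * M⌋₊, (2 * E + singularSeries H * |(a : ℝ)|) :=
        Finset.sum_le_sum_of_subset_of_nonneg (Finset.filter_subset _ _)
          fun _ _ _ => by positivity
    _ ≤ _ := by
        rw [Finset.sum_const, Nat.card_Icc, Nat.add_sub_cancel, nsmul_eq_mul]
        gcongr

/-- The dyadic sum for a fixed `x`. -/
lemma abs_dyadicSum_sub_le {H : Fin k → LinForm} (hH : IsAdmissible H) {a : ℤ}
    (hP : prodForms H a ≠ 0) {x M E E' : ℝ}
    (hM : 1 ≤ M) (hx : (a.natAbs : ℝ) + 1 ≤ x / (2 * M))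
    (hE : ∀ r : ℕ, 0 < r → (r : ℝ) ≤ 4 * M → r.Coprime (prodForms H a).natAbs →
      ∀ z, x / (2 * M) ≤ z → z ≤ x / M →
      |countAll (shiftTuple H a r) z - singularSeries H * (gam H r)⁻¹ * z| ≤ E)
    (hE' : |countAll H x - singularSeries H * x| ≤ E') {K : ℝ}
    (hK : ∀ y, 0 < y → |dilSum (kernelFun k (nu H) (prodForms H a).natAbs) dyadicDefect y| ≤
      K * y ^ (1 / 4 : ℝ)) :
    |∑ q ∈ (Finset.Ioc ⌊x / (2 * M)⌋₊ ⌊x / M⌋₊).filter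
        (fun q : ℕ => q.Coprime (prodForms H a).natAbs),
        (countProg H x q a - seq H a - countAll H x / ((q : ℝ) * gam H q)) -
      singularSeries H * (x / M *
        dilSum (kernelFun k (nu H) (prodForms H a).natAbs) rampDefect M)| ≤
      4 * M * (switchBound H (prodForms H a).natAbs x + 2 * E + singularSeries H * |(a : ℝ)|) +
      singularSeries H * K * (M * (x / M) ^ (1 / 4 : ℝ)) +
      E' * (K + |∑' n : ℕ, kernelFun k (nu H) (prodForms H a).natAbs n / n|) := by
  have hM0 : 0 < M := by linarith
  have ha0 : (0 : ℝ) ≤ a.natAbs := Nat.cast_nonneg _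
  have hy0 : (0 : ℝ) < x / (2 * M) := by linarith
  have hx0 : 0 < x := by
    by_contra! h
    exact absurd hy0 (not_lt.2 (div_nonpos_of_nonpos_of_nonneg h (by positivity)))
  have hyy : x / (2 * M) ≤ x / M := by gcongr; linarith
  have hyx : x / M ≤ x := div_le_self hx0.le hM
  have hy1 : 1 ≤ x / M := by linarith
  have hx1 : 1 ≤ x := by linarith
  have hS := singularSeries_pos hH
  have hfl : ((⌊4 * M⌋₊ : ℕ) : ℝ) ≤ 4 * M := Nat.floor_le (by linarith)
  obtain ⟨p₀, hp₀⟩ := hH.exists_nu_eq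
  have hP' : (prodForms H a).natAbs ≠ 0 := Int.natAbs_ne_zero.2 hP
  have s1 := abs_switch_le hH hP hx1 (Finset.Ioc ⌊x / (2 * M)⌋₊ ⌊x / M⌋₊) ⌊4 * M⌋₊
  have s2 := abs_sum_cutSeq_sub_le hH hM hx hE
  have s3 := sum_inv_mul_gam_eq H (prodForms H a).natAbs (y := x / M) (by positivity)
  rw [div_div, mul_comm M 2] at s3
  set P := (prodForms H a).natAbs with hPdef
  have s4 := dilSum_recipGam_eq k hH.nu_lt hp₀ hP' abs_rampWeight_le_sq one_pos
    (c := Real.log 2) (K := 1) (fun u hu => by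
      rw [Real.rpow_one]; exact abs_rampDefect_le hu) hM0
  have s5 := dilSum_recipGam_eq k hH.nu_lt hp₀ hP' abs_dyadicWeight_le_sq (τ := 1 / 4) (by norm_num)
    (c := Real.log 2) (K := 6) (fun u hu => abs_dyadicDefect_le hu) (y := x / M) (by positivity)
  have s6 : |dilSum (kernelFun k (nu H) P) dyadicDefect (x / M)| ≤ K * (x / M) ^ (1 / 4 : ℝ) :=
    hK (x / M) (by positivity)
  change _ = dilSum (kernelFun k (nu H) P) rampDefect M + _ at s4
  change _ = dilSum (kernelFun k (nu H) P) dyadicDefect (x / M) + _ at s5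
  rw [s5] at s3
  rw [s4] at s2
  set K₁ := ∑' n : ℕ, kernelFun k (nu H) P n / n
  set D := dilSum (kernelFun k (nu H) P) rampDefect M
  set D' := dilSum (kernelFun k (nu H) P) dyadicDefect (x / M)
  set I := Finset.Ioc ⌊x / (2 * M)⌋₊ ⌊x / M⌋₊
  set T := ∑ q ∈ I.filter (fun q : ℕ => q.Coprime P), ((q : ℝ) * gam H q)⁻¹
  set S₁ := ∑ q ∈ I.filter (fun q => q.Coprime P), ∑ r ∈ Finset.Icc 1 ⌊4 * M⌋₊, cutSeq H a x q r
  set S₂ := ∑ r ∈ (Finset.Icc 1 ⌊4 * M⌋₊).filter (fun r => r.Coprime P), ∑ q ∈ I, cutSeq H a x q r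
  have e1 : ∑ q ∈ I.filter (fun q : ℕ => q.Coprime P),
        (countProg H x q a - seq H a - countAll H x / ((q : ℝ) * gam H q)) =
      S₁ - countAll H x * T := by
    rw [Finset.mul_sum, ← Finset.sum_sub_distrib]
    refine Finset.sum_congr rfl fun q hq => ?_
    have hq1 := (Finset.mem_Ioc.1 (Finset.mem_filter.1 hq).1).1
    have hq2 := (Nat.floor_lt hy0.le).1 hq1
    have hq3 : a.natAbs < q := by
      have : (a.natAbs : ℝ) < q := by linarith
      exact_mod_cast this
    rw [countProg_eq H hq3 (by linarith) (R := ⌊4 * M⌋₊), add_sub_cancel_left, div_eq_mul_inv]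
    intro r hr
    refine Nat.le_floor ?_
    push_cast at hr
    have h1 : -(a : ℝ) ≤ a.natAbs := by
      rw [Nat.cast_natAbs, Int.cast_abs]; exact neg_le_abs _
    -- From a + qr ≤ x and |a| ≤ x one gets qr ≤ 2x, and q > x/(2M) then gives r ≤ 4M.
    have h2 : (r : ℝ) * (x / (2 * M)) ≤ 2 * x := by
      calc (r : ℝ) * (x / (2 * M)) ≤ r * q := by gcongr
        _ ≤ 2 * x := by linarith
    rw [mul_div_assoc', div_le_iff₀ (by positivity)] at h2
    have h3 : (r : ℝ) * x ≤ 4 * M * x := by linarith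
    exact le_of_mul_le_mul_right h3 hx0
  rw [e1]
  set y := x / M with hy
  have hy0' : 0 < y := by linarith
  have hxy : x = M * y := by rw [hy]; field_simp
  -- Since x = M y, the linear parts 𝔖(H) y M log 2 K₁ of the switched and expected sums are
  -- identical and disappear.
  have e2 : S₁ - countAll H x * T - singularSeries H * (y * D) =
      (S₁ - S₂) + (S₂ - singularSeries H * (y * (D + M * Real.log 2 * K₁))) -
        singularSeries H * (M * D') - (countAll H x - singularSeries H * x) * T := by
    have : singularSeries H * x * T = singularSeries H * M * (y * T) := by rw [hxy]; ring
    rw [sub_mul, this, s3]; ring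
  have b1 : |S₁ - S₂| ≤ 4 * M * switchBound H P x := by
    refine s1.trans ?_
    have := switchBound_nonneg H P hx1
    change _ * switchBound H P x ≤ _
    gcongr
  have b2 : |singularSeries H * (M * D')| ≤ singularSeries H * K * (M * y ^ (1 / 4 : ℝ)) := by
    rw [abs_mul, abs_mul, abs_of_pos hS, abs_of_pos hM0]
    calc _ ≤ singularSeries H * (M * (K * y ^ (1 / 4 : ℝ))) := by gcongr
      _ = _ := by ring
  have hK0 : 0 ≤ K := by
    have := (abs_nonneg _).trans (hK 1 one_pos)
    simpa using this
  have b3 : |T| ≤ K + |K₁| := by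
    have h1 : |y * T| ≤ y * (K + |K₁|) := by
      rw [s3]
      have h2 := abs_add_le D' (y * Real.log 2 * K₁)
      have h3 : K * y ^ (1 / 4 : ℝ) ≤ K * y := by
        gcongr
        calc y ^ (1 / 4 : ℝ) ≤ y ^ (1 : ℝ) :=
              Real.rpow_le_rpow_of_exponent_le hy1 (by norm_num)
          _ = y := Real.rpow_one y
      have h4 : |y * Real.log 2 * K₁| ≤ y * |K₁| := by
        rw [abs_mul, abs_mul, abs_of_pos hy0', abs_of_pos log_two_mem.1]
        gcongr
        exact mul_le_of_le_one_right hy0'.le log_two_mem.2.le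
      linarith
    rw [abs_mul, abs_of_pos hy0'] at h1
    exact le_of_mul_le_mul_left h1 hy0'
  have b4 : |(countAll H x - singularSeries H * x) * T| ≤ E' * (K + |K₁|) := by
    rw [abs_mul]
    have : 0 ≤ E' := (abs_nonneg _).trans hE'
    gcongr
  rw [e2]
  have c1 := abs_sub ((S₁ - S₂) + (S₂ - singularSeries H * (y * (D + M * Real.log 2 * K₁))) -
        singularSeries H * (M * D')) ((countAll H x - singularSeries H * x) * T)
  have c2 := abs_sub ((S₁ - S₂) + (S₂ - singularSeries H * (y * (D + M * Real.log 2 * K₁))))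
        (singularSeries H * (M * D'))
  have c3 := abs_add_le (S₁ - S₂) (S₂ - singularSeries H * (y * (D + M * Real.log 2 * K₁)))
  linarith

lemma exists_switchBound_le (H : Fin k → LinForm) (P : ℕ) :
    ∃ C, 0 ≤ C ∧ ∀ᶠ x : ℝ in atTop, switchBound H P x ≤ C * x ^ (1 / 6 : ℝ) := by
  have hA : (1 : ℝ) ≤ coeffSum H := by exact_mod_cast one_le_coeffSum H
  set A : ℝ := ((coeffSum H : ℤ) : ℝ)
  have hA0 : 0 < A := by linarith
  have ht : Tendsto (fun x : ℝ => A * x) atTop atTop := tendsto_id.const_mul_atTop hA0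
  have ho := ((isLittleO_log_rpow_rpow_atTop (k + 1 : ℕ)
    (by norm_num : (0 : ℝ) < 1 / 6)).bound one_pos)
  refine ⟨3 * k * P.primeFactors.card * A ^ (1 / 6 : ℝ), by positivity, ?_⟩
  filter_upwards [ht.eventually ho, (Real.tendsto_log_atTop.comp ht).eventually_ge_atTop 1,
    eventually_ge_atTop 1] with x h1 h2 hx
  simp only [Function.comp_apply] at h2
  have hx0 : 0 < x := by linarith
  have hAx : 1 ≤ A * x := one_le_mul_of_one_le_of_one_le hA hx
  rw [Real.norm_eq_abs, Real.norm_eq_abs, one_mul, abs_of_nonneg (by positivity),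
    abs_of_nonneg (by positivity), Real.rpow_natCast, Real.mul_rpow hA0.le hx0.le] at h1
  have h3 : (Nat.log 2 ⌊A * x⌋₊ : ℝ) ≤ 2 * Real.log (A * x) := by
    have h4 : 2 ^ Nat.log 2 ⌊A * x⌋₊ ≤ ⌊A * x⌋₊ :=
      Nat.pow_log_le_self 2 (Nat.floor_pos.2 hAx).ne'
    have h5 : (2 : ℝ) ^ Nat.log 2 ⌊A * x⌋₊ ≤ A * x :=
      le_trans (by exact_mod_cast h4) (Nat.floor_le (by linarith))
    have h6 := Real.log_le_log (by positivity) h5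
    rw [Real.log_pow] at h6
    have h7 := Real.log_two_gt_d9
    have h8 : (Nat.log 2 ⌊A * x⌋₊ : ℝ) * (1 / 2) ≤ Nat.log 2 ⌊A * x⌋₊ * Real.log 2 := by
      gcongr; linarith
    linarith
  calc switchBound H P x ≤ k * (P.primeFactors.card * (3 * Real.log (A * x))) *
        Real.log (A * x) ^ k := by
        unfold switchBound
        gcongr
        linarith
    _ = 3 * k * P.primeFactors.card * Real.log (A * x) ^ (k + 1) := by ring
    _ ≤ 3 * k * P.primeFactors.card * (A ^ (1 / 6 : ℝ) * x ^ (1 / 6 : ℝ)) := by gcongr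
    _ = _ := by ring

/-- Raise M³/x ≤ C to the powers 5/6 and 3/4. The exponents 1/6 and 1/4 are the largest for which M³
= O(x) yields a relative saving of M^{-1/2}. -/
lemma cube_power_bounds {x M C : ℝ} (hx : 0 < x) (hM : 1 ≤ M) (hC : 1 ≤ C) (h : M ^ 3 ≤ C * x) :
    M * x ^ (1 / 6 : ℝ) ≤ C * (x / M * M ^ (-(1 / 2) : ℝ)) ∧
      M * (x / M) ^ (1 / 4 : ℝ) ≤ C * (x / M * M ^ (-(1 / 2) : ℝ)) := by
  have hM0 : 0 < M := by linarith
  have h0 : M ^ 3 / x ≤ C := by rwa [div_le_iff₀ hx]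
  have key : ∀ θ : ℝ, 0 ≤ θ → θ ≤ 1 → (M ^ 3) ^ θ * x ^ (-θ) ≤ C := by
    intro θ h1 h2
    rw [Real.rpow_neg hx.le, ← div_eq_mul_inv, ← Real.div_rpow (by positivity) hx.le]
    calc (M ^ 3 / x) ^ θ ≤ C ^ θ := by gcongr
      _ ≤ C ^ (1 : ℝ) := Real.rpow_le_rpow_of_exponent_le hC h2
      _ = C := Real.rpow_one C
  have eM : ∀ θ : ℝ, (M ^ 3) ^ θ = M ^ (3 * θ) := by
    intro θ
    rw [← Real.rpow_natCast, ← Real.rpow_mul hM0.le]; norm_num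
  have e0 : x / M * M ^ (-(1 / 2) : ℝ) = x ^ (1 : ℝ) * M ^ (-(3 / 2) : ℝ) := by
    rw [Real.rpow_one, div_mul_eq_mul_div, mul_div_assoc, ← Real.rpow_sub_one hM0.ne']; norm_num
  have e1 : M * x ^ (1 / 6 : ℝ) =
      (M ^ 3) ^ (5 / 6 : ℝ) * x ^ (-(5 / 6) : ℝ) * (x / M * M ^ (-(1 / 2) : ℝ)) := by
    have a1 : M ^ (3 * (5 / 6) : ℝ) * M ^ (-(3 / 2) : ℝ) = M := by
      rw [← Real.rpow_add hM0]; norm_num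
    have a2 : x ^ (-(5 / 6) : ℝ) * x ^ (1 : ℝ) = x ^ (1 / 6 : ℝ) := by
      rw [← Real.rpow_add hx]; norm_num
    rw [e0, eM, ← a2]
    nth_rewrite 1 [← a1]
    ring
  have e2 : M * (x / M) ^ (1 / 4 : ℝ) =
      (M ^ 3) ^ (3 / 4 : ℝ) * x ^ (-(3 / 4) : ℝ) * (x / M * M ^ (-(1 / 2) : ℝ)) := by
    have a1 : M ^ (3 * (3 / 4) : ℝ) * M ^ (-(3 / 2) : ℝ) = M ^ (3 / 4 : ℝ) := by
      rw [← Real.rpow_add hM0]; norm_num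
    have a2 : x ^ (-(3 / 4) : ℝ) * x ^ (1 : ℝ) = x ^ (1 / 4 : ℝ) := by
      rw [← Real.rpow_add hx]; norm_num
    have a3 : M = M ^ (3 / 4 : ℝ) * M ^ (1 / 4 : ℝ) := by
      rw [← Real.rpow_add hM0]; norm_num
    have a4 : M ^ (1 / 4 : ℝ) ≠ 0 := (Real.rpow_pos_of_pos hM0 _).ne'
    have a5 : M * (x / M) ^ (1 / 4 : ℝ) = M ^ (3 / 4 : ℝ) * x ^ (1 / 4 : ℝ) := by
      rw [Real.div_rpow hx.le hM0.le]
      nth_rewrite 1 [a3]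
      field_simp
    rw [a5, e0, eM, ← a2, ← a1]
    ring
  rw [e1, e2]
  constructor <;> gcongr <;> exact key _ (by norm_num) (by norm_num)

theorem exists_dyadicSum_bound {δ η : ℝ} (hδ : 0 < δ) (hη : 0 < η) {L : ℝ → ℝ}
    (hLmono : MonotoneOn L (Set.Ici 0)) (hLtop : Tendsto L atTop atTop)
    (hreg : ∀ᶠ x : ℝ in atTop, L x ^ (1 + η) ≤ L (x / (2 * L x)) ^ (1 + δ))
    (hHL : UniformHardyLittlewood k δ L) {H : Fin k → LinForm} (hH : IsAdmissible H) {a : ℤ}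
    (hP : prodForms H a ≠ 0)
    {M : ℝ → ℝ} (hMtop : Tendsto M atTop atTop) (hML : ∀ᶠ x : ℝ in atTop, M x ≤ L x) :
    ∃ C, 0 ≤ C ∧ ∀ᶠ x in atTop,
      |∑ q ∈ (Finset.Ioc ⌊x / (2 * M x)⌋₊ ⌊x / M x⌋₊).filter
          (fun q : ℕ => q.Coprime (prodForms H a).natAbs),
          (countProg H x q a - seq H a - countAll H x / ((q : ℝ) * gam H q)) -
        singularSeries H * (x / M x *
          dilSum (kernelFun k (nu H) (prodForms H a).natAbs) rampDefect (M x))| ≤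
        C * (x / M x * M x ^ (-(1 / 2) : ℝ)) := by
  obtain ⟨C₁, hC₁, h₁⟩ := exists_shiftTuple_bound hδ hη hLmono hLtop hreg hHL hH a hMtop hML
  obtain ⟨C₂, hC₂, h₂⟩ := exists_countAll_bound hδ hLtop hHL hH hMtop hML
  obtain ⟨C₃, hC₃, h₃⟩ := exists_cube_le hδ hη hLmono hLtop hreg hHL hH
  obtain ⟨C₄, hC₄, h₄⟩ := exists_switchBound_le H (prodForms H a).natAbs
  obtain ⟨p₀, hp₀⟩ := hH.exists_nu_eq
  have hP' : (prodForms H a).natAbs ≠ 0 := Int.natAbs_ne_zero.2 hP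
  have hS := singularSeries_pos hH
  set P := (prodForms H a).natAbs with hPdef
  set κ := kernelFun k (nu H) P with hκ
  obtain ⟨K, hK0, hK⟩ : ∃ K, 0 ≤ K ∧ ∀ y, 0 < y → |dilSum κ dyadicDefect y| ≤ K * y ^ (1 / 4 : ℝ) :=
    ⟨_, mul_nonneg (by norm_num) (WSummable.nonneg_tsum (α := κ) (σ := 1 / 4)), fun y hy =>
      abs_dilSum_le (wsummable_kernelFun k hH.nu_lt hp₀ hP' (by norm_num))
        (fun u hu => abs_dyadicDefect_le hu) hy⟩
  set K₁ := |∑' n : ℕ, κ n / n|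
  set B := max 1 C₃
  refine ⟨4 * (C₄ * B + 2 * C₁ + singularSeries H * |(a : ℝ)| * B) + singularSeries H * K * B +
    C₂ * (K + K₁), by positivity, ?_⟩
  filter_upwards [h₁, h₂, h₃, h₄, hML, hMtop.eventually_ge_atTop 1, hLtop.eventually_ge_atTop 1,
    (tendsto_div_two_mul hδ hη hLmono hLtop hreg).eventually_ge_atTop ((a.natAbs : ℝ) + 1),
    eventually_ge_atTop 1] with x g₁ g₂ g₃ g₄ hMLx hM hL ha hx
  set m := M x
  have hm0 : 0 < m := by linarith
  have hx0 : 0 < x := by linarith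
  have ha' : (a.natAbs : ℝ) + 1 ≤ x / (2 * m) := ha.trans (by gcongr)
  have hcube : m ^ 3 ≤ B * x := by
    calc m ^ 3 ≤ L x ^ 3 := by gcongr
      _ ≤ C₃ * x := g₃
      _ ≤ B * x := by gcongr; exact le_max_right _ _
  obtain ⟨c₁, c₂⟩ := cube_power_bounds hx0 hM (le_max_left _ _) hcube
  have hmain := abs_dyadicSum_sub_le hH hP hM ha' g₁ g₂ hK
  refine hmain.trans ?_
  set U := x / m * m ^ (-(1 / 2) : ℝ) with hU
  have hU0 : 0 < U := by positivity
  -- The first bound of `cube_power_bounds` is reused, as x^0 ≤ x^{1/6}.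
  have d₁ : m * x ^ (0 : ℝ) ≤ B * U := le_trans
    (by gcongr; norm_num) c₁
  rw [Real.rpow_zero, mul_one] at d₁
  have d₂ : x / m ^ 2 ≤ U := by
    rw [hU, pow_two, ← div_div, div_eq_mul_inv (x / m) m, ← Real.rpow_neg_one]
    gcongr
    norm_num
  have d₃ : m * (x / m / m ^ 2) ≤ U := by
    refine le_trans (le_of_eq ?_) d₂
    field_simp
  calc 4 * m * (switchBound H P x + 2 * (C₁ * (x / m / m ^ 2)) + singularSeries H * |(a : ℝ)|) +
        singularSeries H * K * (m * (x / m) ^ (1 / 4 : ℝ)) + C₂ * (x / m ^ 2) * (K + K₁)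
      ≤ 4 * m * (C₄ * x ^ (1 / 6 : ℝ) + 2 * (C₁ * (x / m / m ^ 2)) +
        singularSeries H * |(a : ℝ)|) +
        singularSeries H * K * (m * (x / m) ^ (1 / 4 : ℝ)) + C₂ * (x / m ^ 2) * (K + K₁) := by
        gcongr
    _ = 4 * (C₄ * (m * x ^ (1 / 6 : ℝ)) + 2 * C₁ * (m * (x / m / m ^ 2)) +
        singularSeries H * |(a : ℝ)| * m) +
        singularSeries H * K * (m * (x / m) ^ (1 / 4 : ℝ)) + C₂ * (x / m ^ 2) * (K + K₁) := by
        ring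
    _ ≤ 4 * (C₄ * (B * U) + 2 * C₁ * U + singularSeries H * |(a : ℝ)| * (B * U)) +
        singularSeries H * K * (B * U) + C₂ * U * (K + K₁) := by
        gcongr
    _ = _ := by ring

/-! ### Normalization and the constant -/

/-- The factor relating the average to the sum over the kernel. -/
noncomputable def averageConst (H : Fin k → LinForm) (a : ℤ) : ℝ :=
  2 * singularSeries H * (((prodForms H a).natAbs.totient : ℝ) / (prodForms H a).natAbs)⁻¹

lemma totient_div_eq {n : ℕ} (hn : n ≠ 0) :
    (n.totient : ℝ) / n = ∏ p ∈ n.primeFactors, (1 - 1 / (p : ℝ)) := by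
  have h := Nat.totient_eq_mul_prod_factors n
  have hn' : (n : ℝ) ≠ 0 := by exact_mod_cast hn
  rw [div_eq_iff hn', mul_comm]
  have h2 := congrArg (Rat.cast : ℚ → ℝ) h
  push_cast at h2
  simpa only [one_div] using h2

/-- The singular series times ∑ `corrFun` is ∏_{p ∣ P} (1 - ν(p)/p), and φ(P)/P is ∏_{p ∣ P} (1 -
1/p). -/
lemma averageConst_mul {H : Fin k → LinForm} (hH : IsAdmissible H) {a : ℤ} (hP : prodForms H a ≠ 0) :
    averageConst H a * ∑' n, corrFun k (nu H) (prodForms H a).natAbs n =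
      2 * ∏ p ∈ (prodForms H a).natAbs.primeFactors, ((p : ℝ) - nu H p) / ((p : ℝ) - 1) := by
  obtain ⟨p₀, hp₀⟩ := hH.exists_nu_eq
  have hP' : (prodForms H a).natAbs ≠ 0 := Int.natAbs_ne_zero.2 hP
  rw [averageConst, mul_right_comm, mul_assoc 2, singularSeries_eq,
    tprod_localFactor_mul_tsum k hH.nu_lt hp₀ hP', totient_div_eq hP', mul_assoc,
    ← Finset.prod_inv_distrib, ← Finset.prod_mul_distrib]
  congr 1
  refine Finset.prod_congr rfl fun p hp => ?_
  have hp' := Nat.prime_of_mem_primeFactors hp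
  have h1 : (1 : ℝ) < p := by exact_mod_cast hp'.one_lt
  have h2 : (p : ℝ) - 1 ≠ 0 := by linarith
  have h3 : (p : ℝ) ≠ 0 := by linarith
  field_simp

theorem exists_dyadicAverage_bound {δ η : ℝ} (hδ : 0 < δ) (hη : 0 < η) {L : ℝ → ℝ}
    (hLmono : MonotoneOn L (Set.Ici 0)) (hLtop : Tendsto L atTop atTop)
    (hreg : ∀ᶠ x : ℝ in atTop, L x ^ (1 + η) ≤ L (x / (2 * L x)) ^ (1 + δ))
    (hHL : UniformHardyLittlewood k δ L) {H : Fin k → LinForm} (hH : IsAdmissible H) {a : ℤ}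
    (hP : prodForms H a ≠ 0)
    {M : ℝ → ℝ} (hMtop : Tendsto M atTop atTop) (hML : ∀ᶠ x : ℝ in atTop, M x ≤ L x) :
    ∃ C, 0 ≤ C ∧ ∀ᶠ x in atTop,
      |dyadicAverage H a x (M x) - averageConst H a *
          dilSum (kernelFun k (nu H) (prodForms H a).natAbs) rampDefect (M x)| ≤
        C * M x ^ (-(1 / 2) : ℝ) := by
  obtain ⟨C, hC, h⟩ := exists_dyadicSum_bound hδ hη hLmono hLtop hreg hHL hH hP hMtop hML
  have hP' : 0 < (prodForms H a).natAbs := Int.natAbs_pos.2 hP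
  have hφ : 0 < ((prodForms H a).natAbs.totient : ℝ) := by exact_mod_cast Nat.totient_pos.2 hP'
  have hP0 : (0 : ℝ) < (prodForms H a).natAbs := by exact_mod_cast hP'
  set φ : ℝ := ((prodForms H a).natAbs.totient : ℝ) / (prodForms H a).natAbs with hφdef
  have hφ0 : 0 < φ := by positivity
  refine ⟨2 * φ⁻¹ * C, by positivity, ?_⟩
  filter_upwards [h, hMtop.eventually_ge_atTop 1, eventually_ge_atTop 1] with x h1 hM hx
  have hm0 : 0 < M x := by linarith
  have hx0 : 0 < x := by linarith
  rw [dyadicAverage, averageConst, ← hφdef]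
  set S := ∑ q ∈ (Finset.Ioc ⌊x / (2 * M x)⌋₊ ⌊x / M x⌋₊).filter
          (fun q : ℕ => q.Coprime (prodForms H a).natAbs),
          (countProg H x q a - seq H a - countAll H x / ((q : ℝ) * gam H q))
  set D := dilSum (kernelFun k (nu H) (prodForms H a).natAbs) rampDefect (M x)
  have e : (φ * (x / (2 * M x)))⁻¹ * S - 2 * singularSeries H * φ⁻¹ * D =
      2 * φ⁻¹ * (x / M x)⁻¹ * (S - singularSeries H * (x / M x * D)) := by
    field_simp
  rw [e, abs_mul, abs_of_pos (by positivity)]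
  calc _ ≤ 2 * φ⁻¹ * (x / M x)⁻¹ * (C * (x / M x * M x ^ (-(1 / 2) : ℝ))) := by gcongr
    _ = _ := by field_simp

end Tuples

end PrimeTuples

theorem theorem2p4 (k : ℕ) (hk : 1 ≤ k) :
    ∃ δk : ℝ, 0 < δk ∧
      ∀ (δ : ℝ) (_hδ : 0 < δ) (L : ℝ → ℝ)
        (_hLmono : MonotoneOn L (Set.Ici 0)) (_hLtop : Tendsto L atTop atTop)
        (_hLreg : ∃ η : ℝ, 0 < η ∧
          ∀ᶠ x : ℝ in atTop, L x ^ (1 + η) ≤ L (x / (2 * L x)) ^ (1 + δ))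
        (_hHL : PrimeTuples.UniformHardyLittlewood k δ L)
        (H : Fin k → PrimeTuples.LinForm) (_hH : PrimeTuples.IsAdmissible H)
        (a : ℤ) (_ha : a ≠ 0) (_hP : PrimeTuples.prodForms H a ≠ 0)
        (M : ℝ → ℝ) (_hMtop : Tendsto M atTop atTop) (_hML : ∀ᶠ x : ℝ in atTop, M x ≤ L x),
        (PrimeTuples.omegaInt (PrimeTuples.prodForms H a) ≤ k →
          (fun x : ℝ => PrimeTuples.dyadicAverage H a x (M x)) ~[atTop]
            (fun x : ℝ => PrimeTuples.mainTerm H a (M x))) ∧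
        (k < PrimeTuples.omegaInt (PrimeTuples.prodForms H a) →
          (fun x : ℝ => PrimeTuples.dyadicAverage H a x (M x)) =O[atTop]
            (fun x : ℝ => M x ^ (-δk))) := by
  -- The rate starts at 1 for `rampDefect` and is divided by 4 for each of the k pairings.
  refine ⟨1 / 4 ^ k, by positivity, ?_⟩
  rintro δ hδ L hLmono hLtop ⟨η, hη, hreg⟩ hHL H hH a - hP M hMtop hML
  obtain ⟨C, hC, hC'⟩ := PrimeTuples.exists_dyadicAverage_bound hδ hη hLmono hLtop hreg hHL hH hP
    hMtop hML
  obtain ⟨p₀, hp₀⟩ := hH.exists_nu_eq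
  have hP' : (PrimeTuples.prodForms H a).natAbs ≠ 0 := Int.natAbs_ne_zero.2 hP
  have hcorr := PrimeTuples.wsummable_corrFun k hH.nu_lt hp₀ hP'
  have hprime : ∀ p ∈ (PrimeTuples.prodForms H a).natAbs.primeFactors, 1 < p := fun p hp =>
    (Nat.prime_of_mem_primeFactors hp).one_lt
  have hc := PrimeTuples.averageConst_mul hH hP
  set c := PrimeTuples.averageConst H a
  constructor
  · intro hω
    have ht := ((PrimeTuples.tendsto_dilSum_of_card_le PrimeTuples.hasLimitRate_rampDefect
      (hcorr.mono (by norm_num)) hprime hω).comp hMtop).const_mul c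
    set j := k - PrimeTuples.omegaInt (PrimeTuples.prodForms H a) with hj
    set A : ℝ := ∏ p ∈ (PrimeTuples.prodForms H a).natAbs.primeFactors,
      ((p : ℝ) - (PrimeTuples.nu H p : ℝ)) / ((p : ℝ) - 1) * Real.log (p : ℝ) with hA
    have hA0 : 0 < A := by
      refine Finset.prod_pos fun p hp => ?_
      have h1 : (1 : ℝ) < p := by exact_mod_cast hprime p hp
      have h2 : (PrimeTuples.nu H p : ℝ) < p := by
        exact_mod_cast hH.nu_lt p (Nat.prime_of_mem_primeFactors hp)
      exact mul_pos (div_pos (by linarith) (by linarith)) (Real.log_pos h1)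
    have hj0 : (0 : ℝ) < j.factorial := by exact_mod_cast j.factorial_pos
    -- The factor -1/2 is the limit -1/4 of `rampDefect` times the 2 of `averageConst_mul`.
    set c₀ : ℝ := -(A / (2 * j.factorial)) with hc₀
    have hc₀0 : c₀ ≠ 0 := by rw [hc₀]; exact neg_ne_zero.2 (by positivity)
    have hmain : ∀ x, PrimeTuples.mainTerm H a (M x) = c₀ * Real.log (M x) ^ j := by
      intro x
      rw [PrimeTuples.mainTerm, ← hj, ← hA, hc₀]; ring
    have ht1 : Tendsto (fun x => PrimeTuples.dyadicAverage H a x (M x) / Real.log (M x) ^ j) atTop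
        (nhds c₀) := by
      have hz : Tendsto (fun x => C * M x ^ (-(1 / 2) : ℝ)) atTop (nhds 0) := by
        simpa using ((tendsto_rpow_neg_atTop (by norm_num : (0 : ℝ) < 1 / 2)).comp hMtop).const_mul C
      have hdiff : Tendsto (fun x => PrimeTuples.dyadicAverage H a x (M x) / Real.log (M x) ^ j -
          c * (PrimeTuples.dilSum (PrimeTuples.kernelFun k (PrimeTuples.nu H)
            (PrimeTuples.prodForms H a).natAbs) PrimeTuples.rampDefect (M x) /
            Real.log (M x) ^ j)) atTop (nhds 0) := by
        refine squeeze_zero_norm' ?_ hz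
        filter_upwards [hC', (Real.tendsto_log_atTop.comp hMtop).eventually_ge_atTop 1] with x h1 h2
        simp only [Function.comp_apply] at h2
        have h3 : 1 ≤ Real.log (M x) ^ j := one_le_pow₀ h2
        rw [← mul_div_assoc, ← sub_div, norm_div, Real.norm_eq_abs, Real.norm_eq_abs,
          abs_of_pos (by linarith : 0 < Real.log (M x) ^ j)]
        exact (div_le_self (abs_nonneg _) h3).trans h1
      have := hdiff.add ht
      rw [zero_add] at this
      convert this using 2
      · simp [PrimeTuples.kernelFun, hj, PrimeTuples.omegaInt]
      · rw [mul_comm _ (∑' n, _), ← mul_assoc, hc, hc₀, hA, Finset.prod_mul_distrib]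
        change _ = _ * (_ / (j.factorial : ℝ))
        field_simp
        ring
    refine isEquivalent_of_tendsto_one ?_
    have h2 := ht1.div_const c₀
    rw [div_self hc₀0] at h2
    refine h2.congr fun x => ?_
    simp only [Pi.div_apply, hmain]
    rw [div_div, mul_comm]
  · intro hω
    obtain ⟨K, hK⟩ := PrimeTuples.abs_dilSum_le_of_lt_card PrimeTuples.hasLimitRate_rampDefect
      hcorr hprime hk hω
    refine IsBigO.of_bound (|c| * K + C) ?_
    filter_upwards [hC', hMtop.eventually_ge_atTop 1] with x h1 hM
    have hM0 : 0 < M x := by linarith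
    have h2 := hK (M x) hM0
    -- As k ≥ 1, the rate 1/4^k is at most 1/4, so the approximation error M^{-1/2} is absorbed.
    have h3 : M x ^ (-(1 / 2) : ℝ) ≤ M x ^ (-(1 / 4 ^ k) : ℝ) := by
      refine Real.rpow_le_rpow_of_exponent_le hM (neg_le_neg ?_)
      have : (4 : ℝ) ^ 1 ≤ 4 ^ k := pow_le_pow_right₀ (by norm_num) hk
      gcongr
      linarith
    rw [Real.norm_eq_abs, Real.norm_eq_abs, abs_of_pos (Real.rpow_pos_of_pos hM0 _)]
    change |PrimeTuples.dilSum (PrimeTuples.kernelFun k (PrimeTuples.nu H) _) _ _| ≤ _ at h2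
    set D := PrimeTuples.dilSum (PrimeTuples.kernelFun k (PrimeTuples.nu H)
      (PrimeTuples.prodForms H a).natAbs) PrimeTuples.rampDefect (M x)
    have h4 : |c * D| ≤ |c| * (K * M x ^ (-(1 / 4 ^ k) : ℝ)) := by rw [abs_mul]; gcongr
    have h5 := abs_add_le (PrimeTuples.dyadicAverage H a x (M x) - c * D) (c * D)
    rw [sub_add_cancel] at h5
    have h6 : C * M x ^ (-(1 / 2) : ℝ) ≤ C * M x ^ (-(1 / 4 ^ k) : ℝ) := by gcongr
    linarith
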